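/- Let $\Bbbk$ be a field, $q\ge 1$, $n_1,\dots,n_q\ge 1$, and let $\Bbbk[\mathbf x]$ be the polynomial ring in the variables $x_{p,i}$ ($1\le p\le q$, $0\le i\le n_p$), $\mathbb N^q$-graded by giving $x_{p,i}$ the multidegree $\mathbf e_p$ (the $p$-th standard basis vector). Order $\mathbb N^q$ componentwise; "for $\nu$ large enough" means for all $\nu\ge\nu_0$, for some $\nu_0\in\mathbb N^q$. Let $I\subseteq\Bbbk[\mathbf x]$ be a multihomogeneous ideal, $M=\Bbbk[\mathbf x]/I$, and let $r$ be the relevant dimension of $M$: the total degree of its Hilbert polynomial (the polynomial that equals $\dim_\Bbbk M_\nu$ for $\nu$ large enough), with $r=-1$ if this polynomial is zero. Let $\mathbf d=(\mathbf d^{(0)},\dots,\mathbf d^{(r)})$ be a sequence of nonzero elements of $\mathbb N^q$. Let $A=\Bbbk[\mathbf u]$ be the polynomial ring in variables $u^{(i)}_{\mathfrak m}$, where $0\le i\le r$ and $\mathfrak m$ runs over the monomials of multidegree $\mathbf d^{(i)}$ in $\mathbf x$, and let $U_i=\sum_{\mathfrak m}u^{(i)}_{\mathfrak m}\mathfrak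 m\in A[\mathbf x]$ be the generic polynomials. Put $\underline U=(U_0,\dots,U_r)$, $M[\mathbf u]=M\otimes_\Bbbk A$ and $\mathcal M(I)=M[\mathbf u]/(\underline U)M[\mathbf u]$. Fix a set $\operatorname{irr}(A)$ of representatives, up to units, of the irreducible elements of $A$. The content of a finitely generated torsion $A$-module $N$ is $\chi_A(N)=\prod_{\pi\in\operatorname{irr}(A)}\pi^{\ell(N_{(\pi)})}$, where $\ell(N_{(\pi)})$ is the length of the localization of $N$ at the prime $(\pi)$. The Cayley determinant of a complex $0\to C_s\to\dots\to C_0\to0$ of free $A$-modules of finite rank which becomes exact over $F=\operatorname{Frac}(A)$ is the class in $F^\times/A^\times$ of $\prod_{i=1}^{s}\det(\varphi_i)^{(-1)^{i+1}}$, where for bases of the $C_i$ and partitions of these bases into $b_i'\cup b_i''$, with $b_0''=b_s'=\emptyset$, $\varphi_i$ is the block of the matrix of $C_i\to C_{i-1}$ with columns in $b_i''$ and rows in $b_{i-1}'$, the choices being such that every $\varphi_i$ is square with nonzero determinant. Then: (a) There is a polynomial $\mathrm{Res}_{\mathbf d}(I)\in A$, the Rémond resultant form of index $\mathbf d$ of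 $I$, such that for $\nu$ large enough $\mathcal M(I)_\nu$ is a torsion $A$-module with $\chi_A(\mathcal M(I)_\nu)=\mathrm{Res}_{\mathbf d}(I)$. (b) The M-resultant $\mathrm{Kres}_A(\underline U,M[\mathbf u])$ is defined. That is, $M[\mathbf u]$ is a finitely generated multigraded $A[\mathbf x]$-module whose components are free of finite rank over $A$, its relevant dimension (defined with $\operatorname{rank}_A$ in place of $\dim_\Bbbk$) is $r$, $\underline U$ is a filter-regular sequence for $M[\mathbf u]$ (for each $i$, multiplication by $U_i$ is injective on the component of multidegree $\nu$ of $M[\mathbf u]/(U_0,\dots,U_{i-1})M[\mathbf u]$ for $\nu$ large enough), and, for $\nu$ large enough, the component $\mathbf K^\nu_\bullet(\underline U,M[\mathbf u])$ of multidegree $\nu$ of the multigraded Koszul complex of $\underline U$ with coefficients in $M[\mathbf u]$ becomes exact over $\operatorname{Frac}(A)$ and its Cayley determinant, which is well defined modulo $A^\times=\Bbbk^\times$, is the class modulo $A^\times$ of an element of $A$ independent of $\nu$; this class is $\mathrm{Kres}_A(\underline U,M[\mathbf u])$. (c) $\mathrm{Res}_{\mathbf d}(I)=\mathrm{Kres}_A(\underline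 U,M[\mathbf u])\pmod{\Bbbk^\times}$. -/

import Mathlib

open Filter

set_option linter.unusedSectionVars false

noncomputable section

namespace MultiRes

universe u v

/-! ## Multigraded polynomial rings

Multidegrees are the elements of `Fin q → ℕ`, with the componentwise order. -/

/-- The index set of the variables `x_{p,i}`, `p = 1, …, q`, `i = 0, …, n_p`. -/
abbrev Vars {q : ℕ} (n : Fin q → ℕ) : Type := Σ p : Fin q, Fin (n p + 1)

/-- The multidegree `e_p` of the variable `x_{p,i}`. -/
def varDeg {q : ℕ} (n : Fin q → ℕ) : Vars n → (Fin q → ℕ) := fun x => Pi.single x.1 1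

/-- The multigrading of `A[x]`: constants have multidegree `0` and `x_{p,i}` has
multidegree `e_p`. -/
abbrev polyGrading (A : Type*) [CommRing A] {q : ℕ} (n : Fin q → ℕ) :
    (Fin q → ℕ) → Submodule A (MvPolynomial (Vars n) A) :=
  MvPolynomial.weightedHomogeneousSubmodule A (varDeg n)

instance polyGrading.gradedAlgebra (A : Type*) [CommRing A] {q : ℕ} (n : Fin q → ℕ) :
    GradedAlgebra (polyGrading A n) :=
  MvPolynomial.weightedGradedAlgebra A (varDeg n)

/-- The finite set of (exponents of) monomials of multidegree `δ` in the variables `x`. -/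
def monomials {q : ℕ} (n : Fin q → ℕ) (δ : Fin q → ℕ) : Finset (Vars n →₀ ℕ) :=
  (Finset.Iic (Finsupp.equivFunOnFinite.symm fun x : Vars n => δ x.1)).filter
    fun e => Finsupp.weight (varDeg n) e = δ

theorem mem_monomials {q : ℕ} (n : Fin q → ℕ) (δ : Fin q → ℕ) (e : Vars n →₀ ℕ) :
    e ∈ monomials n δ ↔ Finsupp.weight (varDeg n) e = δ := by
  classical
  simp only [monomials, Finset.mem_filter, Finset.mem_Iic, and_iff_right_iff_imp]
  intro h x
  have h1 : Finsupp.weight (varDeg n) e x.1 = δ x.1 := congrFun h x.1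
  rw [Finsupp.weight_apply, Finsupp.sum, Finset.sum_apply] at h1
  by_cases hx : x ∈ e.support
  · have h2 := (Finset.single_le_sum (f := fun y => (e y • varDeg n y) x.1)
      (fun _ _ => Nat.zero_le _) hx).trans h1.le
    simp only [varDeg, Pi.smul_apply, Pi.single_eq_same, smul_eq_mul, mul_one] at h2
    simpa using h2
  · simp [Finsupp.notMem_support_iff.1 hx]

/-! ## Multigraded modules -/

section Modules

variable {q : ℕ} (A : Type*) [CommRing A] {R : Type*} [CommRing R] [Algebra A R]
  {M : Type*} [AddCommGroup M] [Module A M] [Module R M] [IsScalarTower A R M]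

/-- Compatibility of the families of submodules `𝒜 ν` of `R` and `𝒢 ν` of `M`:
`𝒜 a • 𝒢 b ⊆ 𝒢 (a + b)`. -/
def IsGradedSMul (𝒜 : (Fin q → ℕ) → Submodule A R) (𝒢 : (Fin q → ℕ) → Submodule A M) : Prop :=
  ∀ (a b : Fin q → ℕ) (x : R) (m : M), x ∈ 𝒜 a → m ∈ 𝒢 b → x • m ∈ 𝒢 (a + b)

/-- The family of submodules `𝒢 ν` makes `M` a multigraded module over the multigraded ring `R`
with components `𝒜 ν`. -/
structure IsMultigraded (𝒜 : (Fin q → ℕ) → Submodule A R) (𝒢 : (Fin q → ℕ) → Submodule A M) :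
    Prop where
  smul_mem : IsGradedSMul A 𝒜 𝒢
  isInternal : DirectSum.IsInternal 𝒢

/-- The components `(M/P)_ν = M_ν/(P ∩ M_ν)` of a quotient, as submodules of `M/P`. -/
def quotGrading (𝒢 : (Fin q → ℕ) → Submodule A M) (P : Submodule R M) (ν : Fin q → ℕ) :
    Submodule A (M ⧸ P) :=
  (𝒢 ν).map (P.mkQ.restrictScalars A)

/-- `P` is the Hilbert polynomial of the multigraded module `M`: it takes the value
`rank_A (M_ν)` at every large enough `ν`. -/
def IsHilbertPoly (𝒢 : (Fin q → ℕ) → Submodule A M) (P : MvPolynomial (Fin q) ℚ) : Prop :=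
  ∀ᶠ ν : Fin q → ℕ in atTop,
    (Module.finrank A (𝒢 ν) : ℚ) = MvPolynomial.eval (fun p => (ν p : ℚ)) P

open Classical in
/-- The Hilbert polynomial of a multigraded module (`0` if there is none). -/
def hilbertPoly (𝒢 : (Fin q → ℕ) → Submodule A M) : MvPolynomial (Fin q) ℚ :=
  if h : ∃ P, IsHilbertPoly A 𝒢 P then h.choose else 0

open Classical in
/-- The relevant dimension: the total degree of the Hilbert polynomial, or `-1` if that
polynomial is zero. -/
def relevantDim (𝒢 : (Fin q → ℕ) → Submodule A M) : ℤ :=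
  if hilbertPoly A 𝒢 = 0 then -1 else ((hilbertPoly A 𝒢).totalDegree : ℤ)

/-- `f` is filter-regular for `M`: the colon submodule `(0 :_M f)` is eventually zero. -/
def IsFilterRegular (𝒢 : (Fin q → ℕ) → Submodule A M) (f : R) : Prop :=
  ∀ᶠ ν : Fin q → ℕ in atTop, ∀ m ∈ 𝒢 ν, f • m = 0 → m = 0

variable (M) in
/-- The submodule `(f_j : j < i) M`. -/
def initialSubmodule {s : ℕ} (f : Fin s → R) (i : Fin s) : Submodule R M :=
  Ideal.span (f '' {j | j < i}) • ⊤

/-- `f_0, …, f_{s-1}` is a filter-regular sequence for `M`: each `f_i` is filter-regular for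
`M/(f_0, …, f_{i-1})M`. -/
def IsFilterRegularSeq {s : ℕ} (𝒢 : (Fin q → ℕ) → Submodule A M) (f : Fin s → R) : Prop :=
  ∀ i, IsFilterRegular A (quotGrading A 𝒢 (initialSubmodule M f i)) (f i)

variable (M) in
/-- The submodule `(f)M = (f_0, …, f_{s-1})M`. -/
def seqSubmodule {s : ℕ} (f : Fin s → R) : Submodule R M :=
  Ideal.span (Set.range f) • ⊤

/-- A componentwise free module: finitely generated and multigraded, with components that are free
of finite rank over `A`. -/
structure IsComponentwiseFree (𝒜 : (Fin q → ℕ) → Submodule A R)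
    (𝒢 : (Fin q → ℕ) → Submodule A M) : Prop where
  finite : Module.Finite R M
  multigraded : IsMultigraded A 𝒜 𝒢
  free_component : ∀ ν, Module.Free A (𝒢 ν)
  finite_component : ∀ ν, Module.Finite A (𝒢 ν)

end Modules

/-! ## The multigraded Koszul complex -/

section Koszul

variable {q s : ℕ}

/-- The index set of the basis `e_{i_1} ∧ ⋯ ∧ e_{i_p}`, `i_1 < ⋯ < i_p`, of the `p`-th exterior
power of `L = R^s`. Thus the `p`-th Koszul module `(⋀^p L) ⊗ M` is `KIdx s p → M`. -/
abbrev KIdx (s p : ℕ) : Type := {S : Finset (Fin s) // S.card = p}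

/-- `S ∪ {i}` as an index, for `i ∉ S`. -/
def KIdx.insert {p : ℕ} (S : KIdx s p) (i : {i : Fin s // i ∉ S.1}) : KIdx s (p + 1) :=
  ⟨Insert.insert i.1 S.1, by rw [Finset.card_insert_of_notMem i.2, S.2]⟩

/-- The Koszul differential, which maps `e_{i_0} ∧ ⋯ ∧ e_{i_p} ⊗ m` to
`∑_t (-1)^t e_{i_0} ∧ ⋯ (omit e_{i_t}) ⋯ ∧ e_{i_p} ⊗ f_{i_t} m`. In coordinates, the coefficient of
`e_S` collects the contributions of the `e_{S ∪ {i}}` with `i ∉ S`, and `i` is preceded in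
`S ∪ {i}` by the elements of `S` smaller than `i`. -/
def koszulD {R : Type*} [CommRing R] (M : Type*) [AddCommGroup M] [Module R M]
    (f : Fin s → R) (p : ℕ) : (KIdx s (p + 1) → M) →ₗ[R] (KIdx s p → M) :=
  LinearMap.pi fun S => ∑ i : {i : Fin s // i ∉ S.1},
    ((-1 : R) ^ (S.1.filter (· < i.1)).card * f i.1) • LinearMap.proj (S.insert i)

theorem koszulD_koszulD {R M : Type*} [CommRing R] [AddCommGroup M] [Module R M]
    (f : Fin s → R) (p : ℕ) (c : KIdx s (p + 2) → M) :
    koszulD M f p (koszulD M f (p + 1) c) = 0 := by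
  funext S
  simp only [koszulD, LinearMap.pi_apply, LinearMap.sum_apply, LinearMap.smul_apply,
    LinearMap.proj_apply, Finset.smul_sum, Pi.zero_apply]
  rw [Finset.sum_sigma']
  refine Finset.sum_involution (fun x _ => ⟨⟨x.2.1, fun h => x.2.2 (Finset.mem_insert_of_mem h)⟩, ⟨x.1.1, by
      have := x.2.2
      simp only [KIdx.insert, Finset.mem_insert, not_or] at this ⊢
      exact ⟨fun h => this.1 h.symm, x.1.2⟩⟩⟩) ?_ ?_ ?_ ?_
  · rintro ⟨⟨i, hi⟩, ⟨j, hj⟩⟩ _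
    simp only [KIdx.insert, Finset.mem_insert, not_or] at hj
    have e : (KIdx.insert (KIdx.insert S ⟨i,hi⟩) ⟨j, by simpa [KIdx.insert] using hj⟩) =
        (KIdx.insert (KIdx.insert S ⟨j,hj.2⟩) ⟨i, by
          simpa [KIdx.insert] using ⟨fun h => hj.1 h.symm, hi⟩⟩) := by
      apply Subtype.ext; simp [KIdx.insert, Finset.insert_comm]
    simp only [e, smul_smul, ← add_smul]
    convert zero_smul R _
    simp only [KIdx.insert, Finset.filter_insert]
    rcases lt_or_gt_of_ne hj.1 with h | h
    · rw [if_neg (not_lt.2 h.le), if_pos h, Finset.card_insert_of_notMem (by simp [hj.2]), pow_succ]; ring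
    · rw [if_pos h, if_neg (not_lt.2 h.le), Finset.card_insert_of_notMem (by simp [hi]), pow_succ]; ring
  · rintro ⟨⟨i, hi⟩, ⟨j, hj⟩⟩ _ _ h
    simp only [KIdx.insert, Finset.mem_insert, not_or] at hj
    simp only [Sigma.mk.injEq, Subtype.mk.injEq] at h
    exact hj.1 h.1
  · intros; simp
  · rintro ⟨⟨i, hi⟩, ⟨j, hj⟩⟩ _; rfl

variable {A : Type*} [CommRing A] {R : Type*} [CommRing R] [Algebra A R]
  {M : Type*} [AddCommGroup M] [Module A M] [Module R M] [IsScalarTower A R M]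

/-- The component of multidegree `ν` of `M` shifted by `δ`: it is `M_{ν-δ}`, and it is zero unless
`δ ≤ ν`. -/
def shiftedPiece (𝒢 : (Fin q → ℕ) → Submodule A M) (δ ν : Fin q → ℕ) : Submodule A M :=
  open Classical in if δ ≤ ν then 𝒢 (ν - δ) else ⊥

/-- The component of multidegree `ν` of the `p`-th Koszul module: `e_S ⊗ m` has multidegree
`∑_{i ∈ S} d_i + deg m`. -/
def koszulSlice (𝒢 : (Fin q → ℕ) → Submodule A M) (d : Fin s → Fin q → ℕ) (ν : Fin q → ℕ) (p : ℕ) :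
    Submodule A (KIdx s p → M) :=
  Submodule.pi Set.univ fun S => shiftedPiece 𝒢 (∑ i ∈ S.1, d i) ν

theorem smul_mem_shiftedPiece {𝒜 : (Fin q → ℕ) → Submodule A R}
    {𝒢 : (Fin q → ℕ) → Submodule A M}
    (h𝒢 : IsGradedSMul A 𝒜 𝒢)
    {e δ ν : Fin q → ℕ} {x : R} {m : M} (hx : x ∈ 𝒜 e) (hm : m ∈ shiftedPiece 𝒢 (e + δ) ν) :
    x • m ∈ shiftedPiece 𝒢 δ ν := by
  unfold shiftedPiece at *
  by_cases h : e + δ ≤ ν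
  · have h1 : δ ≤ ν := le_trans le_add_self h
    rw [if_pos h] at hm
    rw [if_pos h1]
    have h2 : ν - δ = e + (ν - (e + δ)) := by
      funext p
      have := h p
      simp only [Pi.sub_apply, Pi.add_apply] at *
      omega
    rw [h2]
    exact h𝒢 _ _ _ _ hx hm
  · rw [if_neg h] at hm
    rw [(Submodule.mem_bot A).1 hm, smul_zero]
    exact zero_mem _

theorem koszulD_mem {𝒜 : (Fin q → ℕ) → Submodule A R} {𝒢 : (Fin q → ℕ) → Submodule A M}
    (h𝒢 : IsGradedSMul A 𝒜 𝒢)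
    {d : Fin s → Fin q → ℕ} {f : Fin s → R} (hf : ∀ i, f i ∈ 𝒜 (d i)) (ν : Fin q → ℕ) (p : ℕ)
    (c : KIdx s (p + 1) → M) (hc : c ∈ koszulSlice 𝒢 d ν (p + 1)) :
    (koszulD M f p).restrictScalars A c ∈ koszulSlice 𝒢 d ν p := by
  intro S _
  simp only [LinearMap.coe_restrictScalars, koszulD, LinearMap.pi_apply, LinearMap.sum_apply,
    LinearMap.smul_apply, LinearMap.proj_apply]
  refine Submodule.sum_mem _ fun i _ => ?_
  have h := hc (S.insert i) (Set.mem_univ _)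
  simp only [KIdx.insert, Finset.sum_insert i.2] at h
  have h1 := smul_mem_shiftedPiece h𝒢 (hf i.1) h
  rw [mul_smul]
  rcases neg_one_pow_eq_or R (S.1.filter (· < i.1)).card with h2 | h2
  · rw [h2, one_smul]; exact h1
  · rw [h2, neg_one_smul]; exact neg_mem h1

/-- The differentials of the slice of multidegree `ν` of the Koszul complex `K_•(f, M)`. -/
def koszulSliceD {𝒜 : (Fin q → ℕ) → Submodule A R} {𝒢 : (Fin q → ℕ) → Submodule A M}
    (h𝒢 : IsGradedSMul A 𝒜 𝒢)
    {d : Fin s → Fin q → ℕ} {f : Fin s → R} (hf : ∀ i, f i ∈ 𝒜 (d i)) (ν : Fin q → ℕ) (p : ℕ) :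
    koszulSlice 𝒢 d ν (p + 1) →ₗ[A] koszulSlice 𝒢 d ν p :=
  ((koszulD M f p).restrictScalars A).restrict (koszulD_mem h𝒢 hf ν p)

end Koszul

/-! ## Cayley determinants -/

section Cayley

variable (A : Type*) [CommRing A] [IsDomain A] (C : ℕ → Type*) [∀ i, AddCommGroup (C i)]
  [∀ i, Module A (C i)] (D : ∀ i, C (i + 1) →ₗ[A] C i)

/-- The complex `⋯ → C_1 → C_0 → 0` is generically exact: it becomes exact after tensoring with
the fraction field of `A`. -/
def IsGenericallyExact : Prop :=
  Function.Surjective ((D 0).baseChange (FractionRing A)) ∧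
    ∀ i, Function.Exact ((D (i + 1)).baseChange (FractionRing A))
      ((D i).baseChange (FractionRing A))

/-- A choice of bases and of partitions, as needed to compute the Cayley determinant of a complex
`0 → C_s → ⋯ → C_0 → 0`. The basis of `C_i` is divided into a first part `b'_i` with `rk (i + 1)`
elements and a second part `b''_i` with `rk i` elements, with `b''_0` and `b'_s` empty. The matrix
of `D i : C_{i+1} → C_i` has blocks `(a φ; b c)`, where the block `φ`, with rows in `b'_i` and
columns in `b''_{i+1}`, is square of size `rk (i + 1)` and has nonzero determinant. -/
structure CayleyData (s : ℕ) where
  rk : ℕ → ℕ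
  rk_zero : rk 0 = 0
  rk_of_lt : ∀ i, s < i → rk i = 0
  basis : ∀ i, Module.Basis (Fin (rk (i + 1)) ⊕ Fin (rk i)) A (C i)
  det_ne_zero : ∀ i, (LinearMap.toMatrix (basis (i + 1)) (basis i) (D i)).toBlocks₁₂.det ≠ 0

/-- The Cayley determinant `det(φ_1) det(φ_2)⁻¹ det(φ_3) ⋯` with respect to a choice of bases and
partitions, as an element of the fraction field. -/
def CayleyData.det {A : Type*} [CommRing A] [IsDomain A] {C : ℕ → Type*}
    [∀ i, AddCommGroup (C i)] [∀ i, Module A (C i)] {D : ∀ i, C (i + 1) →ₗ[A] C i} {s : ℕ}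
    (b : CayleyData A C D s) : FractionRing A :=
  ∏ i ∈ Finset.range s, (algebraMap A (FractionRing A)
    (LinearMap.toMatrix (b.basis (i + 1)) (b.basis i) (D i)).toBlocks₁₂.det) ^ ((-1 : ℤ) ^ i)

/-- The class modulo `Aˣ` of the element `x` is the Cayley determinant of the complex: bases and
partitions as required exist, and for every choice of them the determinant agrees with `x` up to
a unit of `A`. -/
def IsCayleyDet (s : ℕ) (x : A) : Prop :=
  Nonempty (CayleyData A C D s) ∧
    ∀ b : CayleyData A C D s, ∃ c : Aˣ, b.det = algebraMap A (FractionRing A) (c * x)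

end Cayley

/-! ## Contents of torsion modules -/

section Content

variable (A : Type*) [CommRing A] [UniqueFactorizationMonoid A]

/-- A choice of representatives for the irreducible elements of `A`, up to units. -/
structure IrrSystem where
  carrier : Set A
  irreducible : ∀ π ∈ carrier, Irreducible π
  existsUnique_associated : ∀ x : A, Irreducible x → ∃! π, π ∈ carrier ∧ Associated π x

variable {A}

theorem isPrime_span_of_irreducible {π : A} (h : Irreducible π) : (Ideal.span {π}).IsPrime :=
  (Ideal.span_singleton_prime h.ne_zero).2 h.prime

/-- The length of the localization `N_{(π)}` over the local ring `A_{(π)}`. -/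
def localLength (N : Type*) [AddCommGroup N] [Module A N] {π : A} (h : Irreducible π) : ℕ :=
  haveI := isPrime_span_of_irreducible h
  (Module.length (Localization.AtPrime (Ideal.span {π}))
    (LocalizedModule (Ideal.span {π}).primeCompl N)).toNat

/-- The content `χ_A(N)` of a finitely generated torsion module `N`: the product of the
`π ^ ℓ(N_{(π)})` over the chosen irreducible elements. -/
def content (irr : IrrSystem A) (N : Type*) [AddCommGroup N] [Module A N] : A :=
  ∏ᶠ π : irr.carrier, π.1 ^ localLength N (irr.irreducible π.1 π.2)

end Content

/-! ## The M-resultant -/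

/-- The class modulo `Aˣ` of `x` is the M-resultant of the sequence `f_0, …, f_{s-1}` with respect
to `M`. This is defined if `M` is a componentwise free `A[x]`-module of relevant dimension `s - 1`
and `f` is a filter-regular sequence for `M`, with `f_i` multihomogeneous of multidegree `d_i`;
then the slices of large enough multidegree of the Koszul complex are generically exact, and their
Cayley determinant is the class of `x`. -/
structure IsMResultant {A : Type*} [CommRing A] [IsDomain A] {q s : ℕ} {n : Fin q → ℕ}
    {M : Type*} [AddCommGroup M] [Module A M] [Module (MvPolynomial (Vars n) A) M]
    [IsScalarTower A (MvPolynomial (Vars n) A) M] (𝒢 : (Fin q → ℕ) → Submodule A M)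
    (h𝒢 : IsGradedSMul A (polyGrading A n) 𝒢)
    (d : Fin s → Fin q → ℕ) (f : Fin s → MvPolynomial (Vars n) A)
    (hf : ∀ i, f i ∈ polyGrading A n (d i)) (x : A) : Prop where
  componentwiseFree : IsComponentwiseFree A (polyGrading A n) 𝒢
  relevantDim_eq : relevantDim A 𝒢 = (s : ℤ) - 1
  filterRegular : IsFilterRegularSeq A 𝒢 f
  eventually_det : ∀ᶠ ν : Fin q → ℕ in atTop,
    IsGenericallyExact A (fun p => koszulSlice 𝒢 d ν p) (koszulSliceD h𝒢 hf ν) ∧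
      IsCayleyDet A (fun p => koszulSlice 𝒢 d ν p) (koszulSliceD h𝒢 hf ν) s x

/-! ## Generic polynomials and the resultant form -/

section Generic

variable (k : Type u) [Field k] {q s : ℕ} (n : Fin q → ℕ) (d : Fin s → Fin q → ℕ)

/-- The index set of the generic coefficients `u^{(i)}_m`, where `m` is a monomial of multidegree
`d_i`. -/
abbrev CoeffIdx : Type := Σ i : Fin s, monomials n (d i)

/-- The ring `k[u]`. -/
abbrev CoeffRing : Type u := MvPolynomial (CoeffIdx n d) k

/-- The generic polynomial `U_i = ∑_m u^{(i)}_m m` of multidegree `d_i`. -/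
def genericPoly (i : Fin s) : MvPolynomial (Vars n) (CoeffRing k n d) :=
  ∑ m : monomials n (d i), MvPolynomial.monomial m.1 (MvPolynomial.X ⟨i, m⟩)

theorem genericPoly_mem (i : Fin s) :
    genericPoly k n d i ∈ polyGrading (CoeffRing k n d) n (d i) :=
  Submodule.sum_mem _ fun m _ =>
    MvPolynomial.isWeightedHomogeneous_monomial _ _ _ ((mem_monomials n (d i) m.1).1 m.2)

variable {k n}

/-- The extension of the ideal `I ⊆ k[x]` to `k[u][x]`. -/
def extendedIdeal (I : Ideal (MvPolynomial (Vars n) k)) :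
    Ideal (MvPolynomial (Vars n) (CoeffRing k n d)) :=
  I.map (MvPolynomial.map MvPolynomial.C)

/-- The module `M[u] = (k[x]/I) ⊗ k[u]`, realized as the quotient of `k[u][x]` by the extension
of `I`. -/
abbrev GenModule (I : Ideal (MvPolynomial (Vars n) k)) : Type u :=
  MvPolynomial (Vars n) (CoeffRing k n d) ⧸ extendedIdeal d I

/-- The multigrading of `M[u]`. -/
def genGrading (I : Ideal (MvPolynomial (Vars n) k)) :
    (Fin q → ℕ) → Submodule (CoeffRing k n d) (GenModule d I) :=
  quotGrading (CoeffRing k n d) (polyGrading (CoeffRing k n d) n) (extendedIdeal d I)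

theorem genGrading_smul (I : Ideal (MvPolynomial (Vars n) k)) :
    IsGradedSMul (CoeffRing k n d) (polyGrading (CoeffRing k n d) n) (genGrading d I) := by
  rintro a b x _ hx ⟨y, hy, rfl⟩
  exact ⟨x * y, MvPolynomial.IsWeightedHomogeneous.mul hx hy, rfl⟩

/-- The multigrading of `𝓜(I) = M[u]/(U_0, …, U_{s-1})M[u]`. -/
def elimGrading (I : Ideal (MvPolynomial (Vars n) k)) : (Fin q → ℕ) →
    Submodule (CoeffRing k n d) (GenModule d I ⧸ seqSubmodule (GenModule d I) (genericPoly k n d)) :=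
  quotGrading (CoeffRing k n d) (genGrading d I)
    (seqSubmodule (GenModule d I) (genericPoly k n d))

/-- `F` is the Rémond resultant form of index `d` attached to `I`: for every large enough `ν` the
module `𝓜(I)_ν` is torsion and its content is `F`. -/
def IsResultantForm (irr : IrrSystem (CoeffRing k n d)) (I : Ideal (MvPolynomial (Vars n) k))
    (F : CoeffRing k n d) : Prop :=
  ∀ᶠ ν : Fin q → ℕ in atTop,
    Module.annihilator (CoeffRing k n d) (elimGrading d I ν) ≠ ⊥ ∧
      content irr (elimGrading d I ν) = F

/-- The class modulo units of `F` is the M-resultant of the generic polynomials `U_0, …, U_{s-1}`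
with respect to `M[u]`. -/
def IsGenericMResultant (I : Ideal (MvPolynomial (Vars n) k)) (F : CoeffRing k n d) : Prop :=
  IsMResultant (genGrading d I) (genGrading_smul d I) d (genericPoly k n d)
    (genericPoly_mem k n d) F

end Generic

end MultiRes

end

/-! Write s = r + 1 and let J_m be the ideal of k[u][x] generated by I and U_0, …, U_{m-1}
(`stageIdeal`). The foundation is that U_i is a nonzerodivisor modulo J_i in large multidegrees.
Invert a monomial m of multidegree d_i. Its coefficient u in U_i occurs in no generator of J_i, so
U_i becomes a polynomial of degree one in u with invertible leading coefficient, and such a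
polynomial is never a zero divisor. Hence whatever U_i kills modulo J_i is killed by a power of
every such m (`exists_pow_mul_mem`). In large multidegrees each monomial is divisible by a high
power of some m, so there the killed element already lies in J_i (`eventually_mem_of_pow_mul_mem`).

This has two consequences. Passing from J_m to J_{m+1} turns the Hilbert polynomial P(ν) into P(ν) -
P(ν - d_m), which lowers the degree; after r + 1 steps nothing is left, so 𝓜(I)_ν is torsion
(`exists_degLT_stageIdeal`, `eventually_exists_smul_mem`). Moreover, for large ν the slice of the
Koszul complex has homology only in degree 0 (`exists_koszulTot_eq`), so it is a finite free
resolution of 𝓜(I)_ν.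

For a finite free resolution of a torsion module, content and Cayley determinant agree up to units.
At a prime π, the cokernel of each chosen minor is an extension of two consecutive auxiliary
cokernels, the one at index 0 being the resolved module. The alternating sum of the π-adic
multiplicities of the minors therefore telescopes to the local length
(`CayleyData.lenLoc_coker_add`, `CayleyData.exists_det_eq`). This comparison is made for each ν
separately.

It remains to see that the content does not depend on ν. Given π, choose a coefficient of some U_i
that occurs in π, and replace d_i by e_p. For this new index there is again a nonzero eliminating
polynomial a. Specialize the new i-th generic polynomial to a form ℓ of multidegree e_p over k[u].
The specialized a kills the cokernel of multiplication by ℓ from 𝓜(I)_ν to 𝓜(I)_{ν+e_p}, and for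
suitable ℓ it is prime to π (`exists_specialize_not_dvd`). So this multiplication is surjective
locally at π, and the local lengths cannot increase with ν (`eventually_lenLoc_le`). They stabilize,
and only the finitely many primes dividing one annihilator matter (`exists_eventually_content_eq`).
The stable content is both the resultant form and the M-resultant. -/

noncomputable section

namespace MultiRes

open MvPolynomial

/-! ### Multihomogeneous components of polynomial rings and their quotients -/

section Components

variable {A : Type*} [CommRing A] {q : ℕ} {n : Fin q → ℕ}

theorem wc_mem (ν : Fin q → ℕ) (y : MvPolynomial (Vars n) A) :
    weightedHomogeneousComponent (varDeg n) ν y ∈ polyGrading A n ν :=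
  weightedHomogeneousComponent_mem _ _ _

theorem wc_of_mem {ν : Fin q → ℕ} {y : MvPolynomial (Vars n) A} (hy : y ∈ polyGrading A n ν) :
    weightedHomogeneousComponent (varDeg n) ν y = y :=
  IsWeightedHomogeneous.weightedHomogeneousComponent_same hy

theorem decompose_eq_wc (ν : Fin q → ℕ) (y : MvPolynomial (Vars n) A) :
    (DirectSum.decompose (polyGrading A n) y ν : MvPolynomial (Vars n) A) =
      weightedHomogeneousComponent (varDeg n) ν y :=
  weightedDecomposition.decompose'_apply _ _ _ _

theorem wc_mul_of_le {δ ν : Fin q → ℕ} {f : MvPolynomial (Vars n) A} (hf : f ∈ polyGrading A n δ)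
    (h : δ ≤ ν) (z : MvPolynomial (Vars n) A) :
    weightedHomogeneousComponent (varDeg n) ν (f * z) =
      f * weightedHomogeneousComponent (varDeg n) (ν - δ) z := by
  rw [← decompose_eq_wc, ← decompose_eq_wc,
    DirectSum.coe_decompose_mul_of_left_mem_of_le (polyGrading A n) hf h]

theorem wc_mul_add {δ ν : Fin q → ℕ} {f : MvPolynomial (Vars n) A} (hf : f ∈ polyGrading A n δ)
    (z : MvPolynomial (Vars n) A) :
    weightedHomogeneousComponent (varDeg n) (δ + ν) (f * z) =
      f * weightedHomogeneousComponent (varDeg n) ν z := by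
  rw [wc_mul_of_le hf le_self_add, add_tsub_cancel_left]

theorem wc_mul_of_not_le {δ ν : Fin q → ℕ} {f : MvPolynomial (Vars n) A}
    (hf : f ∈ polyGrading A n δ) (h : ¬ δ ≤ ν) (z : MvPolynomial (Vars n) A) :
    weightedHomogeneousComponent (varDeg n) ν (f * z) = 0 := by
  rw [← decompose_eq_wc, DirectSum.coe_decompose_mul_of_left_mem_of_not_le (polyGrading A n) hf h]

theorem wc_mem_ideal {J : Ideal (MvPolynomial (Vars n) A)} (hJ : J.IsHomogeneous (polyGrading A n))
    {y : MvPolynomial (Vars n) A} (hy : y ∈ J) (ν : Fin q → ℕ) :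
    weightedHomogeneousComponent (varDeg n) ν y ∈ J := by
  rw [← decompose_eq_wc]
  exact hJ ν hy

theorem isHomogeneous_sup_span {J : Ideal (MvPolynomial (Vars n) A)}
    (hJ : J.IsHomogeneous (polyGrading A n)) {δ : Fin q → ℕ} {f : MvPolynomial (Vars n) A}
    (hf : f ∈ polyGrading A n δ) : (J ⊔ Ideal.span {f}).IsHomogeneous (polyGrading A n) :=
  hJ.sup (Ideal.homogeneous_span _ _ (by rintro x rfl; exact ⟨δ, hf⟩))

theorem monomial_mem_polyGrading (e : Vars n →₀ ℕ) (a : A) :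
    monomial e a ∈ polyGrading A n (Finsupp.weight (varDeg n) e) :=
  isWeightedHomogeneous_monomial _ _ _ rfl

theorem X_mem_polyGrading (x : Vars n) :
    (X x : MvPolynomial (Vars n) A) ∈ polyGrading A n (varDeg n x) :=
  isWeightedHomogeneous_X _ _ _

theorem polyGrading_eq_span (ν : Fin q → ℕ) :
    polyGrading A n ν = Submodule.span A
      ((fun e => (monomial e (1 : A))) '' (monomials n ν : Set (Vars n →₀ ℕ))) := by
  apply le_antisymm
  · intro y hy
    rw [as_sum y]
    refine Submodule.sum_mem _ fun e he => ?_
    have h : Finsupp.weight (varDeg n) e = ν := hy (mem_support_iff.1 he)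
    rw [show monomial e (coeff e y) = coeff e y • monomial e (1 : A) by
      rw [smul_monomial, smul_eq_mul, mul_one]]
    exact Submodule.smul_mem _ _ (Submodule.subset_span ⟨e, (mem_monomials n ν e).2 h, rfl⟩)
  · rw [Submodule.span_le]
    rintro _ ⟨e, he, rfl⟩
    rw [← (mem_monomials n ν e).1 he]
    exact monomial_mem_polyGrading e 1

instance finite_polyGrading (ν : Fin q → ℕ) : Module.Finite A (polyGrading A n ν) := by
  rw [polyGrading_eq_span]
  exact Module.Finite.span_of_finite A ((Finset.finite_toSet _).image _)

/-- `J ∩ A[x]_ν`. -/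
def idealPart (J : Ideal (MvPolynomial (Vars n) A)) (ν : Fin q → ℕ) :
    Submodule A (polyGrading A n ν) :=
  (J.restrictScalars A).comap (polyGrading A n ν).subtype

theorem mem_idealPart {J : Ideal (MvPolynomial (Vars n) A)} {ν : Fin q → ℕ}
    {y : polyGrading A n ν} : y ∈ idealPart J ν ↔ y.1 ∈ J := Iff.rfl

/-- The component of multidegree `ν` of `A[x]/J`. -/
abbrev Comp (J : Ideal (MvPolynomial (Vars n) A)) (ν : Fin q → ℕ) : Type _ :=
  polyGrading A n ν ⧸ idealPart J ν

/-- A linear map from `A[x]_ν` with kernel `J ∩ A[x]_ν` identifies its range with `Comp J ν`. -/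
def compEquivOfKer {N : Type*} [AddCommGroup N] [Module A N]
    {J : Ideal (MvPolynomial (Vars n) A)} {ν : Fin q → ℕ} (g : polyGrading A n ν →ₗ[A] N)
    (hg : ∀ y, g y = 0 ↔ y.1 ∈ J) (P : Submodule A N) (hP : LinearMap.range g = P) :
    Comp J ν ≃ₗ[A] P :=
  (Submodule.quotEquivOfEq _ _ (by ext y; exact (hg y).symm)).trans
    (g.quotKerEquivRange.trans (LinearEquiv.ofEq _ _ hP))

/-- The component of the quotient ring `A[x]/J` agrees with `Comp J ν`. -/
def compEquivQuotGrading (J : Ideal (MvPolynomial (Vars n) A)) (ν : Fin q → ℕ) :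
    Comp J ν ≃ₗ[A] quotGrading A (polyGrading A n) J ν :=
  compEquivOfKer ((Submodule.mkQ J).restrictScalars A ∘ₗ (polyGrading A n ν).subtype)
    (fun y => by simp [Ideal.Quotient.eq_zero_iff_mem]) _ (by
      rw [LinearMap.range_comp, Submodule.range_subtype]; rfl)

/-- Multiplication by a homogeneous polynomial. -/
def mulComp (f : MvPolynomial (Vars n) A) (δ μ : Fin q → ℕ) (hf : f ∈ polyGrading A n δ) :
    polyGrading A n μ →ₗ[A] polyGrading A n (δ + μ) :=
  (LinearMap.mulLeft A f).restrict fun _ hy => IsWeightedHomogeneous.mul hf hy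

/-- A homogeneous element of `J + (f)` is the sum of a homogeneous element of `J` and a homogeneous
multiple of `f`. -/
theorem exists_of_mem_sup_span {J : Ideal (MvPolynomial (Vars n) A)}
    (hJ : J.IsHomogeneous (polyGrading A n)) {f : MvPolynomial (Vars n) A} {δ μ : Fin q → ℕ}
    (hf : f ∈ polyGrading A n δ) {y : MvPolynomial (Vars n) A}
    (hy : y ∈ polyGrading A n (δ + μ)) (h : y ∈ J ⊔ Ideal.span {f}) :
    ∃ z ∈ polyGrading A n μ, y - f * z ∈ J := by
  obtain ⟨j, hj, w, hw, rfl⟩ := Submodule.mem_sup.1 h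
  obtain ⟨z, rfl⟩ := Ideal.mem_span_singleton'.1 hw
  refine ⟨_, wc_mem μ z, ?_⟩
  rw [← wc_mul_add hf, ← wc_of_mem hy, ← map_sub]
  convert wc_mem_ideal hJ hj (δ + μ) using 2
  ring

theorem idealPart_le_comap {J J' : Ideal (MvPolynomial (Vars n) A)} {f : MvPolynomial (Vars n) A}
    {δ μ : Fin q → ℕ} (hf : f ∈ polyGrading A n δ)
    (h : ∀ y ∈ polyGrading A n μ, y ∈ J' → f * y ∈ J) :
    idealPart J' μ ≤ (idealPart J (δ + μ)).comap (mulComp f δ μ hf) := fun y hy =>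
  mem_idealPart.2 (h y.1 y.2 (mem_idealPart.1 hy))

/-- The map `(A[x]/J')_μ → (A[x]/J)_{δ+μ}` induced by multiplication by `f`. -/
def compMul {J J' : Ideal (MvPolynomial (Vars n) A)} {f : MvPolynomial (Vars n) A}
    {δ μ : Fin q → ℕ} (hf : f ∈ polyGrading A n δ)
    (h : ∀ y ∈ polyGrading A n μ, y ∈ J' → f * y ∈ J) : Comp J' μ →ₗ[A] Comp J (δ + μ) :=
  Submodule.mapQ _ _ (mulComp f δ μ hf) (idealPart_le_comap hf h)

theorem compMul_mk {J J' : Ideal (MvPolynomial (Vars n) A)} {f : MvPolynomial (Vars n) A}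
    {δ μ : Fin q → ℕ} (hf : f ∈ polyGrading A n δ)
    (h : ∀ y ∈ polyGrading A n μ, y ∈ J' → f * y ∈ J) (y : polyGrading A n μ) :
    compMul hf h (Submodule.Quotient.mk y) = Submodule.Quotient.mk (mulComp f δ μ hf y) := rfl

theorem comp_mk_eq_zero {J : Ideal (MvPolynomial (Vars n) A)} {ν : Fin q → ℕ}
    (y : polyGrading A n ν) : (Submodule.Quotient.mk y : Comp J ν) = 0 ↔ y.1 ∈ J := by
  rw [Submodule.Quotient.mk_eq_zero, mem_idealPart]

theorem idealPart_mono {J J' : Ideal (MvPolynomial (Vars n) A)} (h : J ≤ J') (ν : Fin q → ℕ) :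
    idealPart J ν ≤ idealPart J' ν := fun _ hy => h hy

theorem comp_factor_mk {J J' : Ideal (MvPolynomial (Vars n) A)} (h : J ≤ J') {ν : Fin q → ℕ}
    (y : polyGrading A n ν) : Submodule.factor (idealPart_mono h ν) (Submodule.Quotient.mk y) =
      (Submodule.Quotient.mk y : Comp J' ν) := rfl

/-- Multiplication by `f` gives an exact sequence 0 → (A[x]/J')_μ → (A[x]/J)_{δ+μ} → (A[x]/(J +
(f)))_{δ+μ} → 0, and rank is additive over a domain. Since `J'` is compared with the colon ideal (J
: f) in multidegree μ only, one may take `J'` to be that colon ideal, or `J` itself where `f` is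
regular. -/
theorem finrank_comp_add [IsDomain A] {J J' : Ideal (MvPolynomial (Vars n) A)}
    (hJ : J.IsHomogeneous (polyGrading A n)) {f : MvPolynomial (Vars n) A} {δ μ : Fin q → ℕ}
    (hf : f ∈ polyGrading A n δ) (h : ∀ y ∈ polyGrading A n μ, f * y ∈ J ↔ y ∈ J') :
    Module.finrank A (Comp J (δ + μ)) =
      Module.finrank A (Comp J' μ) + Module.finrank A (Comp (J ⊔ Ideal.span {f}) (δ + μ)) := by
  have h' : ∀ y ∈ polyGrading A n μ, y ∈ J' → f * y ∈ J := fun y hy => (h y hy).2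
  have hinj : Function.Injective (compMul hf h') := by
    rw [injective_iff_map_eq_zero]
    intro y
    obtain ⟨y, rfl⟩ := Submodule.Quotient.mk_surjective _ y
    rw [compMul_mk, comp_mk_eq_zero, comp_mk_eq_zero]
    exact (h y.1 y.2).1
  have hle : J ≤ J ⊔ Ideal.span {f} := le_sup_left
  have hker : LinearMap.range (compMul hf h') =
      LinearMap.ker (Submodule.factor (idealPart_mono hle (δ + μ))) := by
    apply le_antisymm
    · rintro _ ⟨y, rfl⟩
      obtain ⟨y, rfl⟩ := Submodule.Quotient.mk_surjective _ y
      rw [compMul_mk, LinearMap.mem_ker, comp_factor_mk hle, comp_mk_eq_zero]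
      exact Ideal.mem_sup_right (Ideal.mul_mem_right _ _ (Ideal.mem_span_singleton_self f))
    · intro y
      obtain ⟨y, rfl⟩ := Submodule.Quotient.mk_surjective _ y
      rw [LinearMap.mem_ker, comp_factor_mk hle, comp_mk_eq_zero]
      intro hy
      obtain ⟨z, hz, hyz⟩ := exists_of_mem_sup_span hJ hf y.2 hy
      refine ⟨Submodule.Quotient.mk ⟨z, hz⟩, ?_⟩
      rw [compMul_mk, eq_comm, Submodule.Quotient.eq, mem_idealPart]
      exact hyz
  have h1 := Submodule.finrank_quotient_add_finrank
    (LinearMap.ker (Submodule.factor (idealPart_mono hle (δ + μ))))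
  rw [((Submodule.factor (idealPart_mono hle (δ + μ))).quotKerEquivOfSurjective
    (Submodule.factor_surjective _)).finrank_eq, ← hker,
    LinearMap.finrank_range_of_inj hinj] at h1
  exact h1.symm.trans (add_comm _ _)

theorem isInternal_quotGrading {J : Ideal (MvPolynomial (Vars n) A)}
    (hJ : J.IsHomogeneous (polyGrading A n)) :
    DirectSum.IsInternal (quotGrading A (polyGrading A n) J) := by
  classical
  constructor
  · rw [injective_iff_map_eq_zero]
    intro c hc
    choose y hy using fun ν => (c ν).2
    have h0 : ∑ ν ∈ c.support, y ν ∈ J := by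
      rw [← Ideal.Quotient.eq_zero_iff_mem, map_sum, ← hc,
        DirectSum.coeAddMonoidHom_eq_dfinsuppSum, DFinsupp.sum]
      exact Finset.sum_congr rfl fun ν _ => (hy ν).2
    ext ν
    by_contra hν
    have hν' : ν ∈ c.support := by
      rw [DFinsupp.mem_support_iff]
      exact fun h => hν (by rw [h]; rfl)
    have h1 := wc_mem_ideal hJ h0 ν
    rw [map_sum, Finset.sum_eq_single_of_mem ν hν', wc_of_mem (hy ν).1] at h1
    · apply hν
      rw [← (hy ν).2]
      exact Ideal.Quotient.eq_zero_iff_mem.2 h1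
    · intro μ _ hμ
      exact IsWeightedHomogeneous.weightedHomogeneousComponent_ne _ (hy μ).1 hμ.symm
  · intro m
    obtain ⟨y, rfl⟩ := Ideal.Quotient.mk_surjective m
    induction y using MvPolynomial.induction_on' with
    | monomial e a =>
      exact ⟨DirectSum.of (fun ν => quotGrading A (polyGrading A n) J ν) _
        ⟨Ideal.Quotient.mk J (monomial e a), ⟨_, monomial_mem_polyGrading e a, rfl⟩⟩,
        DirectSum.coeAddMonoidHom_of _ _ _⟩
    | add p r hp hr =>
      obtain ⟨x, hx⟩ := hp
      obtain ⟨z, hz⟩ := hr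
      exact ⟨x + z, by rw [map_add, map_add, hx, hz]⟩

end Components

/-! ### Extension of scalars from `k` to a `k`-algebra -/

section Extension

variable {k : Type*} [Field k] {A : Type*} [CommRing A] [Algebra k A] {q : ℕ} {n : Fin q → ℕ}

/-- The base change map `A[x] → A ⊗ (k[x]/I)`. -/
def toTensorQuot (I : Ideal (MvPolynomial (Vars n) k)) :
    MvPolynomial (Vars n) A →ₐ[A] TensorProduct k A (MvPolynomial (Vars n) k ⧸ I) :=
  (Algebra.TensorProduct.map (AlgHom.id A A) (Ideal.Quotient.mkₐ k I)).comp
    (algebraTensorAlgEquiv k A).symm.toAlgHom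

theorem toTensorQuot_map (I : Ideal (MvPolynomial (Vars n) k)) (a : A)
    (y : MvPolynomial (Vars n) k) :
    toTensorQuot I (a • MvPolynomial.map (algebraMap k A) y) = a ⊗ₜ Ideal.Quotient.mk I y := by
  rw [map_smul]
  simp [toTensorQuot, TensorProduct.smul_tmul']

/-- By right exactness of the tensor product, the kernel of A ⊗ k[x] → A ⊗ (k[x]/I) is generated by
I; the isomorphism A ⊗ k[x] ≅ A[x] carries it to the extended ideal. -/
theorem toTensorQuot_eq_zero_iff (I : Ideal (MvPolynomial (Vars n) k))
    (y : MvPolynomial (Vars n) A) :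
    toTensorQuot I y = 0 ↔ y ∈ I.map (MvPolynomial.map (algebraMap k A)) := by
  constructor
  · have h := Algebra.TensorProduct.lTensor_ker (A := A) (Ideal.Quotient.mkₐ k I)
      (Ideal.Quotient.mkₐ_surjective k I)
    rw [show RingHom.ker (Ideal.Quotient.mkₐ k I) = I from Ideal.Quotient.mkₐ_ker k I] at h
    intro hy
    have h1 : (algebraTensorAlgEquiv k A).symm y ∈
        I.map (Algebra.TensorProduct.includeRight : _ →ₐ[k] TensorProduct k A _) := by
      rw [← h]
      exact hy
    have h2 : I.map (Algebra.TensorProduct.includeRight : _ →ₐ[k] TensorProduct k A _) ≤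
        (I.map (MvPolynomial.map (algebraMap k A))).comap (algebraTensorAlgEquiv k A) := by
      rw [Ideal.map_le_iff_le_comap]
      intro x hx
      rw [Ideal.mem_comap, Ideal.mem_comap, Algebra.TensorProduct.includeRight_apply,
        algebraTensorAlgEquiv_tmul, one_smul]
      exact Ideal.mem_map_of_mem _ hx
    have h3 := h2 h1
    rwa [Ideal.mem_comap, AlgEquiv.apply_symm_apply] at h3
  · have h : I.map (MvPolynomial.map (algebraMap k A)) ≤ RingHom.ker (toTensorQuot (A := A) I) := by
      rw [Ideal.map_le_iff_le_comap]
      intro x hx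
      have h1 := toTensorQuot_map (A := A) I 1 x
      rw [one_smul, Ideal.Quotient.eq_zero_iff_mem.2 hx, TensorProduct.tmul_zero] at h1
      exact h1
    exact fun hy => h hy

theorem map_mem_polyGrading {B C : Type*} [CommRing B] [CommRing C] (g : B →+* C)
    {ν : Fin q → ℕ} {y : MvPolynomial (Vars n) B} (hy : y ∈ polyGrading B n ν) :
    MvPolynomial.map g y ∈ polyGrading C n ν := by
  intro e he
  refine hy fun h => he ?_
  rw [coeff_map, h, map_zero]

/-- The component of the extended ideal is obtained by base change. -/
def compExtEquiv (I : Ideal (MvPolynomial (Vars n) k)) (ν : Fin q → ℕ) :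
    Comp (I.map (MvPolynomial.map (algebraMap k A))) ν ≃ₗ[A]
      TensorProduct k A (quotGrading k (polyGrading k n) I ν) :=
  (compEquivOfKer ((toTensorQuot I).toLinearMap ∘ₗ (polyGrading A n ν).subtype)
    (fun y => toTensorQuot_eq_zero_iff I y.1)
    (LinearMap.range ((quotGrading k (polyGrading k n) I ν).subtype.baseChange A)) (by
      apply le_antisymm
      · rw [LinearMap.range_comp, Submodule.range_subtype, polyGrading_eq_span, Submodule.map_span,
          Submodule.span_le]
        rintro _ ⟨_, ⟨e, he, rfl⟩, rfl⟩
        have h1 : monomial e (1 : A) = (1 : A) • MvPolynomial.map (algebraMap k A) (monomial e (1 : k)) := by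
          simp
        refine ⟨1 ⊗ₜ ⟨Ideal.Quotient.mk I (monomial e 1), ⟨monomial e 1, ?_, rfl⟩⟩, ?_⟩
        · rw [← (mem_monomials n ν e).1 he]
          exact monomial_mem_polyGrading e 1
        · exact (toTensorQuot_map I 1 (monomial e 1)).symm.trans (congrArg (toTensorQuot I) h1.symm)
      · rintro _ ⟨t, rfl⟩
        induction t using TensorProduct.induction_on with
        | zero => rw [map_zero]; exact zero_mem _
        | add x y hx hy => rw [map_add]; exact add_mem hx hy
        | tmul a m =>
          obtain ⟨_, ⟨y, hy, rfl⟩⟩ := m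
          exact ⟨⟨a • MvPolynomial.map (algebraMap k A) y,
            Submodule.smul_mem _ _ (map_mem_polyGrading _ hy)⟩, toTensorQuot_map I a y⟩)).trans
  -- Flatness of `A` over the field `k` identifies the tensor product of `A` with a component and
  -- its image in the tensor product of `A` with the whole quotient.
  (LinearEquiv.ofInjective ((quotGrading k (polyGrading k n) I ν).subtype.baseChange A)
    (Module.Flat.lTensor_preserves_injective_linearMap (M := A)
      (quotGrading k (polyGrading k n) I ν).subtype (Submodule.injective_subtype _))).symm

theorem isHomogeneous_map_ideal {I : Ideal (MvPolynomial (Vars n) k)}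
    (hI : I.IsHomogeneous (polyGrading k n)) (g : k →+* A) :
    (I.map (MvPolynomial.map g)).IsHomogeneous (polyGrading A n) := by
  obtain ⟨S, rfl⟩ := (Ideal.IsHomogeneous.iff_exists _ _).1 hI
  rw [Ideal.map_span]
  refine Ideal.homogeneous_span _ _ ?_
  rintro _ ⟨_, ⟨⟨x, ν, hx⟩, -, rfl⟩, rfl⟩
  exact ⟨ν, map_mem_polyGrading g hx⟩

end Extension

end MultiRes

end

noncomputable section

namespace MultiRes

open MvPolynomial

/-! ### Eventually polynomial functions of a multidegree -/

section EventuallyPolynomial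

variable {q : ℕ}

/-- Evaluation of a polynomial at a multidegree. -/
def evalNat (P : MvPolynomial (Fin q) ℚ) (ν : Fin q → ℕ) : ℚ := eval (fun p => (ν p : ℚ)) P

/-- The function agrees with a polynomial at all large enough multidegrees. -/
def EvPoly (f : (Fin q → ℕ) → ℚ) : Prop :=
  ∃ P : MvPolynomial (Fin q) ℚ, ∀ᶠ ν in atTop, f ν = evalNat P ν

theorem EvPoly.add {f g : (Fin q → ℕ) → ℚ} (hf : EvPoly f) (hg : EvPoly g) :
    EvPoly fun ν => f ν + g ν := by
  obtain ⟨P, hP⟩ := hf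
  obtain ⟨Q, hQ⟩ := hg
  refine ⟨P + Q, ?_⟩
  filter_upwards [hP, hQ] with ν h1 h2
  rw [h1, h2, evalNat, evalNat, evalNat, map_add]

theorem evalNat_bind₁ (g : Fin q → MvPolynomial (Fin q) ℚ) (P : MvPolynomial (Fin q) ℚ)
    {ν μ : Fin q → ℕ} (h : ∀ p, evalNat (g p) ν = μ p) :
    evalNat (bind₁ g P) ν = evalNat P μ := by
  unfold evalNat at *
  rw [← coe_aeval_eq_eval, ← coe_aeval_eq_eval, RingHom.coe_coe, RingHom.coe_coe, aeval_bind₁]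
  congr 2
  funext p
  rw [← h p, ← coe_aeval_eq_eval, RingHom.coe_coe]

/-- The polynomial `P(x - δ)`. -/
def shiftPoly (δ : Fin q → ℕ) : MvPolynomial (Fin q) ℚ →ₐ[ℚ] MvPolynomial (Fin q) ℚ :=
  bind₁ fun p => X p - C (δ p : ℚ)

theorem evalNat_shiftPoly (P : MvPolynomial (Fin q) ℚ) {δ ν : Fin q → ℕ} (h : δ ≤ ν) :
    evalNat (shiftPoly δ P) ν = evalNat P (ν - δ) :=
  evalNat_bind₁ _ _ fun p => by simp [evalNat, Nat.cast_sub (h p)]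

theorem tendsto_tsub_atTop (δ : Fin q → ℕ) :
    Tendsto (fun ν : Fin q → ℕ => ν - δ) atTop atTop := by
  refine tendsto_atTop.2 fun μ => ?_
  filter_upwards [eventually_ge_atTop (μ + δ)] with ν hν
  exact le_tsub_of_add_le_right hν

theorem tendsto_add_atTop (δ : Fin q → ℕ) :
    Tendsto (fun ν : Fin q → ℕ => δ + ν) atTop atTop :=
  tendsto_atTop_mono (fun _ => le_add_self) tendsto_id

theorem EvPoly.comp_sub {f : (Fin q → ℕ) → ℚ} (hf : EvPoly f) (δ : Fin q → ℕ) :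
    EvPoly fun ν => f (ν - δ) := by
  obtain ⟨P, hP⟩ := hf
  refine ⟨shiftPoly δ P, ?_⟩
  filter_upwards [(tendsto_tsub_atTop δ).eventually hP, eventually_ge_atTop δ] with ν h1 h2
  rw [h1, evalNat_shiftPoly P h2]

theorem EvPoly.comp_add {f : (Fin q → ℕ) → ℚ} (hf : EvPoly f) (δ : Fin q → ℕ) :
    EvPoly fun ν => f (δ + ν) := by
  obtain ⟨P, hP⟩ := hf
  refine ⟨bind₁ (fun p => C (δ p : ℚ) + X p) P, ?_⟩
  filter_upwards [(tendsto_add_atTop δ).eventually hP] with ν h1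
  rw [h1, evalNat_bind₁ _ _ (μ := δ + ν) fun p => by simp [evalNat]]

theorem EvPoly.congr {f g : (Fin q → ℕ) → ℚ} (hf : EvPoly f) (h : ∀ᶠ ν in atTop, g ν = f ν) :
    EvPoly g := by
  obtain ⟨P, hP⟩ := hf
  refine ⟨P, ?_⟩
  filter_upwards [hP, h] with ν h1 h2
  rw [h2, h1]

/-- Bernoulli polynomials satisfy B_{e+1}(1 + x) - B_{e+1}(x) = (e + 1) x^e, so a B_{e+1}(x)/(e + 1)
is an antidifference of a x^e. The remaining variables are constant under the shift in direction
`p`. -/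
theorem exists_antidifference (p : Fin q) (P : MvPolynomial (Fin q) ℚ) :
    ∃ G : MvPolynomial (Fin q) ℚ, ∀ ν : Fin q → ℕ,
      evalNat G (Pi.single p 1 + ν) - evalNat G ν = evalNat P ν := by
  classical
  induction P using MvPolynomial.induction_on' with
  | add P Q hP hQ =>
    obtain ⟨G, hG⟩ := hP
    obtain ⟨H, hH⟩ := hQ
    refine ⟨G + H, fun ν => ?_⟩
    have h1 := hG ν
    have h2 := hH ν
    simp only [evalNat, map_add] at h1 h2 ⊢
    linarith
  | monomial e a =>
    refine ⟨C (a / (e p + 1)) * Polynomial.aeval (X p) (Polynomial.bernoulli (e p + 1)) *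
      ∏ i ∈ Finset.univ.erase p, X i ^ e i, fun ν => ?_⟩
    have h1 : ∀ ν : Fin q → ℕ, evalNat (C (a / (e p + 1)) *
        Polynomial.aeval (X p) (Polynomial.bernoulli (e p + 1)) *
        ∏ i ∈ Finset.univ.erase p, X i ^ e i) ν = a / (e p + 1) *
        (Polynomial.bernoulli (e p + 1)).eval (ν p : ℚ) *
          ∏ i ∈ Finset.univ.erase p, (ν i : ℚ) ^ e i := by
      intro ν
      rw [evalNat, map_mul, map_mul, eval_C, map_prod, Polynomial.aeval_def,
        Polynomial.hom_eval₂]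
      simp [Polynomial.eval₂_eq_eval_map]
    rw [h1, h1]
    have h2 : ∏ i ∈ Finset.univ.erase p, (((Pi.single p 1 + ν : Fin q → ℕ) i : ℕ) : ℚ) ^ e i =
        ∏ i ∈ Finset.univ.erase p, (ν i : ℚ) ^ e i := by
      refine Finset.prod_congr rfl fun i hi => ?_
      rw [Pi.add_apply, Pi.single_eq_of_ne (Finset.ne_of_mem_erase hi), zero_add]
    have h3 := Polynomial.bernoulli_eval_one_add (e p + 1) (ν p : ℚ)
    have h4 : (((Pi.single p 1 + ν : Fin q → ℕ) p : ℕ) : ℚ) = 1 + ν p := by simp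
    have h5 : evalNat (monomial e a) ν =
        a * ((ν p : ℚ) ^ e p * ∏ i ∈ Finset.univ.erase p, (ν i : ℚ) ^ e i) := by
      rw [evalNat, eval_monomial, Finset.mul_prod_erase _ (fun i => (ν i : ℚ) ^ e i)
        (Finset.mem_univ p), Finsupp.prod_fintype _ _ (by simp)]
    have h6 : ((e p : ℚ) + 1) ≠ 0 := by positivity
    rw [h2, h4, h3, h5]
    push_cast
    field_simp
    ring

/-- The polynomial obtained by giving the value `c` to the `p`-th variable. -/
def substPoly (p : Fin q) (c : ℕ) (P : MvPolynomial (Fin q) ℚ) : MvPolynomial (Fin q) ℚ :=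
  bind₁ (Function.update X p (C (c : ℚ))) P

theorem evalNat_substPoly (p : Fin q) (c : ℕ) (P : MvPolynomial (Fin q) ℚ) (ν : Fin q → ℕ) :
    evalNat (substPoly p c P) ν = evalNat P (Function.update ν p c) := by
  refine evalNat_bind₁ _ _ fun i => ?_
  by_cases h : i = p
  · subst h
    simp [evalNat]
  · simp [h, evalNat]

/-- A function whose partial differences are eventually polynomial is eventually polynomial. -/
theorem evPoly_of_differences {f : (Fin q → ℕ) → ℚ}
    (h : ∀ p, EvPoly fun ν => f (Pi.single p 1 + ν) - f ν) : EvPoly f := by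
  classical
  choose g hg using h
  obtain ⟨ν0, hν0⟩ := eventually_atTop.1 (eventually_all.2 hg)
  choose H hH using fun p => exists_antidifference p (g p)
  have hupd : ∀ (p : Fin q) (ν : Fin q → ℕ), ν0 ≤ ν → ∀ m : ℕ,
      ν0 ≤ Function.update ν p (ν0 p + m) := by
    intro p ν hν m i
    by_cases hi : i = p
    · subst hi
      simp
    · simpa [hi] using hν i
  -- Telescoping along direction `p`, starting from the value `ν0 p`: `f` and `H p` have the same
  -- increments.
  have key : ∀ (p : Fin q) (ν : Fin q → ℕ), ν0 ≤ ν → ∀ m : ℕ,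
      f (Function.update ν p (ν0 p + m)) - f (Function.update ν p (ν0 p)) =
        evalNat (H p) (Function.update ν p (ν0 p + m)) -
          evalNat (H p) (Function.update ν p (ν0 p)) := by
    intro p ν hν m
    induction m with
    | zero => simp
    | succ m ih =>
      have h1 : Function.update ν p (ν0 p + (m + 1)) =
          Pi.single p 1 + Function.update ν p (ν0 p + m) := by
        funext i
        by_cases hi : i = p
        · subst hi
          simp
          ring
        · simp [hi]
      have h3 := hν0 _ (hupd p ν hν m) p
      have h4 := hH p (Function.update ν p (ν0 p + m))
      rw [h1]
      linarith
  -- The coordinates in `T` are free and the others are frozen at `ν0`. Freeing one more coordinate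
  -- `p` adds the increment of `H p` between `ν0 p` and `ν p`.
  have main : ∀ T : Finset (Fin q), ∃ G : MvPolynomial (Fin q) ℚ, ∀ ν, ν0 ≤ ν →
      (∀ p ∉ T, ν p = ν0 p) → f ν = evalNat G ν := by
    intro T
    induction T using Finset.induction_on with
    | empty =>
      refine ⟨C (f ν0), fun ν _ h => ?_⟩
      rw [show ν = ν0 from funext fun p => h p (Finset.notMem_empty p)]
      simp [evalNat]
    | insert p T hp ih =>
      obtain ⟨G, hG⟩ := ih
      refine ⟨substPoly p (ν0 p) G + H p - substPoly p (ν0 p) (H p), fun ν hν h => ?_⟩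
      have h1 := key p ν hν (ν p - ν0 p)
      rw [Nat.add_sub_cancel' (hν p), Function.update_eq_self] at h1
      have h2 := hG (Function.update ν p (ν0 p)) (hupd p ν hν 0) (by
        intro i hi
        by_cases hip : i = p
        · subst hip
          simp
        · rw [Function.update_of_ne hip]
          exact h i (by simp [hip, hi]))
      have h3 : evalNat (substPoly p (ν0 p) G + H p - substPoly p (ν0 p) (H p)) ν =
          evalNat (substPoly p (ν0 p) G) ν + evalNat (H p) ν -
            evalNat (substPoly p (ν0 p) (H p)) ν := by
        simp [evalNat]
      rw [h3, evalNat_substPoly, evalNat_substPoly]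
      linarith
  obtain ⟨G, hG⟩ := main Finset.univ
  exact ⟨G, eventually_atTop.2 ⟨ν0, fun ν hν => hG ν hν (by simp)⟩⟩

/-- The polynomials of total degree less than `m`. -/
def degLT (q m : ℕ) : Submodule ℚ (MvPolynomial (Fin q) ℚ) :=
  Submodule.span ℚ ((fun e => monomial e (1 : ℚ)) '' {e : Fin q →₀ ℕ | e.degree < m})

theorem monomial_mem_degLT {m : ℕ} {e : Fin q →₀ ℕ} (h : e.degree < m) (a : ℚ) :
    monomial e a ∈ degLT q m := by
  rw [show monomial e a = a • monomial e (1 : ℚ) by rw [smul_monomial, smul_eq_mul, mul_one]]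
  exact Submodule.smul_mem _ _ (Submodule.subset_span ⟨e, h, rfl⟩)

theorem mem_degLT_of_totalDegree_lt {m : ℕ} {P : MvPolynomial (Fin q) ℚ}
    (h : P.totalDegree < m) : P ∈ degLT q m := by
  rw [as_sum P]
  refine Submodule.sum_mem _ fun e he => monomial_mem_degLT ?_ _
  exact lt_of_le_of_lt (le_totalDegree he) h

theorem degLT_zero : degLT q 0 = ⊥ := by
  simp [degLT]

theorem degLT_mono {m m' : ℕ} (h : m ≤ m') : degLT q m ≤ degLT q m' :=
  Submodule.span_mono (Set.image_mono fun _ he => lt_of_lt_of_le he h)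

theorem mul_X_mem_degLT {m : ℕ} {P : MvPolynomial (Fin q) ℚ} (h : P ∈ degLT q m) (i : Fin q) :
    P * X i ∈ degLT q (m + 1) := by
  have : degLT q m ≤ (degLT q (m + 1)).comap (LinearMap.mulRight ℚ (X i)) := by
    conv_lhs => rw [degLT]
    rw [Submodule.span_le]
    rintro _ ⟨e, he, rfl⟩
    have h1 : monomial e (1 : ℚ) * X i = monomial (e + Finsupp.single i 1) 1 := by
      rw [X, monomial_mul, mul_one]
    rw [SetLike.mem_coe, Submodule.mem_comap, LinearMap.mulRight_apply, h1]
    refine monomial_mem_degLT ?_ _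
    rw [map_add, Finsupp.degree_single]
    exact Nat.succ_lt_succ he
  exact this h

/-- Split off one variable. With ΔP = P - P(x - δ), one has Δ(P X_i) = (ΔP) X_i + δ_i (P - ΔP), and
by induction both summands have degree below that of P X_i. -/
theorem monomial_sub_shiftPoly_mem (δ : Fin q → ℕ) (N : ℕ) : ∀ e : Fin q →₀ ℕ, e.degree = N →
    monomial e (1 : ℚ) - shiftPoly δ (monomial e 1) ∈ degLT q N := by
  induction N with
  | zero =>
    intro e he
    rw [Finsupp.degree_eq_zero_iff] at he
    subst he
    rw [show monomial (0 : Fin q →₀ ℕ) (1 : ℚ) = 1 from rfl, map_one, sub_self]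
    exact zero_mem _
  | succ N ih =>
    intro e he
    obtain ⟨i, hi⟩ : ∃ i, e i ≠ 0 := by
      by_contra! h
      rw [show e = 0 from Finsupp.ext h, map_zero] at he
      omega
    have h1 : e = (e - Finsupp.single i 1) + Finsupp.single i 1 :=
      (tsub_add_cancel_of_le (Finsupp.single_le_iff.2 (Nat.one_le_iff_ne_zero.2 hi))).symm
    set e' := e - Finsupp.single i 1
    have h2 : e'.degree = N := by
      rw [h1, map_add, Finsupp.degree_single] at he
      omega
    have h3 : monomial e (1 : ℚ) = monomial e' 1 * X i := by
      rw [X, monomial_mul, mul_one, ← h1]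
    have h4 : shiftPoly δ (X i) = X i - C (δ i : ℚ) := bind₁_X_right _ _
    have h5 : monomial e (1 : ℚ) - shiftPoly δ (monomial e 1) =
        (monomial e' 1 - shiftPoly δ (monomial e' 1)) * X i +
          (δ i : ℚ) • (monomial e' 1 - (monomial e' 1 - shiftPoly δ (monomial e' 1))) := by
      rw [h3, map_mul, h4, smul_eq_C_mul]
      ring
    rw [h5]
    refine add_mem (mul_X_mem_degLT (ih e' h2) i) (Submodule.smul_mem _ _ (sub_mem ?_ ?_))
    · exact monomial_mem_degLT (by omega) 1
    · exact degLT_mono (Nat.le_succ N) (ih e' h2)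

/-- Taking differences lowers the total degree. -/
theorem sub_shiftPoly_mem (δ : Fin q → ℕ) {m : ℕ} {P : MvPolynomial (Fin q) ℚ}
    (h : P ∈ degLT q (m + 1)) : P - shiftPoly δ P ∈ degLT q m := by
  have : degLT q (m + 1) ≤
      (degLT q m).comap (LinearMap.id - (shiftPoly δ).toLinearMap) := by
    conv_lhs => rw [degLT]
    rw [Submodule.span_le]
    rintro _ ⟨e, he, rfl⟩
    exact degLT_mono (Nat.le_of_lt_succ he) (monomial_sub_shiftPoly_mem δ _ e rfl)
  exact this h

end EventuallyPolynomial

/-! ### Existence of Hilbert polynomials -/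

section Hilbert

variable {k : Type*} [Field k] {q : ℕ} {n : Fin q → ℕ}

theorem finrank_comp_eq_zero_of_X_mem {I : Ideal (MvPolynomial (Vars n) k)} {p : Fin q}
    (h : ∀ i, X ⟨p, i⟩ ∈ I) {ν : Fin q → ℕ} (hν : ν p ≠ 0) :
    Module.finrank k (Comp I ν) = 0 := by
  have : Subsingleton (Comp I ν) := by
    refine subsingleton_of_forall_eq 0 fun y => ?_
    obtain ⟨y, rfl⟩ := Submodule.Quotient.mk_surjective _ y
    rw [comp_mk_eq_zero]
    obtain ⟨y, hy⟩ := y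
    change y ∈ I
    rw [as_sum y]
    refine Ideal.sum_mem _ fun e he => ?_
    have h1 : Finsupp.weight (varDeg n) e p = ν p := congrFun (hy (mem_support_iff.1 he)) p
    obtain ⟨x, hx, hxp⟩ : ∃ x ∈ e.support, x.1 = p := by
      by_contra! hc
      apply hν
      rw [← h1, Finsupp.weight_apply, Finsupp.sum, Finset.sum_apply]
      refine Finset.sum_eq_zero fun x hx => ?_
      rw [Pi.smul_apply, varDeg, Pi.single_eq_of_ne (hc x hx).symm, smul_zero]
    obtain ⟨p', i⟩ := x
    obtain rfl : p' = p := hxp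
    have h2 : e = (e - Finsupp.single ⟨p', i⟩ 1) + Finsupp.single ⟨p', i⟩ 1 :=
      (tsub_add_cancel_of_le (Finsupp.single_le_iff.2
        (Nat.one_le_iff_ne_zero.2 (Finsupp.mem_support_iff.1 hx)))).symm
    have h3 : monomial e (coeff e y) =
        monomial (e - Finsupp.single ⟨p', i⟩ 1) (coeff e y) * X ⟨p', i⟩ := by
      rw [X, monomial_mul, mul_one, ← h2]
    rw [h3]
    exact Ideal.mul_mem_left _ _ (h i)
  exact Module.finrank_zero_of_subsingleton

/-- Noetherian induction on `I`. If some variable x outside `I` is a zero divisor modulo `I`, the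
Hilbert function is assembled from those of the larger ideals (I : x) and I + (x). Otherwise, either
all variables of some group p lie in `I` and the function is eventually zero, or each group contains
a variable regular modulo `I`; then the partial differences are Hilbert functions of larger ideals,
hence eventually polynomial. -/
theorem evPoly_finrank_comp (I : Ideal (MvPolynomial (Vars n) k)) :
    I.IsHomogeneous (polyGrading k n) → EvPoly fun ν => (Module.finrank k (Comp I ν) : ℚ) := by
  induction I using WellFoundedGT.induction with
  | ind I ih =>
  intro hI
  have hlt : ∀ x : Vars n, X x ∉ I → I < I ⊔ Ideal.span {X x} := fun x hx =>
    lt_of_le_of_ne le_sup_left fun h => hx (by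
      rw [h]
      exact Ideal.mem_sup_right (Ideal.mem_span_singleton_self _))
  have hsup : ∀ x : Vars n, X x ∉ I →
      EvPoly fun ν => (Module.finrank k (Comp (I ⊔ Ideal.span {X x}) ν) : ℚ) := fun x hx =>
    ih _ (hlt x hx) (isHomogeneous_sup_span hI (X_mem_polyGrading x))
  by_cases h1 : ∃ x : Vars n, X x ∉ I ∧ ∃ y, y ∉ I ∧ X x * y ∈ I
  · obtain ⟨x, hx, y, hy, hxy⟩ := h1
    set I' : Ideal (MvPolynomial (Vars n) k) :=
      Submodule.comap (LinearMap.mulLeft (MvPolynomial (Vars n) k) (X x)) I with hI'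
    have hmem : ∀ z, z ∈ I' ↔ X x * z ∈ I := fun z => Iff.rfl
    have hhom : I'.IsHomogeneous (polyGrading k n) := by
      intro ν z hz
      rw [decompose_eq_wc, hmem, ← wc_mul_add (X_mem_polyGrading x)]
      exact wc_mem_ideal hI hz _
    have hlt' : I < I' := lt_of_le_of_ne (fun z hz => Ideal.mul_mem_left _ _ hz) fun h => hy (by
      rw [h]
      exact hxy)
    refine (((ih I' hlt' hhom).comp_sub (varDeg n x)).add (hsup x hx)).congr ?_
    filter_upwards [eventually_ge_atTop (varDeg n x)] with ν hν
    have := finrank_comp_add (J' := I') (μ := ν - varDeg n x) hI (X_mem_polyGrading x)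
      (fun y _ => Iff.rfl)
    rw [add_tsub_cancel_of_le hν] at this
    rw [this]
    push_cast
    rfl
  push Not at h1
  by_cases h2 : ∃ p, ∀ i, X (⟨p, i⟩ : Vars n) ∈ I
  · obtain ⟨p, hp⟩ := h2
    refine ⟨0, ?_⟩
    filter_upwards [eventually_ge_atTop (Pi.single p 1)] with ν hν
    rw [finrank_comp_eq_zero_of_X_mem hp]
    · simp [evalNat]
    · have := hν p
      rw [Pi.single_eq_same] at this
      exact Nat.one_le_iff_ne_zero.1 this
  push Not at h2
  refine evPoly_of_differences fun p => ?_
  obtain ⟨i, hi⟩ := h2 p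
  refine ((hsup _ hi).comp_add (Pi.single p 1)).congr (Eventually.of_forall fun μ => ?_)
  have := finrank_comp_add (J' := I) (μ := μ) hI (X_mem_polyGrading ⟨p, i⟩)
    (fun y _ => ⟨fun h => by_contra fun hy => h1 _ hi y hy h, fun h => Ideal.mul_mem_left _ _ h⟩)
  rw [show varDeg n ⟨p, i⟩ = Pi.single p 1 from rfl] at this
  rw [this]
  push_cast
  ring

theorem exists_isHilbertPoly {I : Ideal (MvPolynomial (Vars n) k)}
    (hI : I.IsHomogeneous (polyGrading k n)) :
    ∃ P, IsHilbertPoly k (quotGrading k (polyGrading k n) I) P := by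
  obtain ⟨P, hP⟩ := evPoly_finrank_comp I hI
  refine ⟨P, ?_⟩
  filter_upwards [hP] with ν hν
  rw [← (compEquivQuotGrading I ν).finrank_eq, hν, evalNat]

/-- If the relevant dimension is `s - 1` then the Hilbert function is eventually given by a
polynomial of total degree less than `s`. -/
theorem exists_degLT_of_relevantDim {I : Ideal (MvPolynomial (Vars n) k)}
    (hI : I.IsHomogeneous (polyGrading k n)) {s : ℕ}
    (hs : relevantDim k (quotGrading k (polyGrading k n) I) = (s : ℤ) - 1) :
    ∃ P ∈ degLT q s, ∀ᶠ ν in atTop,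
      (Module.finrank k (quotGrading k (polyGrading k n) I ν) : ℚ) = evalNat P ν := by
  have hex := exists_isHilbertPoly hI
  refine ⟨hilbertPoly k (quotGrading k (polyGrading k n) I), ?_, ?_⟩
  · unfold relevantDim at hs
    split_ifs at hs with h
    · rw [h]
      exact zero_mem _
    · refine mem_degLT_of_totalDegree_lt ?_
      rw [← Int.ofNat_lt]
      exact hs.trans_lt (sub_one_lt _)
  · unfold hilbertPoly
    rw [dif_pos hex]
    exact hex.choose_spec

end Hilbert

end MultiRes

end

noncomputable section

namespace MultiRes

open MvPolynomial

/-! ### Elements annihilated by powers of monomials -/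

section Saturation

variable {A : Type*} [CommRing A] {q : ℕ} {n : Fin q → ℕ}

theorem weight_varDeg_apply (e : Vars n →₀ ℕ) (p : Fin q) :
    Finsupp.weight (varDeg n) e p = ∑ i : Fin (n p + 1), e ⟨p, i⟩ := by
  rw [Finsupp.weight_apply, Finsupp.sum_fintype _ _ (by simp), Finset.sum_apply,
    Fintype.sum_sigma, Finset.sum_eq_single_of_mem p (Finset.mem_univ p)]
  · simp [varDeg]
  · intro p' _ hp
    exact Finset.sum_eq_zero fun i _ => by simp [varDeg, Pi.single_eq_of_ne hp.symm]

/-- The monomial of multidegree `δ` that involves only the variables `x_{p, i p}`. -/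
def powerMonomial (δ : Fin q → ℕ) (i : ∀ p, Fin (n p + 1)) : Vars n →₀ ℕ :=
  Finsupp.equivFunOnFinite.symm fun x => if x.2 = i x.1 then δ x.1 else 0

theorem powerMonomial_apply (δ : Fin q → ℕ) (i : ∀ p, Fin (n p + 1)) (x : Vars n) :
    powerMonomial δ i x = if x.2 = i x.1 then δ x.1 else 0 := rfl

theorem powerMonomial_mem (δ : Fin q → ℕ) (i : ∀ p, Fin (n p + 1)) :
    powerMonomial δ i ∈ monomials n δ := by
  rw [mem_monomials]
  funext p
  rw [weight_varDeg_apply]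
  simp [powerMonomial_apply]

/-- A monomial of large enough multidegree is divisible by the `N`-th power of a monomial of
multidegree `δ`. -/
theorem exists_nsmul_le (δ : Fin q → ℕ) (N : ℕ) (e : Vars n →₀ ℕ)
    (h : ∀ p, (n p + 1) * (N * δ p) ≤ Finsupp.weight (varDeg n) e p) :
    ∃ e0 ∈ monomials n δ, N • e0 ≤ e := by
  have h1 : ∀ p, ∃ i : Fin (n p + 1), N * δ p ≤ e ⟨p, i⟩ := by
    intro p
    obtain ⟨i, -, hi⟩ := Finset.exists_le_of_sum_le (s := (Finset.univ : Finset (Fin (n p + 1))))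
      (f := fun _ => N * δ p) (g := fun i => e ⟨p, i⟩) Finset.univ_nonempty (by
        rw [← weight_varDeg_apply]
        simpa using h p)
    exact ⟨i, hi⟩
  choose i hi using h1
  refine ⟨powerMonomial δ i, powerMonomial_mem δ i, fun x => ?_⟩
  rw [Finsupp.smul_apply, powerMonomial_apply]
  obtain ⟨p, j⟩ := x
  split_ifs with hj
  · obtain rfl : j = i p := hj
    exact hi p
  · simp

theorem exists_weight_le (y : MvPolynomial (Vars n) A) :
    ∃ μ : Fin q → ℕ, ∀ ν, weightedHomogeneousComponent (varDeg n) ν y ≠ 0 → ν ≤ μ := by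
  classical
  refine ⟨∑ e ∈ y.support, Finsupp.weight (varDeg n) e, fun ν hν => ?_⟩
  obtain ⟨e, he⟩ := MvPolynomial.ne_zero_iff.1 hν
  rw [coeff_weightedHomogeneousComponent] at he
  split_ifs at he with h1
  · rw [← h1]
    exact Finset.single_le_sum (f := fun e => Finsupp.weight (varDeg n) e)
      (fun _ _ => zero_le) (mem_support_iff.2 he)
  · exact absurd rfl he

/-- `K` is finitely generated, so one exponent `N0` serves for all generators and all monomials of
multidegree `δ`. In a large multidegree every monomial multiplying a generator is divisible by the
`N0`-th power of a monomial of multidegree `δ`. -/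
theorem eventually_mem_of_pow_mul_mem [IsNoetherianRing A]
    {J K : Ideal (MvPolynomial (Vars n) A)} (hJ : J.IsHomogeneous (polyGrading A n))
    (δ : Fin q → ℕ)
    (h : ∀ z ∈ K, ∀ e ∈ monomials n δ, ∃ N : ℕ, monomial (N • e) 1 * z ∈ J) :
    ∀ᶠ ν in atTop, ∀ z ∈ polyGrading A n ν, z ∈ K → z ∈ J := by
  classical
  obtain ⟨G, hG⟩ : K.FG := IsNoetherian.noetherian K
  have hGK : ∀ g ∈ G, g ∈ K := fun g hg => hG ▸ Submodule.subset_span hg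
  choose! N hN using h
  choose μ hμ using exists_weight_le (A := A) (n := n)
  set N0 := ∑ g ∈ G, ∑ e ∈ monomials n δ, N g e
  set μ0 := ∑ g ∈ G, μ g
  have hN0 : ∀ g ∈ G, ∀ e ∈ monomials n δ, N g e ≤ N0 := fun g hg e he =>
    (Finset.single_le_sum (f := fun e => N g e) (fun _ _ => zero_le) he).trans
      (Finset.single_le_sum (f := fun g => ∑ e ∈ monomials n δ, N g e) (fun _ _ => zero_le) hg)
  have hμ0 : ∀ g ∈ G, μ g ≤ μ0 := fun g hg =>
    Finset.single_le_sum (f := fun g => μ g) (fun _ _ => zero_le) hg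
  -- `μ0` bounds the multidegrees occurring in the generators. The excess (n_p + 1) N0 δ_p forces,
  -- by the pigeonhole principle among the n_p + 1 variables of group p, some x_{p,i} to occur to
  -- the power N0 δ_p.
  filter_upwards [eventually_ge_atTop (μ0 + fun p => (n p + 1) * (N0 * δ p))] with ν hν z hz hzK
  rw [← hG] at hzK
  obtain ⟨r, -, hr⟩ := Submodule.mem_span_finset.1 hzK
  rw [← wc_of_mem hz, ← hr, map_sum]
  refine Ideal.sum_mem _ fun g hg => ?_
  rw [smul_eq_mul, as_sum (r g), Finset.sum_mul, map_sum]
  refine Ideal.sum_mem _ fun e _ => ?_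
  set a := coeff e (r g)
  by_cases hle : Finsupp.weight (varDeg n) e ≤ ν
  swap
  · rw [wc_mul_of_not_le (monomial_mem_polyGrading e a) hle]
    exact zero_mem _
  rw [wc_mul_of_le (monomial_mem_polyGrading e a) hle]
  by_cases h0 : weightedHomogeneousComponent (varDeg n) (ν - Finsupp.weight (varDeg n) e) g = 0
  · rw [h0, mul_zero]
    exact zero_mem _
  have h1 := (hμ g _ h0).trans (hμ0 g hg)
  obtain ⟨e0, he0, hle0⟩ := exists_nsmul_le δ N0 e fun p => by
    have h2 := h1 p
    have h3 := hν p
    have h4 := hle p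
    simp only [Pi.sub_apply, Pi.add_apply] at h2 h3
    omega
  have h2 : N g e0 • e0 ≤ e := (nsmul_le_nsmul_left zero_le (hN0 g hg e0 he0)).trans hle0
  have h3 : monomial e a = monomial (e - N g e0 • e0) a * monomial (N g e0 • e0) 1 := by
    rw [monomial_mul, mul_one, tsub_add_cancel_of_le h2]
  -- `K` is not assumed homogeneous, so the hypothesis concerns `g` and not its components: the
  -- power of `e0` is moved inside the component, and homogeneity of `J` concludes.
  rw [h3, mul_assoc, ← wc_mul_add (monomial_mem_polyGrading (N g e0 • e0) (1 : A))]
  exact Ideal.mul_mem_left _ _ (wc_mem_ideal hJ (hN g (hGK g hg) e0 he0) _)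

end Saturation

/-! ### Localization of a quotient ring at one element -/

section QuotientLocalization

variable {R : Type*} [CommRing R] (J : Ideal R) (x : R)

/-- The canonical map from `R` to the localization of `R/J` away from the class of `x`. -/
def quotLoc : R →+* Localization.Away (Ideal.Quotient.mk J x) :=
  (algebraMap (R ⧸ J) (Localization.Away (Ideal.Quotient.mk J x))).comp (Ideal.Quotient.mk J)

theorem quotLoc_eq_zero {y : R} (hy : y ∈ J) : quotLoc J x y = 0 := by
  rw [quotLoc, RingHom.comp_apply, Ideal.Quotient.eq_zero_iff_mem.2 hy, map_zero]

theorem isUnit_quotLoc : IsUnit (quotLoc J x x) :=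
  IsLocalization.Away.algebraMap_isUnit (S := Localization.Away (Ideal.Quotient.mk J x))
    (Ideal.Quotient.mk J x)

theorem exists_pow_mul_mem_of_quotLoc_eq_zero {z : R} (hz : quotLoc J x z = 0) :
    ∃ N : ℕ, x ^ N * z ∈ J := by
  obtain ⟨⟨_, N, rfl⟩, hN⟩ := (IsLocalization.map_eq_zero_iff
    (Submonoid.powers (Ideal.Quotient.mk J x)) (Localization.Away (Ideal.Quotient.mk J x)) _).1 hz
  refine ⟨N, ?_⟩
  rw [← Ideal.Quotient.eq_zero_iff_mem, map_mul, map_pow]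
  exact hN

end QuotientLocalization

/-! ### Filter-regularity of generic polynomials and elimination -/

section Generic

variable {k : Type*} [Field k] {q s : ℕ} {n : Fin q → ℕ} (d : Fin s → Fin q → ℕ)

/-- The ideal generated by `I` and the first `m` generic polynomials. -/
def stageIdeal (I : Ideal (MvPolynomial (Vars n) k)) (m : ℕ) :
    Ideal (MvPolynomial (Vars n) (CoeffRing k n d)) :=
  extendedIdeal d I ⊔ Ideal.span (genericPoly k n d '' {j | j.1 < m})

theorem stageIdeal_zero (I : Ideal (MvPolynomial (Vars n) k)) :
    stageIdeal d I 0 = extendedIdeal d I := by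
  simp [stageIdeal]

theorem stageIdeal_succ (I : Ideal (MvPolynomial (Vars n) k)) (i : Fin s) :
    stageIdeal d I (i + 1) = stageIdeal d I i ⊔ Ideal.span {genericPoly k n d i} := by
  rw [stageIdeal, stageIdeal, sup_assoc, ← Ideal.span_union]
  congr 2
  ext y
  constructor
  · rintro ⟨j, hj, rfl⟩
    rcases Nat.lt_succ_iff_lt_or_eq.1 hj with h | h
    · exact Or.inl ⟨j, h, rfl⟩
    · exact Or.inr (by rw [Fin.ext h]; rfl)
  · rintro (⟨j, hj, rfl⟩ | rfl)
    · exact ⟨j, Nat.lt_succ_of_lt hj, rfl⟩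
    · exact ⟨i, Nat.lt_succ_self _, rfl⟩

theorem isHomogeneous_extendedIdeal {I : Ideal (MvPolynomial (Vars n) k)}
    (hI : I.IsHomogeneous (polyGrading k n)) :
    (extendedIdeal d I).IsHomogeneous (polyGrading (CoeffRing k n d) n) :=
  isHomogeneous_map_ideal hI C

theorem isHomogeneous_stageIdeal {I : Ideal (MvPolynomial (Vars n) k)}
    (hI : I.IsHomogeneous (polyGrading k n)) (m : ℕ) :
    (stageIdeal d I m).IsHomogeneous (polyGrading (CoeffRing k n d) n) :=
  (isHomogeneous_extendedIdeal d hI).sup (Ideal.homogeneous_span _ _ (by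
    rintro _ ⟨j, -, rfl⟩
    exact ⟨_, genericPoly_mem k n d j⟩))

section Isolate

variable {L : Type*} [CommRing L] (κ : MvPolynomial (Vars n) (CoeffRing k n d) →+* L)
  (w : CoeffIdx n d)

open Classical in
/-- Given a ring homomorphism `κ` from `k[u][x]`, replace the value of the coefficient `w` by a new
indeterminate. -/
def isolateVar : MvPolynomial (Vars n) (CoeffRing k n d) →+* Polynomial L :=
  eval₂Hom (eval₂Hom (Polynomial.C.comp (κ.comp (C.comp C)))
    fun c => if c = w then Polynomial.X else Polynomial.C (κ (C (X c))))
    fun x => Polynomial.C (κ (X x))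

theorem isolateVar_coeff_self : isolateVar d κ w (C (X w)) = Polynomial.X := by
  simp [isolateVar]

theorem isolateVar_coeff {c : CoeffIdx n d} (h : c ≠ w) :
    isolateVar d κ w (C (X c)) = Polynomial.C (κ (C (X c))) := by
  simp [isolateVar, h]

theorem isolateVar_map (y : MvPolynomial (Vars n) k) :
    isolateVar d κ w (MvPolynomial.map C y) = Polynomial.C (κ (MvPolynomial.map C y)) := by
  have : (isolateVar d κ w).comp (MvPolynomial.map C) =
      Polynomial.C.comp (κ.comp (MvPolynomial.map C)) := by
    refine MvPolynomial.ringHom_ext (fun a => ?_) fun x => ?_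
    · simp [isolateVar]
    · simp [isolateVar]
  exact RingHom.congr_fun this y

theorem eval_isolateVar (y : MvPolynomial (Vars n) (CoeffRing k n d)) :
    Polynomial.eval (κ (C (X w))) (isolateVar d κ w y) = κ y := by
  have : (Polynomial.evalRingHom (κ (C (X w)))).comp (isolateVar d κ w) = κ := by
    refine MvPolynomial.ringHom_ext (fun a => ?_) fun x => ?_
    · refine RingHom.congr_fun (f := ((Polynomial.evalRingHom (κ (C (X w)))).comp
        (isolateVar d κ w)).comp C) (g := κ.comp C) ?_ a
      refine MvPolynomial.ringHom_ext (fun a => ?_) fun c => ?_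
      · simp [isolateVar]
      · by_cases h : c = w
        · subst h
          simp [isolateVar_coeff_self]
        · simp [isolateVar_coeff d κ w h]
    · simp [isolateVar]
  exact RingHom.congr_fun this y

theorem monomial_X_eq (i : Fin s) (m : monomials n (d i)) :
    monomial m.1 (X ⟨i, m⟩ : CoeffRing k n d) = C (X ⟨i, m⟩) * MvPolynomial.map C (monomial m.1 1) := by
  rw [map_monomial, map_one, C_mul_monomial, mul_one]

theorem isolateVar_monomial_X (i : Fin s) (m : monomials n (d i)) (h : (⟨i, m⟩ : CoeffIdx n d) ≠ w) :
    isolateVar d κ w (monomial m.1 (X ⟨i, m⟩)) = Polynomial.C (κ (monomial m.1 (X ⟨i, m⟩))) := by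
  rw [monomial_X_eq, map_mul, isolateVar_coeff d κ w h, isolateVar_map, map_mul, map_mul]

theorem isolateVar_genericPoly {j : Fin s} (h : j ≠ w.1) :
    isolateVar d κ w (genericPoly k n d j) = Polynomial.C (κ (genericPoly k n d j)) := by
  rw [genericPoly, map_sum, map_sum, map_sum]
  refine Finset.sum_congr rfl fun m _ => isolateVar_monomial_X d κ w j m ?_
  rintro rfl
  exact h rfl

theorem isolateVar_genericPoly_self (i : Fin s) (m : monomials n (d i)) :
    ∃ b, isolateVar d κ ⟨i, m⟩ (genericPoly k n d i) =
      Polynomial.X * Polynomial.C (κ (monomial m.1 1)) + Polynomial.C b := by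
  classical
  refine ⟨∑ m' ∈ Finset.univ.erase m, κ (monomial m'.1 (X ⟨i, m'⟩)), ?_⟩
  rw [genericPoly, map_sum, ← Finset.add_sum_erase _ _ (Finset.mem_univ m), map_sum]
  congr 1
  · rw [monomial_X_eq, map_mul, isolateVar_coeff_self, isolateVar_map, map_monomial, map_one]
  · refine Finset.sum_congr rfl fun m' hm' => isolateVar_monomial_X d κ _ i m' ?_
    intro h
    exact Finset.ne_of_mem_erase hm' (eq_of_heq (Sigma.mk.inj h).2)

end Isolate

/-- Modulo `I` and the preceding generic polynomials, an element annihilated by a generic polynomial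
is annihilated by a power of each monomial of the same multidegree. -/
theorem exists_pow_mul_mem (I : Ideal (MvPolynomial (Vars n) k)) (i : Fin s)
    (m : monomials n (d i)) {z : MvPolynomial (Vars n) (CoeffRing k n d)}
    (hz : genericPoly k n d i * z ∈ stageIdeal d I i) :
    ∃ N : ℕ, monomial (N • m.1) 1 * z ∈ stageIdeal d I i := by
  set J := stageIdeal d I i
  -- `κ` maps to the localization of k[u][x]/J at the class of the monomial, so `κ z = 0` yields the
  -- required exponent. Its refinement `Φ` keeps the coefficient of this monomial as an
  -- indeterminate, and still kills `J` because the generators of `J` do not involve that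
  -- coefficient.
  set κ := quotLoc J (monomial m.1 1) with hκ
  have hκJ : ∀ y ∈ J, κ y = 0 := fun y hy => quotLoc_eq_zero J _ hy
  set Φ := isolateVar d κ ⟨i, m⟩ with hΦ
  have hΦJ : J ≤ RingHom.ker Φ := by
    refine sup_le ?_ ?_
    · rw [extendedIdeal, Ideal.map_le_iff_le_comap]
      intro y hy
      rw [Ideal.mem_comap, RingHom.mem_ker, hΦ, isolateVar_map,
        hκJ _ (Ideal.mem_sup_left (Ideal.mem_map_of_mem _ hy)), map_zero]
    · rw [Ideal.span_le]
      rintro _ ⟨j, hj, rfl⟩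
      rw [SetLike.mem_coe, RingHom.mem_ker, hΦ, isolateVar_genericPoly d κ ⟨i, m⟩ (by
        rintro rfl
        exact lt_irrefl j.1 hj),
        hκJ _ (Ideal.mem_sup_right (Ideal.subset_span ⟨j, hj, rfl⟩)), map_zero]
  have h1 : Φ (genericPoly k n d i) * Φ z = 0 := by
    rw [← map_mul]
    exact hΦJ hz
  obtain ⟨b, hb⟩ := isolateVar_genericPoly_self d κ i m
  obtain ⟨u, hu⟩ := isUnit_quotLoc J (monomial m.1 1)
  -- The image of U_i is a unit times a monic polynomial of degree one, hence a nonzerodivisor.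
  have h2 : Φ z = 0 := by
    have hmon : (Polynomial.X + Polynomial.C (b * (u⁻¹).val)).Monic := Polynomial.monic_X_add_C _
    rw [← hmon.mul_right_eq_zero_iff]
    have h3 : Φ (genericPoly k n d i) =
        (Polynomial.X + Polynomial.C (b * (u⁻¹).val)) * Polynomial.C u.val := by
      rw [hΦ, hb, hκ, ← hu, add_mul, ← Polynomial.C_mul, mul_assoc, Units.inv_mul, mul_one]
    rw [h3] at h1
    have h4 : IsUnit (Polynomial.C u.val) := Polynomial.isUnit_C.2 u.isUnit
    rw [mul_right_comm] at h1
    exact (h4.mul_left_eq_zero).1 h1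
  -- Evaluating the indeterminate at the actual coefficient recovers `κ` from `Φ`.
  have h3 : κ z = 0 := by
    rw [← eval_isolateVar d κ ⟨i, m⟩ z, ← hΦ, h2, Polynomial.eval_zero]
  obtain ⟨N, hN⟩ := exists_pow_mul_mem_of_quotLoc_eq_zero J _ h3
  refine ⟨N, ?_⟩
  rwa [monomial_pow, one_pow] at hN

theorem eventually_mem_stageIdeal {I : Ideal (MvPolynomial (Vars n) k)}
    (hI : I.IsHomogeneous (polyGrading k n)) (i : Fin s) :
    ∀ᶠ ν in atTop, ∀ z ∈ polyGrading (CoeffRing k n d) n ν,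
      genericPoly k n d i * z ∈ stageIdeal d I i → z ∈ stageIdeal d I i :=
  eventually_mem_of_pow_mul_mem (K := Submodule.comap (LinearMap.mulLeft
    (MvPolynomial (Vars n) (CoeffRing k n d)) (genericPoly k n d i)) (stageIdeal d I i))
    (isHomogeneous_stageIdeal d hI i) (d i)
    fun _ hz e he => exists_pow_mul_mem d I i ⟨e, he⟩ hz

theorem finrank_comp_extendedIdeal (I : Ideal (MvPolynomial (Vars n) k)) (ν : Fin q → ℕ) :
    Module.finrank (CoeffRing k n d) (Comp (extendedIdeal d I) ν) =
      Module.finrank k (quotGrading k (polyGrading k n) I ν) :=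
  (compExtEquiv (A := CoeffRing k n d) I ν).finrank_eq.trans Module.finrank_baseChange

/-- Each generic polynomial is regular in large multidegrees, so adding it replaces the rank
function by its difference in direction `d i`, and the degree bound drops by one. Measuring by
`degLT`, whose zeroth term is the zero submodule, also covers zero Hilbert polynomials and lets the
count end at 0. -/
theorem exists_degLT_stageIdeal {I : Ideal (MvPolynomial (Vars n) k)}
    (hI : I.IsHomogeneous (polyGrading k n))
    (hs : relevantDim k (quotGrading k (polyGrading k n) I) = (s : ℤ) - 1) (m : ℕ) (hm : m ≤ s) :
    ∃ P ∈ degLT q (s - m), ∀ᶠ ν in atTop,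
      (Module.finrank (CoeffRing k n d) (Comp (stageIdeal d I m) ν) : ℚ) = evalNat P ν := by
  induction m with
  | zero =>
    obtain ⟨P, hP, h⟩ := exists_degLT_of_relevantDim hI hs
    refine ⟨P, hP, ?_⟩
    filter_upwards [h] with ν hν
    rw [stageIdeal_zero, finrank_comp_extendedIdeal, hν]
  | succ m ih =>
    obtain ⟨P, hP, h⟩ := ih (by omega)
    set i : Fin s := ⟨m, hm⟩
    refine ⟨P - shiftPoly (d i) P, sub_shiftPoly_mem (d i)
      (by rwa [show s - (m + 1) + 1 = s - m by omega]), ?_⟩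
    filter_upwards [h, (tendsto_tsub_atTop (d i)).eventually h, eventually_ge_atTop (d i),
      (tendsto_tsub_atTop (d i)).eventually (eventually_mem_stageIdeal d hI i)] with ν h1 h2 h3 h4
    have h5 := finrank_comp_add (isHomogeneous_stageIdeal d hI m)
      (J' := stageIdeal d I m) (μ := ν - d i) (genericPoly_mem k n d i)
      fun y hy => ⟨h4 y hy, fun h => Ideal.mul_mem_left _ _ h⟩
    rw [add_tsub_cancel_of_le h3, ← stageIdeal_succ d I i] at h5
    have h6 : evalNat (P - shiftPoly (d i) P) ν = evalNat P ν - evalNat P (ν - d i) := by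
      rw [← evalNat_shiftPoly P h3]
      simp [evalNat]
    rw [h6, ← h1, ← h2, h5]
    push_cast
    ring

theorem eventually_finrank_stageIdeal {I : Ideal (MvPolynomial (Vars n) k)}
    (hI : I.IsHomogeneous (polyGrading k n))
    (hs : relevantDim k (quotGrading k (polyGrading k n) I) = (s : ℤ) - 1) :
    ∀ᶠ ν in atTop, Module.finrank (CoeffRing k n d) (Comp (stageIdeal d I s) ν) = 0 := by
  obtain ⟨P, hP, h⟩ := exists_degLT_stageIdeal d hI hs s le_rfl
  rw [Nat.sub_self, degLT_zero, Submodule.mem_bot] at hP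
  filter_upwards [h] with ν hν
  rw [hP] at hν
  simpa [evalNat] using hν

theorem exists_ne_zero_smul_eq_zero {A N : Type*} [CommRing A] [IsDomain A] [AddCommGroup N]
    [Module A N] [Module.Finite A N] (h : Module.finrank A N = 0) :
    ∃ a : A, a ≠ 0 ∧ ∀ x : N, a • x = 0 := by
  classical
  rw [Module.finrank_eq_zero_iff_isTorsion] at h
  obtain ⟨G, hG⟩ := Module.Finite.fg_top (R := A) (M := N)
  choose a ha using fun x : N => @h x
  refine ⟨∏ x ∈ G, (a x : A), Finset.prod_ne_zero_iff.2 fun x _ => nonZeroDivisors.ne_zero (a x).2,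
    fun x => ?_⟩
  have hx : x ∈ Submodule.span A (G : Set N) := hG ▸ Submodule.mem_top
  induction hx using Submodule.span_induction with
  | mem x hx =>
    rw [← Finset.prod_erase_mul _ _ hx, mul_smul]
    have : (a x : A) • x = 0 := ha x
    rw [this, smul_zero]
  | zero => rw [smul_zero]
  | add x y _ _ hx hy => rw [smul_add, hx, hy, add_zero]
  | smul c x _ hx => rw [smul_comm, hx, smul_zero]

/-- For large enough multidegrees the component of `k[u][x]` is killed, modulo `I` and the generic
polynomials, by a nonzero polynomial in the generic coefficients. -/
theorem eventually_exists_smul_mem {I : Ideal (MvPolynomial (Vars n) k)}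
    (hI : I.IsHomogeneous (polyGrading k n))
    (hs : relevantDim k (quotGrading k (polyGrading k n) I) = (s : ℤ) - 1) :
    ∀ᶠ ν in atTop, ∃ a : CoeffRing k n d, a ≠ 0 ∧
      ∀ y ∈ polyGrading (CoeffRing k n d) n ν, a • y ∈ stageIdeal d I s := by
  filter_upwards [eventually_finrank_stageIdeal d hI hs] with ν hν
  obtain ⟨a, ha, h⟩ := exists_ne_zero_smul_eq_zero hν
  refine ⟨a, ha, fun y hy => ?_⟩
  have := h (Submodule.Quotient.mk ⟨y, hy⟩)
  rw [← Submodule.Quotient.mk_smul, comp_mk_eq_zero] at this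
  exact this

end Generic

end MultiRes

end

noncomputable section

namespace MultiRes

/-! ### Acyclicity of the Koszul complex in large multidegrees -/

section KoszulAcyclic

variable {q s : ℕ} {A : Type*} [CommRing A] {R : Type*} [CommRing R] [Algebra A R]
  {M : Type*} [AddCommGroup M] [Module A M] [Module R M] [IsScalarTower A R M]

/-- The Koszul differential on the direct sum of all exterior powers, with coordinates indexed by
the subsets of the index set. -/
def koszulTot (M : Type*) [AddCommGroup M] [Module R M] (f : Fin s → R) :
    (Finset (Fin s) → M) →ₗ[R] (Finset (Fin s) → M) :=
  LinearMap.pi fun S => ∑ j : Fin s, if j ∈ S then 0 else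
    ((-1 : R) ^ (S.filter (· < j)).card * f j) • LinearMap.proj (Insert.insert j S)

theorem koszulTot_apply (f : Fin s → R) (c : Finset (Fin s) → M) (S : Finset (Fin s)) :
    koszulTot M f c S = ∑ j : Fin s, if j ∈ S then 0 else
      ((-1 : R) ^ (S.filter (· < j)).card * f j) • c (Insert.insert j S) := by
  simp only [koszulTot, LinearMap.pi_apply, LinearMap.sum_apply]
  refine Finset.sum_congr rfl fun j _ => ?_
  split_ifs <;> rfl

theorem koszulTot_empty (f : Fin s → R) (c : Finset (Fin s) → M) :
    koszulTot M f c ∅ = ∑ j : Fin s, f j • c {j} := by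
  rw [koszulTot_apply]
  simp

theorem koszulD_eq_koszulTot (f : Fin s → R) (p : ℕ) (c : Finset (Fin s) → M) (S : KIdx s p) :
    koszulD M f p (fun T => c T.1) S = koszulTot M f c S.1 := by
  rw [koszulTot_apply, Finset.sum_ite, Finset.sum_const_zero, zero_add]
  refine Eq.trans ?_ (Finset.sum_subtype (p := fun j => j ∉ S.1) (F := Subtype.fintype _)
    (Finset.univ.filter fun j => j ∉ S.1) (by simp) _).symm
  simp [koszulD, KIdx.insert]

theorem koszulTot_koszulTot (f : Fin s → R) (c : Finset (Fin s) → M) :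
    koszulTot M f (koszulTot M f c) = 0 := by
  funext S
  have h1 := koszulD_eq_koszulTot f S.card (koszulTot M f c) ⟨S, rfl⟩
  have h2 : (fun T : KIdx s (S.card + 1) => koszulTot M f c T.1) =
      koszulD M f (S.card + 1) fun T => c T.1 :=
    funext fun T => (koszulD_eq_koszulTot f _ c T).symm
  rw [h2, koszulD_koszulD] at h1
  exact h1.symm

/-- The function vanishes on all subsets that have an element `≥ m`. -/
def SuppLT (m : ℕ) (c : Finset (Fin s) → M) : Prop := ∀ S, ∀ j ∈ S, m ≤ j.1 → c S = 0

theorem SuppLT.koszulTot {m : ℕ} {c : Finset (Fin s) → M} (h : SuppLT m c) (f : Fin s → R) :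
    SuppLT m (koszulTot M f c) := by
  intro S j hj hm
  rw [koszulTot_apply]
  refine Finset.sum_eq_zero fun l _ => ?_
  split_ifs
  · rfl
  · rw [h _ j (Finset.mem_insert_of_mem hj) hm, smul_zero]

/-- The part of `c` that involves the basis element of index `i`. -/
def contractAt (i : Fin s) (c : Finset (Fin s) → M) : Finset (Fin s) → M :=
  fun S => if i ∈ S then 0 else c (Insert.insert i S)

/-- The product with the basis element of index `i`. -/
def extendAt (i : Fin s) (c : Finset (Fin s) → M) : Finset (Fin s) → M :=
  fun S => if i ∈ S then c (S.erase i) else 0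

theorem contractAt_extendAt {i : Fin s} {c : Finset (Fin s) → M} (h : SuppLT i.1 c) :
    contractAt i (extendAt i c) = c := by
  funext S
  by_cases hi : i ∈ S
  · simp [contractAt, hi, h S i hi le_rfl]
  · simp [contractAt, extendAt, hi, Finset.erase_insert hi]

theorem suppLT_contractAt {i : Fin s} {c : Finset (Fin s) → M} (h : SuppLT (i.1 + 1) c) :
    SuppLT i.1 (contractAt i c) := by
  intro S j hj hm
  by_cases hi : i ∈ S
  · simp [contractAt, hi]
  · have : i.1 ≠ j.1 := fun e => hi (Fin.ext e ▸ hj)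
    simp [contractAt, hi, h _ j (Finset.mem_insert_of_mem hj) (by omega)]

theorem suppLT_extendAt {i : Fin s} {c : Finset (Fin s) → M} (h : SuppLT i.1 c) :
    SuppLT (i.1 + 1) (extendAt i c) := by
  intro S j hj hm
  by_cases hi : i ∈ S
  · have : j ≠ i := by
      rintro rfl
      omega
    simp [extendAt, hi, h _ j (Finset.mem_erase.2 ⟨this, hj⟩) (by omega)]
  · simp [extendAt, hi]

/-- As `i` is the largest index that occurs in `c`, it enters no sign attached to a smaller index,
and contraction commutes with the differential without sign. The terms with larger indices vanish on
both sides. -/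
theorem koszulTot_contractAt {i : Fin s} {c : Finset (Fin s) → M} (h : SuppLT (i.1 + 1) c)
    (f : Fin s → R) {S : Finset (Fin s)} (hi : i ∉ S) :
    koszulTot M f (contractAt i c) S = koszulTot M f c (Insert.insert i S) := by
  rw [koszulTot_apply, koszulTot_apply]
  refine Finset.sum_congr rfl fun j _ => ?_
  by_cases hj : j ∈ S
  · rw [if_pos hj, if_pos (Finset.mem_insert_of_mem hj)]
  rw [if_neg hj]
  rcases lt_trichotomy j i with hji | rfl | hji
  · have h1 : i ∉ Insert.insert j S := by simp [hi, hji.ne']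
    have h2 : j ∉ Insert.insert i S := by simp [hj, hji.ne]
    rw [if_neg h2, contractAt, if_neg h1, Finset.filter_insert, if_neg (not_lt.2 hji.le),
      Finset.insert_comm]
  · simp [contractAt]
  · have h2 : j ∉ Insert.insert i S := by simp [hj, hji.ne']
    have h3 : i.1 + 1 ≤ j.1 := hji
    rw [if_neg h2, h _ j (Finset.mem_insert_self _ _) h3,
      suppLT_contractAt h _ j (Finset.mem_insert_self _ _) (by omega), smul_zero, smul_zero]

variable {𝒜 : (Fin q → ℕ) → Submodule A R} {𝒢 : (Fin q → ℕ) → Submodule A M}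
  {d : Fin s → Fin q → ℕ} {f : Fin s → R}

/-- The coordinates of `c` have the multidegrees of the slice of multidegree `ν`. -/
def InSlice (𝒢 : (Fin q → ℕ) → Submodule A M) (d : Fin s → Fin q → ℕ) (ν : Fin q → ℕ)
    (c : Finset (Fin s) → M) : Prop :=
  ∀ S, c S ∈ shiftedPiece 𝒢 (∑ i ∈ S, d i) ν

theorem inSlice_zero (ν : Fin q → ℕ) : InSlice 𝒢 d ν 0 := fun _ => zero_mem _

theorem InSlice.add {ν : Fin q → ℕ} {c c' : Finset (Fin s) → M} (h : InSlice 𝒢 d ν c)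
    (h' : InSlice 𝒢 d ν c') : InSlice 𝒢 d ν (c + c') := fun S => add_mem (h S) (h' S)

theorem InSlice.sub {ν : Fin q → ℕ} {c c' : Finset (Fin s) → M} (h : InSlice 𝒢 d ν c)
    (h' : InSlice 𝒢 d ν c') : InSlice 𝒢 d ν (c - c') := fun S => sub_mem (h S) (h' S)

theorem InSlice.koszulTot (h𝒢 : IsGradedSMul A 𝒜 𝒢) (hf : ∀ i, f i ∈ 𝒜 (d i)) {ν : Fin q → ℕ}
    {c : Finset (Fin s) → M} (h : InSlice 𝒢 d ν c) : InSlice 𝒢 d ν (koszulTot M f c) := by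
  intro S
  rw [koszulTot_apply]
  refine Submodule.sum_mem _ fun j _ => ?_
  split_ifs with hj
  · exact zero_mem _
  · have h1 := h (Insert.insert j S)
    rw [Finset.sum_insert hj] at h1
    have h2 := smul_mem_shiftedPiece h𝒢 (hf j) h1
    rw [mul_smul]
    rcases neg_one_pow_eq_or R (S.filter (· < j)).card with h3 | h3
    · rwa [h3, one_smul]
    · rw [h3, neg_one_smul]
      exact neg_mem h2

theorem shiftedPiece_add (δ : Fin q → ℕ) {δ' ν : Fin q → ℕ} (h : δ' ≤ ν) :
    shiftedPiece 𝒢 (δ' + δ) ν = shiftedPiece 𝒢 δ (ν - δ') := by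
  unfold shiftedPiece
  by_cases h1 : δ' + δ ≤ ν
  · rw [if_pos h1, if_pos (le_tsub_of_add_le_left h1), tsub_add_eq_tsub_tsub]
  · rw [if_neg h1, if_neg fun h2 => h1 ((le_tsub_iff_left h).1 h2)]

theorem InSlice.contractAt {ν : Fin q → ℕ} {c : Finset (Fin s) → M} (h : InSlice 𝒢 d ν c)
    {i : Fin s} (hi : d i ≤ ν) : InSlice 𝒢 d (ν - d i) (contractAt i c) := by
  intro S
  unfold MultiRes.contractAt
  split_ifs with hS
  · exact zero_mem _
  · rw [← shiftedPiece_add _ hi, ← Finset.sum_insert hS]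
    exact h _

theorem InSlice.extendAt {ν : Fin q → ℕ} {c : Finset (Fin s) → M} {i : Fin s}
    (h : InSlice 𝒢 d (ν - d i) c) (hi : d i ≤ ν) : InSlice 𝒢 d ν (extendAt i c) := by
  intro S
  unfold MultiRes.extendAt
  split_ifs with hS
  · rw [← Finset.add_sum_erase _ _ hS, shiftedPiece_add _ hi]
    exact h _
  · exact zero_mem _

/-- If the sequence `f` is regular in multidegrees at least `ν0`, then the slices of large enough
multidegree of its Koszul complex have no homology in positive degrees. -/
theorem exists_koszulTot_eq (h𝒢 : IsGradedSMul A 𝒜 𝒢) (hf : ∀ i, f i ∈ 𝒜 (d i)) {ν0 : Fin q → ℕ}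
    (hreg : ∀ i : Fin s, ∀ μ, ν0 ≤ μ → ∀ m ∈ 𝒢 μ,
      (∃ b : Fin s → M, f i • m = ∑ j ∈ Finset.Iio i, f j • b j) →
      ∃ b : Fin s → M, (∀ j, b j ∈ shiftedPiece 𝒢 (d j) μ) ∧ m = ∑ j ∈ Finset.Iio i, f j • b j)
    (m : ℕ) (hm : m ≤ s) : ∀ ν, (ν0 + ∑ j : Fin s with j.1 < m, d j) ≤ ν →
      ∀ c : Finset (Fin s) → M, InSlice 𝒢 d ν c → SuppLT m c → c ∅ = 0 → koszulTot M f c = 0 →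
      ∃ b, InSlice 𝒢 d ν b ∧ SuppLT m b ∧ b ∅ = 0 ∧ koszulTot M f b = c := by
  induction m with
  | zero =>
    intro ν _ c _ hc h0 _
    refine ⟨0, inSlice_zero ν, fun _ _ _ _ => rfl, rfl, ?_⟩
    rw [map_zero]
    funext S
    rcases S.eq_empty_or_nonempty with rfl | ⟨j, hj⟩
    · exact h0.symm
    · exact (hc S j hj (Nat.zero_le _)).symm
  | succ m ih =>
    intro ν hν c hcS hc h0 hD
    set i : Fin s := ⟨m, hm⟩ with hi
    have hsum : ∑ j : Fin s with j.1 < m + 1, d j = d i + ∑ j : Fin s with j.1 < m, d j := by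
      rw [← Finset.sum_insert (by simp [hi])]
      congr 1
      ext j
      simp only [Finset.mem_filter, Finset.mem_univ, true_and, Finset.mem_insert, hi, Fin.ext_iff]
      omega
    rw [hsum] at hν
    have hle : d i ≤ ν := le_trans (le_trans le_self_add le_add_self) hν
    have hν1 : ν0 + ∑ j : Fin s with j.1 < m, d j ≤ ν := by
      refine le_trans ?_ hν
      gcongr
      exact le_add_self
    have hν2 : ν0 + ∑ j : Fin s with j.1 < m, d j ≤ ν - d i := by
      refine le_tsub_of_add_le_left (le_trans (le_of_eq ?_) hν)
      rw [add_left_comm]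
    -- Write c = c₀ + e_i ∧ c₁ with c₀ and c₁ free of e_i. Then c₁ is a cycle for the first m
    -- elements of the sequence, to which the induction hypothesis applies once its coordinate at ∅
    -- has been removed.
    set c1 := contractAt i c with hc1
    have hc1S : InSlice 𝒢 d (ν - d i) c1 := hcS.contractAt hle
    have hc1m : SuppLT m c1 := suppLT_contractAt (i := i) hc
    have hc1D : koszulTot M f c1 = 0 := by
      funext S
      by_cases hS : i ∈ S
      · exact hc1m.koszulTot f S i hS le_rfl
      · rw [hc1, koszulTot_contractAt hc f hS, hD]
        rfl
    -- The ∅-coordinate of D c = 0 says that f_i c₁(∅) is a combination of the earlier f_j, so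
    -- regularity applies to c₁(∅).
    obtain ⟨b1, hb1, hb1e⟩ := hreg i (ν - d i) (le_self_add.trans hν2) (c1 ∅) (by
      have := hc1S ∅
      rw [Finset.sum_empty, shiftedPiece, if_pos zero_le, tsub_zero] at this
      exact this) (by
      refine ⟨fun j => - c {j}, ?_⟩
      have h1 := congrFun hD ∅
      rw [koszulTot_empty, Pi.zero_apply, ← Finset.add_sum_erase _ _ (Finset.mem_univ i)] at h1
      have h2 : c1 ∅ = c {i} := by simp [hc1, contractAt]
      rw [h2, eq_neg_of_add_eq_zero_left h1, ← Finset.sum_neg_distrib]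
      rw [← Finset.sum_subset (s₁ := Finset.Iio i) (fun j hj => ?_) fun j hj hj' => ?_]
      · exact Finset.sum_congr rfl fun j _ => (smul_neg _ _).symm
      · exact Finset.mem_erase.2 ⟨(Finset.mem_Iio.1 hj).ne, Finset.mem_univ j⟩
      · have h3 : i < j := lt_of_le_of_ne (not_lt.1 fun h => hj' (Finset.mem_Iio.2 h))
          (Finset.ne_of_mem_erase hj).symm
        rw [hc {j} j (Finset.mem_singleton_self j) h3, smul_zero, neg_zero])
    -- `β1` is the chain ∑_{j<i} e_j ⊗ b_j; its boundary is concentrated at ∅ and equals c₁(∅)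
    -- there.
    set β1 : Finset (Fin s) → M := fun S => ∑ j ∈ Finset.Iio i, if S = {j} then b1 j else 0
    have hβ1S : InSlice 𝒢 d (ν - d i) β1 := by
      intro S
      refine Submodule.sum_mem _ fun j _ => ?_
      split_ifs with h
      · rw [h, Finset.sum_singleton]
        exact hb1 j
      · exact zero_mem _
    have hβ1m : SuppLT m β1 := by
      intro S j hj hmj
      refine Finset.sum_eq_zero fun l hl => if_neg ?_
      rintro rfl
      rw [Finset.mem_singleton] at hj
      subst hj
      exact absurd (Finset.mem_Iio.1 hl) (not_lt.2 hmj)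
    have hβ10 : β1 ∅ = 0 :=
      Finset.sum_eq_zero fun l _ => if_neg (Finset.singleton_ne_empty l).symm
    have hβ1D : koszulTot M f β1 ∅ = c1 ∅ := by
      rw [koszulTot_empty, hb1e]
      refine (Finset.sum_subset (Finset.subset_univ (Finset.Iio i)) fun j _ hj => ?_).symm.trans
        (Finset.sum_congr rfl fun j hj => ?_)
      · rw [hβ1m {j} j (Finset.mem_singleton_self j)
          (not_lt.1 fun h => hj (Finset.mem_Iio.2 h)), smul_zero]
      · congr 1
        simp only [β1, Finset.singleton_inj]
        rw [Finset.sum_ite_eq, if_pos hj]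
    obtain ⟨β2, hβ2S, hβ2m, hβ20, hβ2D⟩ := ih (by omega) (ν - d i) hν2 (c1 - koszulTot M f β1)
      (hc1S.sub (hβ1S.koszulTot h𝒢 hf))
      (fun S j hj hmj => by
        rw [Pi.sub_apply, hc1m S j hj hmj, hβ1m.koszulTot f S j hj hmj, sub_zero])
      (by rw [Pi.sub_apply, hβ1D, sub_self])
      (by rw [map_sub, hc1D, koszulTot_koszulTot, sub_zero])
    have hβm : SuppLT i.1 (β1 + β2) := fun S j hj hmj => by
      rw [Pi.add_apply, hβ1m S j hj hmj, hβ2m S j hj hmj, add_zero]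
    have hβD : koszulTot M f (β1 + β2) = c1 := by
      rw [map_add, hβ2D, add_sub_cancel]
    -- The boundary of e_i ∧ (β₁ + β₂) has the same e_i-part as `c`, so `c` minus this boundary no
    -- longer involves e_i. It vanishes at ∅ because β₁ and β₂ do.
    set b := extendAt i (β1 + β2) with hb
    have hbm : SuppLT (i.1 + 1) b := suppLT_extendAt hβm
    have hbS : InSlice 𝒢 d ν b := (hβ1S.add hβ2S).extendAt hle
    have hb0 : b ∅ = 0 := by simp [hb, extendAt]
    have hbD0 : koszulTot M f b ∅ = 0 := by
      rw [koszulTot_empty]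
      refine Finset.sum_eq_zero fun j _ => ?_
      have : b {j} = 0 := by
        by_cases h : i = j
        · subst h
          simp [hb, extendAt, hβ10, hβ20]
        · simp [hb, extendAt, h]
      rw [this, smul_zero]
    obtain ⟨β3, hβ3S, hβ3m, hβ30, hβ3D⟩ := ih (by omega) ν hν1 (c - koszulTot M f b)
      (hcS.sub (hbS.koszulTot h𝒢 hf))
      (fun S j hj hmj => by
        rw [Pi.sub_apply]
        by_cases hS : i ∈ S
        · have h1 : i ∉ S.erase i := Finset.notMem_erase i S
          have h2 := koszulTot_contractAt hbm f h1
          rw [hb, contractAt_extendAt hβm, hβD, Finset.insert_erase hS, ← hb, hc1, contractAt,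
            if_neg h1, Finset.insert_erase hS] at h2
          rw [h2, sub_self]
        · have h1 : i.1 + 1 ≤ j.1 := by
            have : j ≠ i := fun e => hS (e ▸ hj)
            have : j.1 ≠ m := fun e => this (Fin.ext e)
            change m + 1 ≤ j.1
            omega
          rw [hc S j hj h1, hbm.koszulTot f S j hj h1, sub_zero])
      (by rw [Pi.sub_apply, h0, hbD0, sub_zero])
      (by rw [map_sub, hD, koszulTot_koszulTot, sub_zero])
    refine ⟨b + β3, hbS.add hβ3S, fun S j hj hmj => ?_, ?_, ?_⟩
    · rw [Pi.add_apply, hbm S j hj hmj, hβ3m S j hj (by omega), add_zero]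
    · rw [Pi.add_apply, hb0, hβ30, add_zero]
    · rw [map_add, hβ3D, add_sub_cancel]

/-- Acyclicity of the slices of the Koszul complex in positive degrees. -/
theorem exact_koszulSliceD (h𝒢 : IsGradedSMul A 𝒜 𝒢) (hf : ∀ i, f i ∈ 𝒜 (d i)) {ν0 : Fin q → ℕ}
    (hreg : ∀ i : Fin s, ∀ μ, ν0 ≤ μ → ∀ m ∈ 𝒢 μ,
      (∃ b : Fin s → M, f i • m = ∑ j ∈ Finset.Iio i, f j • b j) →
      ∃ b : Fin s → M, (∀ j, b j ∈ shiftedPiece 𝒢 (d j) μ) ∧ m = ∑ j ∈ Finset.Iio i, f j • b j)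
    {ν : Fin q → ℕ} (hν : ν0 + ∑ j, d j ≤ ν) (p : ℕ) :
    Function.Exact (koszulSliceD h𝒢 hf ν (p + 1)) (koszulSliceD h𝒢 hf ν p) := by
  intro c
  constructor
  · intro hc
    -- A chain of exterior degree p + 1 is extended by zero to all subsets, which makes the
    -- statement for the total differential applicable.
    set c' : Finset (Fin s) → M := fun S => if h : S.card = p + 1 then c.1 ⟨S, h⟩ else 0 with hc'
    have hres : (fun T : KIdx s (p + 1) => c' T.1) = c.1 := funext fun T => by
      simp [hc', T.2]
    obtain ⟨b, hbS, -, -, hbD⟩ := exists_koszulTot_eq h𝒢 hf hreg s le_rfl ν (by simpa using hν) c'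
      (fun S => by
        simp only [hc']
        split_ifs with h
        · exact c.2 ⟨S, h⟩ (Set.mem_univ _)
        · exact zero_mem _)
      (fun S j _ hj => absurd j.2 (not_lt.2 hj)) (by simp [hc'])
      (by
        funext S
        by_cases h : S.card = p
        · rw [← koszulD_eq_koszulTot f p c' ⟨S, h⟩, hres]
          exact congrFun (congrArg Subtype.val hc) ⟨S, h⟩
        · rw [koszulTot_apply]
          refine Finset.sum_eq_zero fun j _ => ?_
          split_ifs with hj
          · rfl
          · have : c' (Insert.insert j S) = 0 := dif_neg (by
              rw [Finset.card_insert_of_notMem hj]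
              omega)
            rw [this, smul_zero])
    refine ⟨⟨fun T => b T.1, fun T _ => hbS T.1⟩, Subtype.ext (funext fun T => ?_)⟩
    refine (koszulD_eq_koszulTot f (p + 1) b T).trans ?_
    rw [hbD, ← hres]
  · rintro ⟨b, rfl⟩
    exact Subtype.ext (koszulD_koszulD f p b.1)

end KoszulAcyclic

end MultiRes

end

noncomputable section

namespace MultiRes

/-! ### Lengths of localized modules -/

section LocalLength

variable {A : Type*} [CommRing A] (S : Submonoid A)

/-- The length of the localization of a module. -/
def lenLoc (N : Type*) [AddCommGroup N] [Module A N] : ℕ∞ :=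
  Module.length (Localization S) (LocalizedModule S N)

variable {N N' N'' : Type*} [AddCommGroup N] [Module A N] [AddCommGroup N'] [Module A N']
  [AddCommGroup N''] [Module A N'']

theorem exact_localizedModule_map {g : N' →ₗ[A] N} {h : N →ₗ[A] N''} (H : Function.Exact g h) :
    Function.Exact (LocalizedModule.map S g) (LocalizedModule.map S h) :=
  LocalizedModule.map_exact S g h H

theorem lenLoc_eq_add_of_exact {g : N' →ₗ[A] N} {h : N →ₗ[A] N''} (hg : Function.Injective g)
    (hh : Function.Surjective h) (H : Function.Exact g h) :
    lenLoc S N = lenLoc S N' + lenLoc S N'' :=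
  Module.length_eq_add_of_exact (LocalizedModule.map S g) (LocalizedModule.map S h)
    (LocalizedModule.map_injective S g hg) (LocalizedModule.map_surjective S h hh)
    (exact_localizedModule_map S H)

theorem lenLoc_congr (e : N ≃ₗ[A] N') : lenLoc S N = lenLoc S N' :=
  le_antisymm
    (Module.length_le_of_injective (LocalizedModule.map S e.toLinearMap)
      (LocalizedModule.map_injective S _ e.injective))
    (Module.length_le_of_surjective (LocalizedModule.map S e.toLinearMap)
      (LocalizedModule.map_surjective S _ e.surjective))

/-- The hypothesis says that `g` becomes surjective after localization, and a surjection does not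
increase length. -/
theorem lenLoc_le_of_smul_mem_range (g : N →ₗ[A] N')
    (h : ∀ y, ∃ a ∈ S, a • y ∈ LinearMap.range g) : lenLoc S N' ≤ lenLoc S N := by
  refine Module.length_le_of_surjective (LocalizedModule.map S g) fun y => ?_
  induction y using LocalizedModule.induction_on with
  | h y t =>
    obtain ⟨a, ha, x, hx⟩ := h y
    refine ⟨LocalizedModule.mk x (⟨a, ha⟩ * t), ?_⟩
    rw [LocalizedModule.map_mk, hx]
    exact LocalizedModule.mk_cancel_common_left ⟨a, ha⟩ t y

theorem lenLoc_eq_zero {a : A} (ha : a ∈ S) (h : ∀ x : N, a • x = 0) : lenLoc S N = 0 := by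
  have : Subsingleton (LocalizedModule S N) :=
    LocalizedModule.subsingleton_iff.2 fun x => ⟨a, ha, h x⟩
  exact Module.length_eq_zero

theorem lenLoc_eq_zero_of_subsingleton [Subsingleton N] : lenLoc S N = 0 :=
  lenLoc_eq_zero S S.one_mem fun _ => Subsingleton.elim _ _

end LocalLength

/-! ### Length of a cokernel and multiplicity of the determinant -/

section Determinant

theorem ord_prod {O : Type*} [CommRing O] [IsDomain O] {ι : Type*} (t : Finset ι) (a : ι → O)
    (h : ∀ i ∈ t, a i ≠ 0) : Ring.ord O (∏ i ∈ t, a i) = ∑ i ∈ t, Ring.ord O (a i) := by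
  classical
  induction t using Finset.induction_on with
  | empty => simp
  | insert i t hi ih =>
    rw [Finset.prod_insert hi, Finset.sum_insert hi,
      Ring.ord_mul' O (mem_nonZeroDivisors_of_ne_zero (h i (Finset.mem_insert_self i t))),
      ih fun j hj => h j (Finset.mem_insert_of_mem hj)]

/-- Over a principal ideal domain, the length of the cokernel of an injective endomorphism is the
order of its determinant. -/
theorem length_quotient_range {O E : Type*} [CommRing O] [IsDomain O] [IsPrincipalIdealRing O]
    [AddCommGroup E] [Module O E] {ι : Type*} [Fintype ι] [DecidableEq ι] (b : Module.Basis ι O E)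
    (φ : E →ₗ[O] E) (h : LinearMap.det φ ≠ 0) :
    Module.length O (E ⧸ LinearMap.range φ) = Ring.ord O (LinearMap.det φ) := by
  have := Module.Free.of_basis b
  have := Module.Finite.of_basis b
  have hinj : Function.Injective φ := by
    rw [← LinearMap.ker_eq_bot]
    by_contra hk
    exact h (LinearMap.det_eq_zero_iff_ker_ne_bot.2 hk)
  have hfr := LinearMap.finrank_range_of_inj hinj
  -- Smith normal form of the range: the a_i b1_i form a basis of it, so the cokernel is the product
  -- of the quotients O/(a_i).
  set a := Submodule.smithNormalFormCoeffs b hfr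
  set b1 := Submodule.smithNormalFormTopBasis b hfr
  set b2 := Submodule.smithNormalFormBotBasis b hfr
  have hb : ∀ i, (b2 i : E) = a i • b1 i := Submodule.smithNormalFormBotBasis_def b hfr
  set e := LinearEquiv.ofInjective φ hinj
  -- This automorphism sends b1_i to the preimage of a_i b1_i under φ, so φ ∘ e2 is diagonal in the
  -- basis b1 and det φ equals ∏ a_i up to a unit.
  set e2 : E ≃ₗ[O] E := b1.equiv (b2.map e.symm) (Equiv.refl ι)
  have hφ : ∀ i, φ (e2 (b1 i)) = a i • b1 i := by
    intro i
    rw [← hb]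
    have h1 : e2 (b1 i) = e.symm (b2 i) := by simp [e2]
    rw [h1]
    exact congrArg Subtype.val (e.apply_symm_apply (b2 i))
  have hdet : LinearMap.det (φ ∘ₗ (e2 : E →ₗ[O] E)) = ∏ i, a i := by
    rw [← LinearMap.det_toMatrix b1]
    have : LinearMap.toMatrix b1 b1 (φ ∘ₗ (e2 : E →ₗ[O] E)) = Matrix.diagonal a := by
      ext i j
      rw [LinearMap.toMatrix_apply, LinearMap.comp_apply, LinearEquiv.coe_coe, hφ, map_smul,
        Module.Basis.repr_self, Finsupp.smul_single, smul_eq_mul, mul_one, Matrix.diagonal_apply,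
        Finsupp.single_apply]
      by_cases hij : i = j
      · subst hij
        simp
      · rw [if_neg hij, if_neg (Ne.symm hij)]
    rw [this, Matrix.det_diagonal]
  rw [(Submodule.quotientEquivPiSpan _ b hfr).length_eq, Module.length_pi_of_fintype]
  change ∑ i, Ring.ord O (a i) = _
  rw [← ord_prod _ _ fun i _ => Submodule.smithNormalFormCoeffs_ne_zero b hfr i, ← hdet,
    LinearMap.det_comp]
  exact Ring.ord_mul_of_isUnit_right (LinearEquiv.isUnit_det' e2) _

variable {A : Type*} [CommRing A] [IsDomain A] (S : Submonoid A)

theorem lenLoc_quotient_range_eq_length {E : Type*} [AddCommGroup E] [Module A E]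
    (φ : E →ₗ[A] E) :
    lenLoc S (E ⧸ LinearMap.range φ) = Module.length (Localization S)
      (LocalizedModule S E ⧸ LinearMap.range (LocalizedModule.map S φ)) := by
  have hex : Function.Exact φ (LinearMap.range φ).mkQ := LinearMap.exact_map_mkQ_range φ
  have h1 := exact_localizedModule_map S hex
  have h2 := LocalizedModule.map_surjective S _ (Submodule.mkQ_surjective (LinearMap.range φ))
  rw [← LinearMap.exact_iff.1 h1]
  exact (LinearMap.quotKerEquivOfSurjective _ h2).symm.length_eq

theorem det_localizedModule_map {E : Type*} [AddCommGroup E] [Module A E] {ι : Type*} [Fintype ι]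
    [DecidableEq ι] (b : Module.Basis ι A E) (φ : E →ₗ[A] E) :
    LinearMap.det (LocalizedModule.map S φ) =
      algebraMap A (Localization S) (LinearMap.det φ) := by
  set b' := b.ofIsLocalizedModule (Localization S) S (LocalizedModule.mkLinearMap S E)
  rw [← LinearMap.det_toMatrix b', ← LinearMap.det_toMatrix b, RingHom.map_det]
  congr 1
  ext i j
  rw [LinearMap.toMatrix_apply, RingHom.mapMatrix_apply, Matrix.map_apply,
    LinearMap.toMatrix_apply, Module.Basis.ofIsLocalizedModule_apply]
  rw [LocalizedModule.mkLinearMap_apply, LocalizedModule.map_mk,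
    ← LocalizedModule.mkLinearMap_apply, Module.Basis.ofIsLocalizedModule_repr_apply]

section Prime

variable [IsNoetherianRing A] {π : A}

theorem isPrime_span_of_prime (hπ : Prime π) : (Ideal.span {π}).IsPrime :=
  (Ideal.span_singleton_prime hπ.ne_zero).2 hπ

/-- The complement of the prime ideal `(π)`. -/
def primeCompl (hπ : Prime π) : Submonoid A :=
  haveI := isPrime_span_of_prime hπ
  (Ideal.span {π}).primeCompl

theorem mem_primeCompl (hπ : Prime π) {a : A} : a ∈ primeCompl hπ ↔ ¬ π ∣ a :=
  not_congr Ideal.mem_span_singleton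

instance isLocalRing_localization_primeCompl (hπ : Prime π) : IsLocalRing (Localization (primeCompl hπ)) :=
  haveI := isPrime_span_of_prime hπ
  inferInstanceAs (IsLocalRing (Localization.AtPrime (Ideal.span {π})))

theorem primeCompl_le (hπ : Prime π) : primeCompl hπ ≤ nonZeroDivisors A := fun _ ha =>
  mem_nonZeroDivisors_of_ne_zero fun h => (mem_primeCompl hπ).1 ha (h ▸ dvd_zero π)

instance isDomain_localization_primeCompl (hπ : Prime π) : IsDomain (Localization (primeCompl hπ)) :=
  IsLocalization.isDomain_localization (primeCompl_le hπ)

instance isNoetherianRing_localization_primeCompl (hπ : Prime π) :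
    IsNoetherianRing (Localization (primeCompl hπ)) :=
  IsLocalization.isNoetherianRing (primeCompl hπ) _ inferInstance

theorem maximalIdeal_localization_primeCompl (hπ : Prime π) :
    IsLocalRing.maximalIdeal (Localization (primeCompl hπ)) =
      Ideal.span {algebraMap A (Localization (primeCompl hπ)) π} := by
  have := isPrime_span_of_prime hπ
  have h : (Ideal.span {π}).map (algebraMap A (Localization.AtPrime (Ideal.span {π}))) =
    IsLocalRing.maximalIdeal _ := Localization.AtPrime.map_eq_maximalIdeal
  rw [Ideal.map_span, Set.image_singleton] at h
  exact h.symm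

instance isPrincipalIdealRing_localization_primeCompl (hπ : Prime π) :
    IsPrincipalIdealRing (Localization (primeCompl hπ)) := by
  have h := (tfae_of_isNoetherianRing_of_isLocalRing_of_isDomain
    (Localization (primeCompl hπ))).out 0 4
  exact h.2 ⟨⟨_, maximalIdeal_localization_primeCompl hπ⟩⟩

theorem irreducible_algebraMap_primeCompl (hπ : Prime π) :
    Irreducible (algebraMap A (Localization (primeCompl hπ)) π) := by
  have hmax := IsLocalRing.maximalIdeal.isMaximal (Localization (primeCompl hπ))
  rw [maximalIdeal_localization_primeCompl] at hmax
  refine ((Ideal.span_singleton_prime fun h => hπ.ne_zero ?_).1 hmax.isPrime).irreducible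
  exact (IsLocalization.injective _ (primeCompl_le hπ)) (h.trans (map_zero _).symm)

/-- Write x = π^m c with π ∤ c: locally `c` is a unit and π has order one. -/
theorem ord_algebraMap_primeCompl (hπ : Prime π) {x : A} (hx : x ≠ 0) :
    Ring.ord (Localization (primeCompl hπ)) (algebraMap A _ x) = emultiplicity π x := by
  have hfin : FiniteMultiplicity π x :=
    FiniteMultiplicity.of_prime_left hπ hx
  obtain ⟨c, hc, hc'⟩ := hfin.exists_eq_pow_mul_and_not_dvd
  have hu : IsUnit (algebraMap A (Localization (primeCompl hπ)) c) :=
    IsLocalization.map_units _ (⟨c, (mem_primeCompl hπ).2 hc'⟩ : primeCompl hπ)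
  have hirr := irreducible_algebraMap_primeCompl hπ
  rw [hfin.emultiplicity_eq_multiplicity]
  conv_lhs => rw [hc]
  rw [map_mul, map_pow, Ring.ord_mul_of_isUnit_right hu,
    Ring.ord_pow (mem_nonZeroDivisors_of_ne_zero hirr.ne_zero), Ring.ord_of_irreducible hirr]
  simp

/-- The local length of the cokernel of an endomorphism is the multiplicity of its determinant. -/
theorem lenLoc_quotient_range (hπ : Prime π) {E : Type*} [AddCommGroup E] [Module A E] {ι : Type*} [Fintype ι]
    [DecidableEq ι] (b : Module.Basis ι A E) (φ : E →ₗ[A] E) (h : LinearMap.det φ ≠ 0) :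
    lenLoc (primeCompl hπ) (E ⧸ LinearMap.range φ) = emultiplicity π (LinearMap.det φ) := by
  rw [lenLoc_quotient_range_eq_length, length_quotient_range
    (b.ofIsLocalizedModule (Localization (primeCompl hπ)) (primeCompl hπ)
      (LocalizedModule.mkLinearMap _ E)), det_localizedModule_map _ b,
    ord_algebraMap_primeCompl hπ h]
  rw [det_localizedModule_map _ b]
  exact fun h0 => h ((IsLocalization.injective _ (primeCompl_le hπ)) (h0.trans (map_zero _).symm))

end Prime

end Determinant

end MultiRes

end

noncomputable section

namespace MultiRes

/-! ### Lengths along a complex with chosen bases -/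

section Blocks

variable {A : Type*} [CommRing A]

/-- The coordinates with respect to a basis that is divided into two parts. -/
def splitCoord {E ι κ : Type*} [AddCommGroup E] [Module A E] [Finite ι] [Finite κ]
    (β : Module.Basis (ι ⊕ κ) A E) : E ≃ₗ[A] (ι → A) × (κ → A) :=
  β.equivFun.trans (LinearEquiv.sumArrowLequivProdArrow ι κ A A)

/-- The composition of the inclusion of the second part, a linear map, and the projection to the
first part. -/
def blockMap {E E' ι κ ι' κ' : Type*} [AddCommGroup E] [Module A E] [AddCommGroup E'] [Module A E']
    [Finite ι] [Finite κ] [Finite ι'] [Finite κ'] (β' : Module.Basis (ι' ⊕ κ') A E')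
    (β : Module.Basis (ι ⊕ κ) A E) (f : E' →ₗ[A] E) : (κ' → A) →ₗ[A] (ι → A) :=
  LinearMap.fst A _ _ ∘ₗ (splitCoord β).toLinearMap ∘ₗ f ∘ₗ (splitCoord β').symm.toLinearMap ∘ₗ
    LinearMap.inr A _ _

theorem blockMap_apply {E E' ι κ ι' κ' : Type*} [AddCommGroup E] [Module A E] [AddCommGroup E']
    [Module A E'] [Finite ι] [Finite κ] [Finite ι'] [Finite κ'] (β' : Module.Basis (ι' ⊕ κ') A E')
    (β : Module.Basis (ι ⊕ κ) A E) (f : E' →ₗ[A] E) (y : κ' → A) :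
    blockMap β' β f y = (splitCoord β (f ((splitCoord β').symm (0, y)))).1 := rfl

theorem splitCoord_symm_single {E ι κ : Type*} [AddCommGroup E] [Module A E] [Fintype ι]
    [Fintype κ] [DecidableEq κ] (β : Module.Basis (ι ⊕ κ) A E) (j : κ) :
    (splitCoord β).symm (0, Pi.single j 1) = β (Sum.inr j) := by
  classical
  rw [LinearEquiv.symm_apply_eq]
  refine Prod.ext (funext fun i => ?_) (funext fun i => ?_)
  · simp [splitCoord]
  · simp [splitCoord, Pi.single_apply, Finsupp.single_apply, eq_comm]

theorem splitCoord_symm_inr {E ι κ : Type*} [AddCommGroup E] [Module A E] [Fintype ι]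
    [Fintype κ] (β : Module.Basis (ι ⊕ κ) A E) (y : κ → A) :
    (splitCoord β).symm (0, y) = ∑ j, y j • β (Sum.inr j) := by
  classical
  have h : ((0 : ι → A), y) = ∑ j, y j • ((0 : ι → A), Pi.single j (1 : A)) := by
    refine Prod.ext ?_ ?_
    · rw [Prod.fst_sum]
      simp
    · rw [Prod.snd_sum]
      simpa using (Pi.basisFun A κ).sum_equivFun y |>.symm
  rw [h, map_sum]
  simp only [map_smul, splitCoord_symm_single]

theorem blockMap_eq_toLin' {E E' ι κ ι' κ' : Type*} [AddCommGroup E] [Module A E] [AddCommGroup E']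
    [Module A E'] [Fintype ι] [Fintype κ] [Fintype ι'] [Fintype κ'] [DecidableEq ι']
    [DecidableEq κ'] (β' : Module.Basis (ι' ⊕ κ') A E')
    (β : Module.Basis (ι ⊕ κ) A E) (f : E' →ₗ[A] E) :
    blockMap β' β f = Matrix.toLin' (LinearMap.toMatrix β' β f).toBlocks₁₂ := by
  refine LinearMap.pi_ext' fun j => LinearMap.ext_ring (funext fun i => ?_)
  rw [LinearMap.comp_apply, LinearMap.comp_apply, LinearMap.coe_single, blockMap_apply,
    splitCoord_symm_single, Matrix.toLin'_apply, Matrix.mulVec_single_one]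
  simp [Matrix.toBlocks₁₂, LinearMap.toMatrix_apply, splitCoord]

end Blocks

section Cayley

variable {A : Type*} [CommRing A] [IsDomain A] {C : ℕ → Type*} [∀ i, AddCommGroup (C i)]
  [∀ i, Module A (C i)] {D : ∀ i, C (i + 1) →ₗ[A] C i} {s : ℕ} (b : CayleyData A C D s)

namespace CayleyData

/-- The determinant of the `i`-th chosen minor. -/
def minor (i : ℕ) : A := (LinearMap.toMatrix (b.basis (i + 1)) (b.basis i) (D i)).toBlocks₁₂.det

/-- The `i`-th chosen minor as a linear map. -/
def minorMap (i : ℕ) : (Fin (b.rk (i + 1)) → A) →ₗ[A] (Fin (b.rk (i + 1)) → A) :=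
  blockMap (b.basis (i + 1)) (b.basis i) (D i)

theorem minor_ne_zero (i : ℕ) : b.minor i ≠ 0 := b.det_ne_zero i

theorem det_minorMap (i : ℕ) : LinearMap.det (b.minorMap i) = b.minor i := by
  rw [minorMap, blockMap_eq_toLin', LinearMap.det_toLin', minor]

theorem minorMap_injective (i : ℕ) : Function.Injective (b.minorMap i) := by
  rw [← LinearMap.ker_eq_bot]
  by_contra h
  exact b.minor_ne_zero i ((b.det_minorMap i).symm.trans (LinearMap.det_eq_zero_iff_ker_ne_bot.2 h))

/-- The differential followed by the projection to the first part. -/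
def projD (i : ℕ) : C (i + 1) →ₗ[A] (Fin (b.rk (i + 1)) → A) :=
  LinearMap.fst A _ _ ∘ₗ (splitCoord (b.basis i)).toLinearMap ∘ₗ D i

theorem projD_apply (i : ℕ) (x : C (i + 1)) :
    b.projD i x = (splitCoord (b.basis i) (D i x)).1 := rfl

theorem projD_inr (i : ℕ) (y : Fin (b.rk (i + 1)) → A) :
    b.projD i ((splitCoord (b.basis (i + 1))).symm (0, y)) = b.minorMap i y := rfl

variable {b} in
-- A boundary with vanishing b'-part lies in the span of b''. The next differential kills it, and
-- the next minor is injective on that span, so it is zero; at i = 0 the part b'' is empty. Thus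
-- projecting `D i` to b' does not enlarge its kernel.
theorem D_eq_zero (hC : ∀ i, Function.Exact (D (i + 1)) (D i)) {i : ℕ} {x : C (i + 1)}
    (h : b.projD i x = 0) : D i x = 0 := by
  have h1 : D i x = (splitCoord (b.basis i)).symm (0, (splitCoord (b.basis i) (D i x)).2) := by
    rw [LinearEquiv.eq_symm_apply]
    exact Prod.ext h rfl
  rw [h1]
  have h2 : (splitCoord (b.basis i) (D i x)).2 = 0 := by
    cases i with
    | zero =>
      funext j
      exact (Fin.cast b.rk_zero j).elim0
    | succ i =>
      refine b.minorMap_injective i ?_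
      rw [← projD_inr, ← h1, projD_apply, (hC i).apply_apply_eq_zero, map_zero, map_zero]
      rfl
  rw [h2, Prod.mk_zero_zero, map_zero]

/-- The cokernel of the projected differential. -/
abbrev Coker (i : ℕ) : Type _ := (Fin (b.rk (i + 1)) → A) ⧸ LinearMap.range (b.projD i)

theorem range_minorMap_le (i : ℕ) : LinearMap.range (b.minorMap i) ≤ LinearMap.range (b.projD i) := by
  rintro _ ⟨y, rfl⟩
  exact ⟨_, b.projD_inr i y⟩

theorem splitCoord_symm_eq_add (i : ℕ) (y) :
    (splitCoord (b.basis i)).symm y = (splitCoord (b.basis i)).symm (y.1, 0) +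
      (splitCoord (b.basis i)).symm (0, y.2) := by
  rw [← map_add]
  simp

/-- Membership in the range of the minor means that `z` can be completed by some b''-part to a cycle
of `D i`. By exactness the cycles are the boundaries of `D (i + 1)`. -/
theorem exists_projD_eq (hC : ∀ i, Function.Exact (D (i + 1)) (D i)) (i : ℕ)
    (z : Fin (b.rk (i + 1 + 1)) → A) :
    b.projD i ((splitCoord (b.basis (i + 1))).symm (z, 0)) ∈ LinearMap.range (b.minorMap i) ↔
      z ∈ LinearMap.range (b.projD (i + 1)) := by
  constructor
  · rintro ⟨y, hy⟩
    rw [← projD_inr, ← sub_eq_zero, ← map_sub] at hy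
    obtain ⟨x, hx⟩ := (hC i _).1 (D_eq_zero hC hy)
    refine ⟨-x, ?_⟩
    rw [map_neg, projD_apply, hx]
    simp
  · rintro ⟨x, rfl⟩
    set w := splitCoord (b.basis (i + 1)) (D (i + 1) x) with hw
    have h1 : D (i + 1) x = (splitCoord (b.basis (i + 1))).symm w := by simp [hw]
    have h2 : b.projD i (D (i + 1) x) = 0 := by
      rw [projD_apply, (hC i).apply_apply_eq_zero, map_zero]
      rfl
    rw [h1, splitCoord_symm_eq_add, map_add, projD_inr] at h2
    refine ⟨-w.2, ?_⟩
    rw [map_neg, eq_comm]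
    exact eq_neg_of_add_eq_zero_left h2

/-- With φ the i-th minor there is an exact sequence 0 → `Coker (i + 1)` → coker φ → `Coker i` → 0.
Its first map is induced by `D i` on the b'-part of C_{i+1}, and is well defined and injective by
`exists_projD_eq`. The middle term has local length equal to the multiplicity of π in det φ. -/
theorem lenLoc_coker_add [IsNoetherianRing A] (hC : ∀ i, Function.Exact (D (i + 1)) (D i)) {π : A}
    (hπ : Prime π) (i : ℕ) :
    lenLoc (primeCompl hπ) (b.Coker (i + 1)) + lenLoc (primeCompl hπ) (b.Coker i) =
      emultiplicity π (b.minor i) := by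
  have hdet : LinearMap.det (b.minorMap i) ≠ 0 := by
    rw [det_minorMap]
    exact b.minor_ne_zero i
  rw [← det_minorMap, ← lenLoc_quotient_range hπ (Pi.basisFun A _) _ hdet]
  set l : (Fin (b.rk (i + 1 + 1)) → A) →ₗ[A] (Fin (b.rk (i + 1)) → A) :=
    b.projD i ∘ₗ (splitCoord (b.basis (i + 1))).symm.toLinearMap ∘ₗ LinearMap.inl A _ _
  have hl : ∀ z, l z ∈ LinearMap.range (b.minorMap i) ↔ z ∈ LinearMap.range (b.projD (i + 1)) :=
    b.exists_projD_eq hC i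
  symm
  refine lenLoc_eq_add_of_exact _
    (g := Submodule.mapQ _ _ l fun z hz => (hl z).2 hz)
    (h := Submodule.factor (b.range_minorMap_le i)) ?_ (Submodule.factor_surjective _) ?_
  · rw [← LinearMap.ker_eq_bot, LinearMap.ker_eq_bot']
    intro z hz
    obtain ⟨z, rfl⟩ := Submodule.Quotient.mk_surjective _ z
    rw [Submodule.mapQ_apply, Submodule.Quotient.mk_eq_zero] at hz
    rw [Submodule.Quotient.mk_eq_zero]
    exact (hl z).1 hz
  · intro y
    obtain ⟨y, rfl⟩ := Submodule.Quotient.mk_surjective _ y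
    constructor
    · intro hy
      obtain ⟨x, rfl⟩ := (Submodule.Quotient.mk_eq_zero _).1 hy
      set w := splitCoord (b.basis (i + 1)) x with hw
      have h1 : x = (splitCoord (b.basis (i + 1))).symm w := by simp [hw]
      refine ⟨Submodule.Quotient.mk w.1, ?_⟩
      rw [Submodule.mapQ_apply, Submodule.Quotient.eq]
      refine ⟨-w.2, ?_⟩
      rw [h1, splitCoord_symm_eq_add, map_add, projD_inr, map_neg]
      change _ = l w.1 - (l w.1 + _)
      rw [sub_add_cancel_left]
    · rintro ⟨z, hz⟩
      obtain ⟨z, rfl⟩ := Submodule.Quotient.mk_surjective _ z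
      rw [← hz, Submodule.mapQ_apply]
      exact (Submodule.Quotient.mk_eq_zero _).2 ⟨_, rfl⟩

theorem subsingleton_coker {i : ℕ} (hi : s ≤ i) : Subsingleton (b.Coker i) := by
  have h : b.rk (i + 1) = 0 := b.rk_of_lt _ (Nat.lt_succ_of_le hi)
  have : Subsingleton (Fin (b.rk (i + 1)) → A) := by
    rw [h]
    infer_instance
  infer_instance

/-- The zeroth cokernel is the zeroth homology. -/
def cokerZeroEquiv : (C 0 ⧸ LinearMap.range (D 0)) ≃ₗ[A] b.Coker 0 := by
  have h0 : ∀ y : Fin (b.rk 0) → A, y = 0 := fun y => funext fun j => (Fin.cast b.rk_zero j).elim0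
  let p : C 0 →ₗ[A] (Fin (b.rk (0 + 1)) → A) :=
    LinearMap.fst A _ _ ∘ₗ (splitCoord (b.basis 0)).toLinearMap
  have hp : Function.Bijective p := by
    constructor
    · intro x y hxy
      exact (splitCoord (b.basis 0)).injective (Prod.ext hxy ((h0 _).trans (h0 _).symm))
    · intro z
      exact ⟨(splitCoord (b.basis 0)).symm (z, 0), by simp [p]⟩
  refine Submodule.Quotient.equiv _ _ (LinearEquiv.ofBijective p hp) ?_
  rw [← LinearMap.range_comp]
  rfl

theorem lenLoc_coker_zero (S : Submonoid A) :
    lenLoc S (C 0 ⧸ LinearMap.range (D 0)) = lenLoc S (b.Coker 0) :=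
  lenLoc_congr S b.cokerZeroEquiv

/-- The preceding relations telescope in an alternating sum. Even and odd minors stand on opposite
sides to avoid subtraction in `ℕ∞`, and the parity of `m` decides on which side the last cokernel
remains. -/
theorem emultiplicity_minors [IsNoetherianRing A] (hC : ∀ i, Function.Exact (D (i + 1)) (D i))
    {π : A} (hπ : Prime π) (m : ℕ) :
    emultiplicity π (∏ i ∈ Finset.range m, if Even i then b.minor i else 1) +
        (if Even m then lenLoc (primeCompl hπ) (b.Coker m) else 0) =
      emultiplicity π (∏ i ∈ Finset.range m, if Even i then 1 else b.minor i) +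
        lenLoc (primeCompl hπ) (b.Coker 0) +
          (if Even m then 0 else lenLoc (primeCompl hπ) (b.Coker m)) := by
  induction m with
  | zero => simp [emultiplicity_of_one_right hπ.not_isUnit]
  | succ m ih =>
    rw [Finset.prod_range_succ, Finset.prod_range_succ, emultiplicity_mul hπ, emultiplicity_mul hπ]
    by_cases hm : Even m
    · have hm' : ¬ Even (m + 1) := fun h => Nat.even_add_one.1 h hm
      simp only [hm, hm', if_true, if_false, add_zero] at ih ⊢
      rw [emultiplicity_of_one_right hπ.not_isUnit, ← b.lenLoc_coker_add hC hπ, add_zero, ← ih]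
      ring
    · have hm' : Even (m + 1) := Nat.even_add_one.2 hm
      simp only [hm, hm', if_true, if_false, add_zero] at ih ⊢
      rw [emultiplicity_of_one_right hπ.not_isUnit, ← b.lenLoc_coker_add hC hπ, add_zero, ih]
      ring

theorem emultiplicity_prod_minor [IsNoetherianRing A]
    (hC : ∀ i, Function.Exact (D (i + 1)) (D i)) {π : A} (hπ : Prime π) :
    emultiplicity π (∏ i ∈ Finset.range s, if Even i then b.minor i else 1) =
      emultiplicity π (∏ i ∈ Finset.range s, if Even i then 1 else b.minor i) +
        lenLoc (primeCompl hπ) (C 0 ⧸ LinearMap.range (D 0)) := by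
  have h := b.emultiplicity_minors hC hπ s
  have := b.subsingleton_coker le_rfl
  rw [lenLoc_eq_zero_of_subsingleton (primeCompl hπ) (N := b.Coker s)] at h
  rw [lenLoc_coker_zero b]
  simpa using h

theorem prod_minor_ne_zero :
    (∏ i ∈ Finset.range s, if Even i then b.minor i else 1) ≠ 0 :=
  Finset.prod_ne_zero_iff.2 fun i _ => by
    split_ifs
    · exact b.minor_ne_zero i
    · exact one_ne_zero

theorem prod_minor_ne_zero' :
    (∏ i ∈ Finset.range s, if Even i then 1 else b.minor i) ≠ 0 :=
  Finset.prod_ne_zero_iff.2 fun i _ => by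
    split_ifs
    · exact one_ne_zero
    · exact b.minor_ne_zero i

theorem lenLoc_ne_top [IsNoetherianRing A] (b : CayleyData A C D s)
    (hC : ∀ i, Function.Exact (D (i + 1)) (D i)) {π : A}
    (hπ : Prime π) : lenLoc (primeCompl hπ) (C 0 ⧸ LinearMap.range (D 0)) ≠ ⊤ := by
  intro h
  have h1 := b.emultiplicity_prod_minor hC hπ
  rw [h, add_top] at h1
  exact (finiteMultiplicity_iff_emultiplicity_ne_top.1
    (FiniteMultiplicity.of_prime_left hπ b.prod_minor_ne_zero)) h1

theorem det_mul (m : ℕ) :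
    (∏ i ∈ Finset.range m, (algebraMap A (FractionRing A) (b.minor i)) ^ ((-1 : ℤ) ^ i)) *
      algebraMap A (FractionRing A) (∏ i ∈ Finset.range m, if Even i then 1 else b.minor i) =
      algebraMap A (FractionRing A) (∏ i ∈ Finset.range m, if Even i then b.minor i else 1) := by
  rw [map_prod, map_prod, ← Finset.prod_mul_distrib]
  refine Finset.prod_congr rfl fun i _ => ?_
  have h : algebraMap A (FractionRing A) (b.minor i) ≠ 0 :=
    (map_ne_zero_iff _ (IsFractionRing.injective A (FractionRing A))).2 (b.minor_ne_zero i)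
  by_cases hi : Even i
  · simp [hi]
  · rw [(Nat.not_even_iff_odd.1 hi).neg_one_pow, if_neg hi, if_neg hi, zpow_neg_one,
      inv_mul_cancel₀ h, map_one]

/-- The Cayley determinant is, up to a unit, any element with the same multiplicities as the zeroth
homology. -/
theorem exists_det_eq [IsNoetherianRing A] [UniqueFactorizationMonoid A]
    (hC : ∀ i, Function.Exact (D (i + 1)) (D i)) {x : A} (hx : x ≠ 0)
    (h : ∀ π : A, ∀ hπ : Prime π,
      emultiplicity π x = lenLoc (primeCompl hπ) (C 0 ⧸ LinearMap.range (D 0))) :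
    ∃ c : Aˣ, b.det = algebraMap A (FractionRing A) (c * x) := by
  -- The odd minors, which are inverted in the Cayley determinant, are moved to the side of `x`. In
  -- a factorial ring, equal multiplicities at all primes give associated elements.
  have hass : Associated ((∏ i ∈ Finset.range s, if Even i then 1 else b.minor i) * x)
      (∏ i ∈ Finset.range s, if Even i then b.minor i else 1) := by
    have key : ∀ π : A, Prime π →
        emultiplicity π ((∏ i ∈ Finset.range s, if Even i then 1 else b.minor i) * x) =
          emultiplicity π (∏ i ∈ Finset.range s, if Even i then b.minor i else 1) := by
      intro π hπ
      rw [emultiplicity_mul hπ, h π hπ, b.emultiplicity_prod_minor hC hπ]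
    exact associated_of_dvd_dvd
      ((UniqueFactorizationMonoid.dvd_iff_emultiplicity_le
        (mul_ne_zero b.prod_minor_ne_zero' hx)).2 fun π hπ => (key π hπ).le)
      ((UniqueFactorizationMonoid.dvd_iff_emultiplicity_le b.prod_minor_ne_zero).2
        fun π hπ => (key π hπ).ge)
  obtain ⟨c, hc⟩ := hass
  refine ⟨c, ?_⟩
  have h1 : algebraMap A (FractionRing A)
      (∏ i ∈ Finset.range s, if Even i then 1 else b.minor i) ≠ 0 :=
    (map_ne_zero_iff _ (IsFractionRing.injective A (FractionRing A))).2 b.prod_minor_ne_zero'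
  refine mul_right_cancel₀ h1 ((b.det_mul s).trans ?_)
  rw [← map_mul, ← hc]
  congr 1
  ring

end CayleyData

/-! ### Existence of suitable bases and minors -/

/-- Take a maximal independent set of columns. By maximality every other column has a nonzero
multiple in its span, so the range modulo this span is torsion and has rank 0. -/
theorem exists_finset_card_eq_finrank_range {E N ι : Type*} [AddCommGroup E] [Module A E]
    [AddCommGroup N] [Module A N] [Fintype ι] (β : Module.Basis ι A E) (f : E →ₗ[A] N) :
    ∃ t : Finset ι, t.card = Module.finrank A (LinearMap.range f) ∧
      LinearIndependent A fun i : t => f (β i) := by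
  classical
  obtain ⟨t, ht, hmax⟩ := exists_maximal_linearIndepOn A fun i => f (β i)
  have := Module.Finite.of_basis β
  refine ⟨t.toFinset, ?_, ?_⟩
  · set V := LinearMap.range f
    have hV : ∀ i, f (β i) ∈ V := fun i => ⟨_, rfl⟩
    let v : ι → V := fun i => ⟨f (β i), hV i⟩
    have hv : LinearIndependent A fun i : t => v i :=
      LinearIndependent.of_comp V.subtype ht
    set W := Submodule.span A (Set.range fun i : t => v i)
    have h1 : Module.finrank A W = t.toFinset.card := by
      rw [finrank_span_eq_card hv, Set.toFinset_card]
    have h2 : Module.finrank A (V ⧸ W) = 0 := by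
      rw [Module.finrank_eq_zero_iff_isTorsion]
      have hspan : ∀ i, ∃ a : A, a ≠ 0 ∧ a • v i ∈ W := by
        intro i
        have himg : ∀ w ∈ Submodule.span A ((fun i => f (β i)) '' t), ∀ hw : w ∈ V,
            (⟨w, hw⟩ : V) ∈ W := by
          intro w hw hwV
          have h3 : W.map V.subtype = Submodule.span A ((fun i => f (β i)) '' t) := by
            rw [Submodule.map_span, ← Set.range_comp, Set.image_eq_range]
            rfl
          rw [← h3] at hw
          obtain ⟨w', hw', rfl⟩ := hw
          exact hw'
        by_cases hi : i ∈ t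
        · exact ⟨1, one_ne_zero, by
            rw [one_smul]
            exact Submodule.subset_span ⟨⟨i, hi⟩, rfl⟩⟩
        · obtain ⟨a, ha, h3⟩ := hmax i hi
          exact ⟨a, ha, himg _ h3 _⟩
      choose a ha hav using hspan
      intro x
      obtain ⟨x, rfl⟩ := Submodule.Quotient.mk_surjective _ x
      refine ⟨⟨∏ i, a i, mem_nonZeroDivisors_of_ne_zero (Finset.prod_ne_zero_iff.2 fun i _ => ha i)⟩, ?_⟩
      change Submodule.Quotient.mk ((∏ i, a i) • x) = _
      rw [Submodule.Quotient.mk_eq_zero]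
      obtain ⟨_, y, rfl⟩ := x
      have h4 : (⟨f y, ⟨y, rfl⟩⟩ : V) = ∑ i, β.repr y i • v i := by
        apply Subtype.ext
        rw [Submodule.coe_sum]
        change f y = ∑ i, β.repr y i • f (β i)
        conv_lhs => rw [← β.sum_repr y]
        rw [map_sum]
        simp only [map_smul]
      rw [h4, Finset.smul_sum]
      refine Submodule.sum_mem _ fun i _ => ?_
      rw [← Finset.mul_prod_erase _ _ (Finset.mem_univ i), smul_comm, mul_comm, mul_smul]
      exact Submodule.smul_mem _ _ (Submodule.smul_mem _ _ (hav i))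
    have h3 := Submodule.finrank_quotient_add_finrank W
    omega
  · have h := ht.comp (fun i : t.toFinset => (⟨i.1, Set.mem_toFinset.1 i.2⟩ : t))
      (fun i j h => Subtype.ext (congrArg (fun z : t => z.1) h))
    exact h

theorem finrank_range_add_finrank_ker_of_isDomain {E N : Type*} [AddCommGroup E] [Module A E]
    [Module.Finite A E] [AddCommGroup N] [Module A N] (f : E →ₗ[A] N) :
    Module.finrank A (LinearMap.range f) + Module.finrank A (LinearMap.ker f) =
      Module.finrank A E := by
  rw [← f.quotKerEquivRange.finrank_eq]
  exact Submodule.finrank_quotient_add_finrank _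

/-- Bases and minors as needed for the Cayley determinant exist. -/
theorem nonempty_cayleyData (hfree : ∀ i, Module.Free A (C i)) (hfin : ∀ i, Module.Finite A (C i))
    (hC : ∀ i, Function.Exact (D (i + 1)) (D i)) (hs : ∀ i, s < i → Subsingleton (C i))
    (h0 : Module.finrank A (C 0 ⧸ LinearMap.range (D 0)) = 0) : Nonempty (CayleyData A C D s) := by
  classical
  let β : ∀ i, Module.Basis (Fin (Module.finrank A (C i))) A (C i) := fun i => Module.finBasis A (C i)
  choose t ht hli using fun i => exists_finset_card_eq_finrank_range (β (i + 1)) (D i)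
  let rk : ℕ → ℕ := fun
    | 0 => 0
    | j + 1 => (t j).card
  have hrk0 : rk 0 = 0 := rfl
  let T : ∀ i, Finset (Fin (Module.finrank A (C i))) := fun i =>
    Nat.casesOn (motive := fun i => Finset (Fin (Module.finrank A (C i)))) i ∅ t
  have hT : ∀ i, (T i).card = rk i := fun i => by cases i <;> rfl
  -- By exactness the rank of C_{i+1} is the sum of the ranks of `D i` and `D (i + 1)`; for C_0 one
  -- uses instead that the cokernel of `D 0` has rank 0.
  have hT' : ∀ i, (T i)ᶜ.card = rk (i + 1) := by
    intro i
    rw [Finset.card_compl, Fintype.card_fin, hT]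
    cases i with
    | zero =>
      have h1 := Submodule.finrank_quotient_add_finrank (LinearMap.range (D 0))
      have h2 := ht 0
      change _ - 0 = (t 0).card
      omega
    | succ i =>
      have h1 := finrank_range_add_finrank_ker_of_isDomain (D i)
      have h2 := ht i
      have h3 := ht (i + 1)
      rw [← LinearMap.exact_iff.1 (hC i)] at h3
      change _ - (t i).card = (t (i + 1)).card
      omega
  clear_value rk
  let e : ∀ i, Fin (rk (i + 1)) ⊕ Fin (rk i) ≃ Fin (Module.finrank A (C i)) := fun i =>
    (Equiv.sumCongr (Finset.equivFinOfCardEq (hT' i)).symm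
      (Finset.equivFinOfCardEq (hT i)).symm).trans
        ((Equiv.sumComm _ _).trans ((Equiv.sumCongr (Equiv.refl _)
          (Equiv.subtypeEquivRight fun x => Finset.mem_compl)).trans
            (Equiv.sumCompl fun x => x ∈ T i)))
  have he : ∀ i j, e i (Sum.inr j) = ((Finset.equivFinOfCardEq (hT i)).symm j).1 := fun i j => rfl
  let γ : ∀ i, Module.Basis (Fin (rk (i + 1)) ⊕ Fin (rk i)) A (C i) := fun i =>
    (β i).reindex (e i).symm
  have hγ : ∀ i, LinearIndependent A fun j : Fin (rk (i + 1)) => D i (γ (i + 1) (Sum.inr j)) := by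
    intro i
    have h1 := (hli i).comp _ (Finset.equivFinOfCardEq (hT (i + 1))).symm.injective
    have h2 : (fun j : Fin (rk (i + 1)) => D i (γ (i + 1) (Sum.inr j))) =
        (fun j : t i => D i (β (i + 1) j)) ∘ (Finset.equivFinOfCardEq (hT (i + 1))).symm := by
      funext j
      simp only [γ, Module.Basis.reindex_apply, Equiv.symm_symm, he]
      rfl
    rw [h2]
    exact h1
  have hD : ∀ i y, D i ((splitCoord (γ (i + 1))).symm (0, y)) = 0 → y = 0 := by
    intro i y hy
    rw [splitCoord_symm_inr, map_sum] at hy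
    simp only [map_smul] at hy
    exact funext (Fintype.linearIndependent_iff.1 (hγ i) y hy)
  refine ⟨⟨rk, hrk0, fun i hi => ?_, γ, fun i hdet => ?_⟩⟩
  · have := hs i hi
    have h1 := (T i).card_le_univ
    rw [hT, Fintype.card_fin, Module.finrank_zero_of_subsingleton] at h1
    exact Nat.le_zero.1 h1
  -- A kernel vector y of the block maps under `D i` into the span of b''_i. The next differential
  -- kills this image and is injective on that span, so `D i` kills y, contradicting the
  -- independence of the chosen columns.
  · obtain ⟨y, hy0, hy⟩ := Matrix.exists_mulVec_eq_zero_iff.2 hdet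
    rw [← Matrix.toLin'_apply] at hy
    have hy := (congrArg (fun g => g y) (blockMap_eq_toLin' (γ (i + 1)) (γ i) (D i))).trans hy
    rw [blockMap_apply] at hy
    set w := splitCoord (γ i) (D i ((splitCoord (γ (i + 1))).symm (0, y))) with hw
    have h1 : D i ((splitCoord (γ (i + 1))).symm (0, y)) = (splitCoord (γ i)).symm (0, w.2) := by
      rw [LinearEquiv.eq_symm_apply, ← hw]
      exact Prod.ext hy rfl
    refine hy0 (hD i y ?_)
    rw [h1]
    have h2 : w.2 = 0 := by
      cases i with
      | zero => exact funext fun j => (Fin.cast hrk0 j).elim0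
      | succ i =>
        refine hD i _ ?_
        rw [← h1, (hC i).apply_apply_eq_zero]
    rw [h2, Prod.mk_zero_zero, map_zero]

end Cayley

/-! ### Contents -/

section Content

variable {A : Type*} [CommRing A] [IsDomain A] [IsNoetherianRing A]
  [UniqueFactorizationMonoid A] (irr : IrrSystem A)

theorem localLength_eq (N : Type*) [AddCommGroup N] [Module A N] {π : A} (h : Irreducible π) :
    localLength N h = (lenLoc (primeCompl h.prime) N).toNat := rfl

variable {irr} in
theorem IrrSystem.eq_of_associated {π π' x : A} (h : π ∈ irr.carrier) (h' : π' ∈ irr.carrier)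
    (hx : Associated π x) (hx' : Associated π' x) : π = π' :=
  (irr.existsUnique_associated π (irr.irreducible π h)).unique ⟨h, Associated.refl π⟩
    ⟨h', hx'.trans hx.symm⟩

theorem finite_dvd_irrSystem {a : A} (ha : a ≠ 0) : {π : irr.carrier | π.1 ∣ a}.Finite := by
  classical
  have h : ∀ π : irr.carrier, ∃ x, π.1 ∣ a →
      x ∈ UniqueFactorizationMonoid.factors a ∧ Associated π.1 x := by
    intro π
    by_cases hπ : π.1 ∣ a
    · obtain ⟨x, hx, hx'⟩ :=
        UniqueFactorizationMonoid.exists_mem_factors_of_dvd ha (irr.irreducible π.1 π.2) hπ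
      exact ⟨x, fun _ => ⟨hx, hx'⟩⟩
    · exact ⟨0, fun h => absurd h hπ⟩
  choose f hf using h
  refine Set.Finite.of_injOn (f := f) (t := (UniqueFactorizationMonoid.factors a).toFinset)
    (fun π hπ => ?_) (fun π hπ π' hπ' hff => ?_) (Finset.finite_toSet _)
  · exact Multiset.mem_toFinset.2 (hf π hπ).1
  · refine Subtype.ext (irr.eq_of_associated π.2 π'.2 (hf π hπ).2 ?_)
    rw [hff]
    exact (hf π' hπ').2

variable {N : Type*} [AddCommGroup N] [Module A N]

theorem content_eq_prod {a : A} (ha : a ≠ 0) (haN : ∀ x : N, a • x = 0) :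
    content irr N = ∏ π ∈ (finite_dvd_irrSystem irr ha).toFinset,
      π.1 ^ localLength N (irr.irreducible π.1 π.2) := by
  refine finprod_eq_prod_of_mulSupport_subset _ fun π hπ => ?_
  rw [Set.Finite.coe_toFinset]
  by_contra h
  refine hπ ?_
  dsimp only
  rw [localLength_eq, lenLoc_eq_zero _ ((mem_primeCompl (irr.irreducible π.1 π.2).prime).2 h) haN]
  simp

theorem content_ne_zero {a : A} (ha : a ≠ 0) (haN : ∀ x : N, a • x = 0) : content irr N ≠ 0 := by
  rw [content_eq_prod irr ha haN]
  exact Finset.prod_ne_zero_iff.2 fun π _ => pow_ne_zero _ (irr.irreducible π.1 π.2).ne_zero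

theorem primeCompl_eq_of_associated {π π' : A} (hπ : Prime π) (hπ' : Prime π')
    (h : Associated π π') : primeCompl hπ = primeCompl hπ' := by
  ext a
  rw [mem_primeCompl, mem_primeCompl, h.dvd_iff_dvd_left]

/-- Only the factor of the representative of π contributes. Finite lengths are required because
`localLength` is defined through `toNat`, which sends `⊤` to 0. -/
theorem emultiplicity_content {a : A} (ha : a ≠ 0) (haN : ∀ x : N, a • x = 0)
    (hfin : ∀ π : A, ∀ hπ : Prime π, lenLoc (primeCompl hπ) N ≠ ⊤) {π : A} (hπ : Prime π) :
    emultiplicity π (content irr N) = lenLoc (primeCompl hπ) N := by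
  classical
  obtain ⟨p, ⟨hp, hpπ⟩, -⟩ := irr.existsUnique_associated π hπ.irreducible
  have hpp : Prime p := (irr.irreducible p hp).prime
  rw [emultiplicity_eq_of_associated_left hpπ, ← primeCompl_eq_of_associated hpp hπ hpπ,
    content_eq_prod irr ha haN, Finset.emultiplicity_prod hpp]
  have hself : ∀ k : ℕ, emultiplicity p (p ^ k) = k :=
    emultiplicity_pow_self hpp.ne_zero hpp.not_isUnit
  have hlen : (localLength N (irr.irreducible p hp) : ℕ∞) = lenLoc (primeCompl hpp) N :=
    ENat.natCast_toNat (hfin p hpp)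
  rw [Finset.sum_eq_single (⟨p, hp⟩ : irr.carrier)]
  · rw [hself, hlen]
  · intro x _ hx
    refine emultiplicity_eq_zero.2 fun h => hx ?_
    have h1 : Associated p x.1 :=
      hpp.irreducible.associated_of_dvd (irr.irreducible x.1 x.2) (hpp.dvd_of_dvd_pow h)
    exact Subtype.ext (irr.eq_of_associated x.2 hp (Associated.refl _) h1)
  · intro h
    -- If the representative is missing from the finite product, it does not divide `a`, and its
    -- local length is 0.
    have h1 : ¬ p ∣ a := fun h2 => h ((Set.Finite.mem_toFinset _).2 h2)
    rw [hself, hlen, lenLoc_eq_zero _ ((mem_primeCompl hpp).2 h1) haN]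

theorem content_congr {N' : Type*} [AddCommGroup N'] [Module A N']
    (h : ∀ π : irr.carrier, localLength N (irr.irreducible π.1 π.2) =
      localLength N' (irr.irreducible π.1 π.2)) : content irr N = content irr N' :=
  finprod_congr fun π => by rw [h π]

end Content

end MultiRes

end

noncomputable section

namespace MultiRes

open MvPolynomial

/-! ### The Koszul complex of the generic polynomials -/

section Translation

variable {k : Type*} [Field k] {q s : ℕ} {n : Fin q → ℕ} (d : Fin s → Fin q → ℕ)
  {I : Ideal (MvPolynomial (Vars n) k)}

/-- The class of a polynomial in `M[u]`. -/
abbrev genMk (I : Ideal (MvPolynomial (Vars n) k)) :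
    MvPolynomial (Vars n) (CoeffRing k n d) →ₗ[MvPolynomial (Vars n) (CoeffRing k n d)]
      GenModule d I :=
  (extendedIdeal d I).mkQ

theorem genMk_mem_smul_top (𝔞 : Ideal (MvPolynomial (Vars n) (CoeffRing k n d)))
    (y : MvPolynomial (Vars n) (CoeffRing k n d)) :
    genMk d I y ∈ (𝔞 • ⊤ : Submodule (MvPolynomial (Vars n) (CoeffRing k n d)) (GenModule d I)) ↔
      y ∈ extendedIdeal d I ⊔ 𝔞 := by
  have h : (𝔞 • ⊤ : Submodule (MvPolynomial (Vars n) (CoeffRing k n d)) (GenModule d I)) =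
      Submodule.map (genMk d I) 𝔞 := by
    rw [← Submodule.range_mkQ (extendedIdeal d I), LinearMap.range_eq_map, ← Submodule.map_smul'',
      smul_eq_mul, Ideal.mul_top]
  rw [h, ← Submodule.comap_map_mkQ, Submodule.mem_comap]

theorem genMk_mem_initialSubmodule (i : Fin s) (y : MvPolynomial (Vars n) (CoeffRing k n d)) :
    genMk d I y ∈ initialSubmodule (GenModule d I) (genericPoly k n d) i ↔ y ∈ stageIdeal d I i :=
  genMk_mem_smul_top d _ y

theorem genMk_mem_seqSubmodule (y : MvPolynomial (Vars n) (CoeffRing k n d)) :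
    genMk d I y ∈ seqSubmodule (GenModule d I) (genericPoly k n d) ↔ y ∈ stageIdeal d I s := by
  have h : Set.range (genericPoly k n d) = genericPoly k n d '' {j | j.1 < s} := by
    rw [← Set.image_univ]
    congr 1
    ext j
    simp
  rw [seqSubmodule, genMk_mem_smul_top, stageIdeal, h]

/-- The components of `𝓜(I)` as quotients of the components of the polynomial ring. -/
def compEquivElim (I : Ideal (MvPolynomial (Vars n) k)) (ν : Fin q → ℕ) :
    Comp (stageIdeal d I s) ν ≃ₗ[CoeffRing k n d] elimGrading d I ν :=
  compEquivOfKer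
    (((seqSubmodule (GenModule d I) (genericPoly k n d)).mkQ.restrictScalars (CoeffRing k n d)) ∘ₗ
      ((genMk d I).restrictScalars (CoeffRing k n d)) ∘ₗ (polyGrading (CoeffRing k n d) n ν).subtype)
    (fun y => by
      change Submodule.mkQ _ (genMk d I y.1) = 0 ↔ _
      rw [Submodule.mkQ_apply, Submodule.Quotient.mk_eq_zero, genMk_mem_seqSubmodule]) _ (by
      rw [LinearMap.range_comp, LinearMap.range_comp, Submodule.range_subtype]
      rfl)

/-- A homogeneous element of the ideal generated by `I` and the first `m` generic polynomials
becomes a combination of these polynomials with homogeneous coefficients. -/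
theorem exists_sum_of_mem_stageIdeal (hI : I.IsHomogeneous (polyGrading k n)) (m : ℕ)
    {ν : Fin q → ℕ} {y : MvPolynomial (Vars n) (CoeffRing k n d)}
    (hy : y ∈ polyGrading (CoeffRing k n d) n ν) (h : y ∈ stageIdeal d I m) :
    ∃ b : Fin s → GenModule d I, (∀ j, b j ∈ shiftedPiece (genGrading d I) (d j) ν) ∧
      genMk d I y = ∑ j : Fin s with j.1 < m, genericPoly k n d j • b j := by
  classical
  obtain ⟨e, he, z, hz, rfl⟩ := Submodule.mem_sup.1 h
  have hset : {j : Fin s | j.1 < m} = ((Finset.univ.filter fun j : Fin s => j.1 < m : Finset _) :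
      Set (Fin s)) := by simp
  rw [hset] at hz
  obtain ⟨c, rfl⟩ := (Submodule.mem_span_image_finset_iff_exists_fun' _).1 hz
  -- Homogeneous parts of the given coefficients; in multidegree ν a polynomial with `d j` not below
  -- ν can contribute nothing.
  refine ⟨fun j => if d j ≤ ν then
    genMk d I (weightedHomogeneousComponent (varDeg n) (ν - d j) (c j)) else 0, fun j => ?_, ?_⟩
  · unfold shiftedPiece
    dsimp only
    split_ifs with hj
    · exact ⟨_, wc_mem _ _, rfl⟩
    · exact zero_mem _
  · have h1 : genMk d I (weightedHomogeneousComponent (varDeg n) ν e) = 0 :=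
      (Submodule.Quotient.mk_eq_zero _).2 (wc_mem_ideal (isHomogeneous_extendedIdeal d hI) he ν)
    rw [← wc_of_mem hy, map_add, map_add, h1, zero_add, map_sum, map_sum]
    refine Finset.sum_congr rfl fun j _ => ?_
    rw [smul_eq_mul, mul_comm]
    dsimp only
    split_ifs with hj
    · rw [wc_mul_of_le (genericPoly_mem k n d j) hj, ← smul_eq_mul, map_smul]
    · rw [wc_mul_of_not_le (genericPoly_mem k n d j) hj, map_zero, smul_zero]

theorem mem_stageIdeal_of_sum (m : ℕ) {y : MvPolynomial (Vars n) (CoeffRing k n d)}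
    {b : Fin s → GenModule d I}
    (h : genMk d I y = ∑ j : Fin s with j.1 < m, genericPoly k n d j • b j) :
    y ∈ stageIdeal d I m := by
  refine (genMk_mem_smul_top d _ y).1 ?_
  rw [h]
  refine Submodule.sum_mem _ fun j hj => Submodule.smul_mem_smul (Ideal.subset_span ?_) trivial
  exact ⟨j, (Finset.mem_filter.1 hj).2, rfl⟩

theorem eventually_all_mem_stageIdeal (hI : I.IsHomogeneous (polyGrading k n)) :
    ∃ ν0 : Fin q → ℕ, ∀ i : Fin s, ∀ ν, ν0 ≤ ν → ∀ z ∈ polyGrading (CoeffRing k n d) n ν,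
      genericPoly k n d i * z ∈ stageIdeal d I i → z ∈ stageIdeal d I i := by
  obtain ⟨ν0, h⟩ := eventually_atTop.1
    (eventually_all.2 fun i : Fin s => eventually_mem_stageIdeal d hI i)
  exact ⟨ν0, fun i ν hν => h ν hν i⟩

theorem isFilterRegularSeq_genericPoly (hI : I.IsHomogeneous (polyGrading k n)) :
    IsFilterRegularSeq (CoeffRing k n d) (genGrading d I) (genericPoly k n d) := by
  intro i
  filter_upwards [eventually_mem_stageIdeal d hI i] with ν hν
  rintro _ ⟨_, ⟨y, hy, rfl⟩, rfl⟩ h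
  rw [LinearMap.coe_restrictScalars, LinearMap.coe_restrictScalars, ← map_smul, ← map_smul,
    smul_eq_mul, Submodule.mkQ_apply, Submodule.Quotient.mk_eq_zero,
    genMk_mem_initialSubmodule] at h
  rw [LinearMap.coe_restrictScalars, LinearMap.coe_restrictScalars, Submodule.mkQ_apply,
    Submodule.Quotient.mk_eq_zero, genMk_mem_initialSubmodule]
  exact hν y hy h

theorem eventually_exact_koszulSliceD (hI : I.IsHomogeneous (polyGrading k n)) :
    ∀ᶠ ν in atTop, ∀ p, Function.Exact
      (koszulSliceD (genGrading_smul d I) (genericPoly_mem k n d) ν (p + 1))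
      (koszulSliceD (genGrading_smul d I) (genericPoly_mem k n d) ν p) := by
  obtain ⟨ν0, h0⟩ := eventually_all_mem_stageIdeal d hI
  filter_upwards [eventually_ge_atTop (ν0 + ∑ j, d j)] with ν hν p
  refine exact_koszulSliceD (genGrading_smul d I) (genericPoly_mem k n d) (ν0 := ν0) ?_ hν p
  rintro i μ hμ _ ⟨y, hy, rfl⟩ ⟨b, hb⟩
  have hIio : Finset.Iio i = Finset.univ.filter fun j : Fin s => j.1 < i.1 := by
    ext j
    rw [Finset.mem_Iio, Finset.mem_filter]
    exact (and_iff_right (Finset.mem_univ j)).symm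
  rw [hIio] at hb ⊢
  exact exists_sum_of_mem_stageIdeal d hI i hy (h0 i μ hμ y hy (mem_stageIdeal_of_sum d i hb))

theorem koszulD_zero_apply {R M : Type*} [CommRing R] [AddCommGroup M] [Module R M]
    (f : Fin s → R) (c : KIdx s 1 → M) (S : KIdx s 0) :
    koszulD M f 0 c S = ∑ j : Fin s, f j • c ⟨{j}, Finset.card_singleton j⟩ := by
  classical
  have hS : S.1 = ∅ := Finset.card_eq_zero.1 S.2
  have h := koszulD_eq_koszulTot f 0
    (fun T : Finset (Fin s) => if hT : T.card = 1 then c ⟨T, hT⟩ else 0) S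
  rw [hS, koszulTot_empty] at h
  simp only [Finset.card_singleton, dif_pos] at h
  rw [← h]
  refine congrArg (fun c => koszulD M f 0 c S) (funext fun T => ?_)
  rw [dif_pos T.2]

/-- The zeroth homology of the slices of the Koszul complex. -/
theorem exists_koszulSlice_homology_equiv (hI : I.IsHomogeneous (polyGrading k n))
    (ν : Fin q → ℕ) :
    Nonempty (Comp (stageIdeal d I s) ν ≃ₗ[CoeffRing k n d]
      (koszulSlice (genGrading d I) d ν 0 ⧸ LinearMap.range
        (koszulSliceD (genGrading_smul d I) (genericPoly_mem k n d) ν 0))) := by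
  have hS : ∀ S : KIdx s 0, S.1 = ∅ := fun S => Finset.card_eq_zero.1 S.2
  have hpiece : ∀ S : KIdx s 0, shiftedPiece (genGrading d I) (∑ i ∈ S.1, d i) ν =
      genGrading d I ν := by
    intro S
    rw [hS, Finset.sum_empty, shiftedPiece, if_pos (show (0 : Fin q → ℕ) ≤ ν from fun _ => Nat.zero_le _), tsub_zero]
  let c0 : polyGrading (CoeffRing k n d) n ν →ₗ[CoeffRing k n d]
      koszulSlice (genGrading d I) d ν 0 :=
    LinearMap.codRestrict _ (LinearMap.pi fun _ =>
      ((genMk d I).restrictScalars (CoeffRing k n d)) ∘ₗ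
        (polyGrading (CoeffRing k n d) n ν).subtype) (fun y S _ => by
          have h1 : genMk d I y.1 ∈ genGrading d I ν := ⟨y.1, y.2, rfl⟩
          rw [← hpiece S] at h1
          exact h1)
  have hc0 : ∀ y S, (c0 y).1 S = genMk d I y.1 := fun _ _ => rfl
  refine ⟨(compEquivOfKer ((Submodule.mkQ _) ∘ₗ c0) (fun y => ?_) ⊤ ?_).trans Submodule.topEquiv⟩
  · rw [LinearMap.comp_apply, Submodule.mkQ_apply, Submodule.Quotient.mk_eq_zero]
    constructor
    · rintro ⟨c, hc⟩
      have h1 := congrFun (congrArg Subtype.val hc) ⟨∅, rfl⟩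
      have h2 : (koszulD (GenModule d I) (genericPoly k n d) 0 c.1) ⟨∅, rfl⟩ = genMk d I y.1 := h1
      rw [koszulD_zero_apply] at h2
      refine mem_stageIdeal_of_sum d s (b := fun j => c.1 ⟨{j}, Finset.card_singleton j⟩) ?_
      rw [← h2, Finset.filter_true_of_mem fun j _ => j.2]
    · intro hy
      obtain ⟨b, hb, hyb⟩ := exists_sum_of_mem_stageIdeal d hI s y.2 hy
      choose j hj using fun S : KIdx s 1 => Finset.card_eq_one.1 S.2
      refine ⟨⟨fun S => b (j S), fun S _ => ?_⟩, Subtype.ext (funext fun S => ?_)⟩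
      · have h1 := hb (j S)
        rw [← Finset.sum_singleton d (j S), ← hj S] at h1
        exact h1
      · change koszulD (GenModule d I) (genericPoly k n d) 0 (fun S => b (j S)) S = _
        rw [koszulD_zero_apply, hc0, hyb, Finset.filter_true_of_mem fun j _ => j.2]
        refine Finset.sum_congr rfl fun i _ => ?_
        have := hj ⟨{i}, Finset.card_singleton i⟩
        rw [← Finset.singleton_injective this]
  · rw [LinearMap.range_eq_top]
    refine (Submodule.mkQ_surjective _).comp fun c => ?_
    have h1 := c.2 ⟨∅, rfl⟩ trivial
    obtain ⟨y, hy, hyc⟩ := (hpiece ⟨∅, rfl⟩).le h1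
    refine ⟨⟨y, hy⟩, Subtype.ext (funext fun S => ?_)⟩
    have hSe : S = ⟨∅, rfl⟩ := Subtype.ext (hS S)
    rw [hSe, ← hyc]
    rfl

/-! ### Freeness -/

/-- The components of `M[u]` as base changes. -/
def genGradingEquiv (I : Ideal (MvPolynomial (Vars n) k)) (ν : Fin q → ℕ) :
    genGrading d I ν ≃ₗ[CoeffRing k n d]
      TensorProduct k (CoeffRing k n d) (quotGrading k (polyGrading k n) I ν) :=
  (compEquivQuotGrading (extendedIdeal d I) ν).symm.trans
    (compExtEquiv (A := CoeffRing k n d) I ν)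

theorem free_genGrading (ν : Fin q → ℕ) : Module.Free (CoeffRing k n d) (genGrading d I ν) :=
  Module.Free.of_equiv (genGradingEquiv d I ν).symm

theorem finite_genGrading (ν : Fin q → ℕ) : Module.Finite (CoeffRing k n d) (genGrading d I ν) :=
  Module.Finite.equiv (compEquivQuotGrading (extendedIdeal d I) ν)

theorem finrank_genGrading (ν : Fin q → ℕ) :
    Module.finrank (CoeffRing k n d) (genGrading d I ν) =
      Module.finrank k (quotGrading k (polyGrading k n) I ν) :=
  (genGradingEquiv d I ν).finrank_eq.trans Module.finrank_baseChange

/-- A product of submodules as a product of modules. -/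
def submodulePiEquiv {A ι : Type*} [CommRing A] {M : ι → Type*} [∀ i, AddCommGroup (M i)]
    [∀ i, Module A (M i)] (P : ∀ i, Submodule A (M i)) :
    Submodule.pi Set.univ P ≃ₗ[A] ∀ i, P i where
  toFun x i := ⟨x.1 i, x.2 i trivial⟩
  invFun x := ⟨fun i => (x i).1, fun i _ => (x i).2⟩
  map_add' _ _ := rfl
  map_smul' _ _ := rfl
  left_inv _ := rfl
  right_inv _ := rfl

theorem free_shiftedPiece (δ ν : Fin q → ℕ) :
    Module.Free (CoeffRing k n d) (shiftedPiece (genGrading d I) δ ν) := by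
  by_cases h : δ ≤ ν
  · rw [show shiftedPiece (genGrading d I) δ ν = genGrading d I (ν - δ) from if_pos h]
    exact free_genGrading d _
  · rw [show shiftedPiece (genGrading d I) δ ν = ⊥ from if_neg h]
    infer_instance

theorem finite_shiftedPiece (δ ν : Fin q → ℕ) :
    Module.Finite (CoeffRing k n d) (shiftedPiece (genGrading d I) δ ν) := by
  by_cases h : δ ≤ ν
  · rw [show shiftedPiece (genGrading d I) δ ν = genGrading d I (ν - δ) from if_pos h]
    exact finite_genGrading d _
  · rw [show shiftedPiece (genGrading d I) δ ν = ⊥ from if_neg h]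
    infer_instance

theorem free_koszulSlice (ν : Fin q → ℕ) (p : ℕ) :
    Module.Free (CoeffRing k n d) (koszulSlice (genGrading d I) d ν p) := by
  have := fun S : KIdx s p => free_shiftedPiece (I := I) d (∑ i ∈ S.1, d i) ν
  exact Module.Free.of_equiv (submodulePiEquiv fun S : KIdx s p =>
    shiftedPiece (genGrading d I) (∑ i ∈ S.1, d i) ν).symm

theorem finite_koszulSlice (ν : Fin q → ℕ) (p : ℕ) :
    Module.Finite (CoeffRing k n d) (koszulSlice (genGrading d I) d ν p) := by
  have := fun S : KIdx s p => finite_shiftedPiece (I := I) d (∑ i ∈ S.1, d i) ν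
  exact Module.Finite.equiv (submodulePiEquiv fun S : KIdx s p =>
    shiftedPiece (genGrading d I) (∑ i ∈ S.1, d i) ν).symm

theorem subsingleton_koszulSlice (ν : Fin q → ℕ) {p : ℕ} (hp : s < p) :
    Subsingleton (koszulSlice (genGrading d I) d ν p) := by
  have : IsEmpty (KIdx s p) := ⟨fun S => by
    have h1 := S.1.card_le_univ
    rw [S.2, Fintype.card_fin] at h1
    omega⟩
  infer_instance

theorem isComponentwiseFree_genGrading (hI : I.IsHomogeneous (polyGrading k n)) :
    IsComponentwiseFree (CoeffRing k n d) (polyGrading (CoeffRing k n d) n) (genGrading d I) where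
  finite := inferInstance
  multigraded := ⟨genGrading_smul d I, isInternal_quotGrading (isHomogeneous_extendedIdeal d hI)⟩
  free_component := free_genGrading d
  finite_component := finite_genGrading d

/-- Both gradings have the same rank function, hence the same predicate `IsHilbertPoly` and the same
chosen polynomial, without appeal to uniqueness. -/
theorem relevantDim_genGrading :
    relevantDim (CoeffRing k n d) (genGrading d I) =
      relevantDim k (quotGrading k (polyGrading k n) I) := by
  have h : IsHilbertPoly (CoeffRing k n d) (genGrading d I) =
      IsHilbertPoly k (quotGrading k (polyGrading k n) I) := by
    funext P
    simp only [IsHilbertPoly, finrank_genGrading]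
  unfold relevantDim hilbertPoly
  rw [h]

/-! ### Generic exactness -/

/-- The fraction field is flat, which preserves exactness in positive degrees; in degree zero the
annihilator `a` becomes invertible. -/
theorem isGenericallyExact_of_exact {A : Type*} [CommRing A] [IsDomain A] {C : ℕ → Type*}
    [∀ i, AddCommGroup (C i)] [∀ i, Module A (C i)] {D : ∀ i, C (i + 1) →ₗ[A] C i}
    (hC : ∀ i, Function.Exact (D (i + 1)) (D i)) {a : A} (ha : a ≠ 0)
    (h : ∀ x : C 0, a • x ∈ LinearMap.range (D 0)) : IsGenericallyExact A C D := by
  have hflat : Module.Flat A (FractionRing A) := IsLocalization.flat _ (nonZeroDivisors A)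
  refine ⟨fun x => ?_, fun i => ?_⟩
  · induction x using TensorProduct.induction_on with
    | zero => exact ⟨0, map_zero _⟩
    | add x y hx hy =>
      obtain ⟨x', rfl⟩ := hx
      obtain ⟨y', rfl⟩ := hy
      exact ⟨x' + y', map_add _ _ _⟩
    | tmul r x =>
      obtain ⟨c, hc⟩ := h x
      have ha' : algebraMap A (FractionRing A) a ≠ 0 :=
        (map_ne_zero_iff _ (IsFractionRing.injective A (FractionRing A))).2 ha
      refine ⟨(r / algebraMap A (FractionRing A) a) ⊗ₜ c, ?_⟩
      rw [LinearMap.baseChange_tmul, hc, ← TensorProduct.smul_tmul, Algebra.smul_def,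
        mul_div_cancel₀ _ ha']
  · exact Module.Flat.lTensor_exact (FractionRing A) (hC i)

end Translation

end MultiRes

end

noncomputable section

namespace MultiRes

open MvPolynomial

/-! ### Specialization of one generic polynomial -/

section Specialization

variable {k : Type*} [Field k] {σ : Type*}

theorem degreeOf_pos_of_mem_vars {π : MvPolynomial σ k} {w : σ} (h : w ∈ π.vars) :
    0 < degreeOf w π := by
  classical
  rw [degreeOf_def, Multiset.count_pos]
  rwa [vars_def, Multiset.mem_toFinset] at h

theorem degreeOf_eq_zero_of_notMem {f : MvPolynomial σ k} {w : σ} (h : w ∉ f.vars) :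
    degreeOf w f = 0 := by
  classical
  rw [degreeOf_def, Multiset.count_eq_zero]
  rwa [vars_def, Multiset.mem_toFinset] at h

/-- The polynomials that omit some variable occurring in `π`, modulo `π`. -/
def renameMk (π : MvPolynomial σ k) (P : σ → Prop) :
    MvPolynomial {c // P c} k →+* MvPolynomial σ k ⧸ Ideal.span {π} :=
  (Ideal.Quotient.mk (Ideal.span {π})).comp (rename (Subtype.val : {c // P c} → σ)).toRingHom

/-- Degrees in a single variable add in products, so a nonzero multiple of `π` has positive degree
in `w` and cannot omit `w`. -/
theorem renameMk_injective {π : MvPolynomial σ k} (hπ : π ≠ 0) {w : σ} (hw : w ∈ π.vars)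
    {P : σ → Prop} (hP : ¬ P w) : Function.Injective (renameMk π P) := by
  classical
  rw [injective_iff_map_eq_zero]
  intro f hf
  by_contra hf0
  have h1 : rename (Subtype.val : {c // P c} → σ) f ∈ Ideal.span {π} :=
    Ideal.Quotient.eq_zero_iff_mem.1 hf
  obtain ⟨h, hh⟩ := Ideal.mem_span_singleton.1 h1
  have h2 : rename (Subtype.val : {c // P c} → σ) f ≠ 0 := fun h0 =>
    hf0 (rename_injective _ Subtype.val_injective (h0.trans (map_zero _).symm))
  have h3 : degreeOf w (rename (Subtype.val : {c // P c} → σ) f) = 0 := by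
    refine degreeOf_eq_zero_of_notMem fun h4 => ?_
    obtain ⟨c, -, rfl⟩ := Finset.mem_image.1 (vars_rename _ _ h4)
    exact hP c.2
  have hne : h ≠ 0 := by
    rintro rfl
    exact h2 (hh.trans (mul_zero _))
  rw [hh, degreeOf_mul_eq hπ hne] at h3
  have := degreeOf_pos_of_mem_vars hw
  omega

theorem exists_mem_vars_of_prime {π : MvPolynomial σ k} (hπ : Prime π) : ∃ w, w ∈ π.vars := by
  by_contra h
  have h1 := vars_eq_empty_iff_eq_C.1 (Finset.eq_empty_of_forall_notMem (not_exists.1 h))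
  refine hπ.not_isUnit (MvPolynomial.isUnit_iff_eq_C_of_isReduced.2 ⟨_, ?_, h1⟩)
  refine IsUnit.mk0 _ fun h0 => hπ.ne_zero ?_
  rw [h1, h0, map_zero]

variable {q s : ℕ} {n : Fin q → ℕ} (d : Fin s → Fin q → ℕ) (i : Fin s) (δ : Fin q → ℕ)

theorem mem_monomials_of_ne {c : CoeffIdx n (Function.update d i δ)} (h : c.1 ≠ i) :
    c.2.1 ∈ monomials n (d c.1) := by
  have h1 := (mem_monomials _ _ _).1 c.2.2
  exact (mem_monomials _ _ _).2 (h1.trans (Function.update_of_ne h _ _))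

/-- Substitution of the elements `t` for the coefficients of the `i`-th generic polynomial, whose
multidegree `δ` is arbitrary. -/
def specialize (t : (Vars n →₀ ℕ) → CoeffRing k n d) :
    CoeffRing k n (Function.update d i δ) →ₐ[k] CoeffRing k n d :=
  aeval fun c => if h : c.1 = i then t c.2.1 else X ⟨c.1, ⟨c.2.1, mem_monomials_of_ne d i δ h⟩⟩

/-- The polynomial of multidegree `δ` with coefficients `t`. -/
def polyOfCoeff (t : (Vars n →₀ ℕ) → CoeffRing k n d) : MvPolynomial (Vars n) (CoeffRing k n d) :=
  ∑ m : monomials n δ, monomial m.1 (t m.1)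

theorem polyOfCoeff_mem (t : (Vars n →₀ ℕ) → CoeffRing k n d) :
    polyOfCoeff d δ t ∈ polyGrading (CoeffRing k n d) n δ :=
  Submodule.sum_mem _ fun m _ =>
    isWeightedHomogeneous_monomial _ _ _ ((mem_monomials n δ m.1).1 m.2)

theorem map_specialize_genericPoly_self (t : (Vars n →₀ ℕ) → CoeffRing k n d) :
    MvPolynomial.map (specialize d i δ t).toRingHom
      (genericPoly k n (Function.update d i δ) i) = polyOfCoeff d δ t := by
  rw [genericPoly, map_sum, polyOfCoeff]
  refine Fintype.sum_equiv (Equiv.subtypeEquivRight fun e => by rw [Function.update_self]) _ _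
    fun m => ?_
  rw [map_monomial]
  congr 1
  simp [specialize]

theorem map_specialize_genericPoly {j : Fin s} (hj : j ≠ i)
    (t : (Vars n →₀ ℕ) → CoeffRing k n d) :
    MvPolynomial.map (specialize d i δ t).toRingHom
      (genericPoly k n (Function.update d i δ) j) = genericPoly k n d j := by
  rw [genericPoly, map_sum, genericPoly]
  refine Fintype.sum_equiv (Equiv.subtypeEquivRight fun e => by rw [Function.update_of_ne hj]) _ _
    fun m => ?_
  rw [map_monomial]
  congr 1
  simp only [specialize, AlgHom.toRingHom_eq_coe, RingHom.coe_coe, aeval_X, dif_neg hj]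
  rfl

theorem map_specialize_mem (I : Ideal (MvPolynomial (Vars n) k))
    (t : (Vars n →₀ ℕ) → CoeffRing k n d)
    {y : MvPolynomial (Vars n) (CoeffRing k n (Function.update d i δ))}
    (hy : y ∈ stageIdeal (Function.update d i δ) I s) :
    MvPolynomial.map (specialize d i δ t).toRingHom y ∈
      stageIdeal d I s ⊔ Ideal.span {polyOfCoeff d δ t} := by
  suffices h : stageIdeal (Function.update d i δ) I s ≤
      (stageIdeal d I s ⊔ Ideal.span {polyOfCoeff d δ t}).comap
        (MvPolynomial.map (specialize d i δ t).toRingHom) from h hy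
  refine sup_le (Ideal.map_le_iff_le_comap.2 fun z hz => ?_) (Ideal.span_le.2 ?_)
  · refine Ideal.mem_comap.2 (Ideal.mem_comap.2 (Ideal.mem_sup_left (Ideal.mem_sup_left ?_)))
    rw [MvPolynomial.map_map]
    have h1 : (specialize d i δ t).toRingHom.comp C = (C : k →+* CoeffRing k n d) :=
      RingHom.ext fun a => (specialize d i δ t).commutes a
    rw [h1]
    exact Ideal.mem_map_of_mem _ hz
  · rintro _ ⟨j, -, rfl⟩
    refine Ideal.mem_comap.2 ?_
    by_cases hj : j = i
    · subst hj
      rw [map_specialize_genericPoly_self]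
      exact Ideal.mem_sup_right (Ideal.mem_span_singleton_self _)
    · rw [map_specialize_genericPoly d i δ hj]
      exact Ideal.mem_sup_left (Ideal.mem_sup_right (Ideal.subset_span ⟨j, j.2, rfl⟩))

/-- Transfers an annihilator for the modified index to one modulo J_s and the specialized form. It
suffices to treat monomials, which the specialization fixes. -/
theorem specialize_smul_mem (I : Ideal (MvPolynomial (Vars n) k))
    (t : (Vars n →₀ ℕ) → CoeffRing k n d) {ν : Fin q → ℕ}
    {a : CoeffRing k n (Function.update d i δ)}
    (ha : ∀ y ∈ polyGrading (CoeffRing k n (Function.update d i δ)) n ν,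
      a • y ∈ stageIdeal (Function.update d i δ) I s)
    {y : MvPolynomial (Vars n) (CoeffRing k n d)}
    (hy : y ∈ polyGrading (CoeffRing k n d) n ν) :
    specialize d i δ t a • y ∈ stageIdeal d I s ⊔ Ideal.span {polyOfCoeff d δ t} := by
  rw [polyGrading_eq_span] at hy
  induction hy using Submodule.span_induction with
  | mem y hy =>
    obtain ⟨e, he, rfl⟩ := hy
    have h1 : monomial e (1 : CoeffRing k n (Function.update d i δ)) ∈
        polyGrading (CoeffRing k n (Function.update d i δ)) n ν :=
      isWeightedHomogeneous_monomial _ _ _ ((mem_monomials n ν e).1 he)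
    have h2 := map_specialize_mem d i δ I t (ha _ h1)
    rw [smul_eq_C_mul, map_mul, map_C, map_monomial, map_one] at h2
    rw [smul_eq_C_mul]
    exact h2
  | zero =>
    rw [smul_zero]
    exact zero_mem _
  | add y z _ _ hy hz =>
    rw [smul_add]
    exact add_mem hy hz
  | smul c y _ hy =>
    rw [smul_comm, smul_eq_C_mul]
    exact Ideal.mul_mem_left _ _ hy

/-- The index of a coefficient, with the coefficients of the `i`-th generic polynomial separated
from the others. -/
def splitIdx (c : CoeffIdx n (Function.update d i δ)) :
    (Vars n →₀ ℕ) ⊕ {c : CoeffIdx n d // c.1 ≠ i} :=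
  if h : c.1 = i then Sum.inl c.2.1 else
    Sum.inr ⟨⟨c.1, ⟨c.2.1, mem_monomials_of_ne d i δ h⟩⟩, h⟩

theorem splitIdx_injective : Function.Injective (splitIdx (n := n) d i δ) := by
  rintro ⟨j, m⟩ ⟨j', m'⟩ h
  unfold splitIdx at h
  dsimp only at h
  split_ifs at h with h1 h2 h2
  · subst h1
    subst h2
    rw [Sum.inl.injEq] at h
    rw [Subtype.ext h]
  · rw [Sum.inr.injEq, Subtype.mk.injEq, Sigma.mk.injEq] at h
    obtain ⟨rfl, h⟩ := h
    have h3 := congrArg Subtype.val (eq_of_heq h)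
    rw [show m = m' from Subtype.ext h3]

/-- Some specialization of a nonzero polynomial is not divisible by a given prime in which a
coefficient of the `i`-th generic polynomial occurs. -/
theorem exists_specialize_not_dvd {π : CoeffRing k n d} (hπ : Prime π) {w : CoeffIdx n d}
    (hw : w ∈ π.vars) (hw' : ∃ w' : CoeffIdx n d, w' ≠ w)
    {a : CoeffRing k n (Function.update d w.1 δ)} (ha : a ≠ 0) :
    ∃ t : (Vars n →₀ ℕ) → CoeffRing k n d, ¬ π ∣ specialize d w.1 δ t a := by
  have hprime : (Ideal.span {π}).IsPrime := isPrime_span_of_prime hπ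
  -- Even over a finite field the quotient is infinite, since it contains a polynomial ring in the
  -- coefficients other than `w`.
  have hinf : Infinite (CoeffRing k n d ⧸ Ideal.span {π}) := by
    obtain ⟨w', hw'⟩ := hw'
    have : Nonempty {c : CoeffIdx n d // c ≠ w} := ⟨⟨w', hw'⟩⟩
    exact Infinite.of_injective _
      (renameMk_injective (P := fun c => c ≠ w) hπ.ne_zero hw (not_not.2 rfl))
  let g := renameMk π fun c : CoeffIdx n d => c.1 ≠ w.1
  have hg : Function.Injective g := renameMk_injective hπ.ne_zero hw (not_not.2 rfl)
  -- The coefficients of the replaced polynomial remain indeterminates, and the others are reduced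
  -- modulo `π`. The latter omit `w`, so the reduction is injective on them and `Φ a` is nonzero.
  let Φ : CoeffRing k n (Function.update d w.1 δ) →+*
      MvPolynomial (Vars n →₀ ℕ) (CoeffRing k n d ⧸ Ideal.span {π}) :=
    (MvPolynomial.map g).comp ((sumAlgEquiv k _ _).toAlgHom.toRingHom.comp
      (rename (splitIdx d w.1 δ)).toRingHom)
  have hΦ : Function.Injective Φ :=
    (map_injective g hg).comp ((sumAlgEquiv k _ _).injective.comp
      (rename_injective _ (splitIdx_injective d w.1 δ)))
  have hΦa : Φ a ≠ 0 := fun h => ha (hΦ (h.trans (map_zero Φ).symm))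
  -- A nonzero polynomial over an infinite domain has a point where it does not vanish; lifting the
  -- point to k[u] gives `t`.
  have hex : ∃ u : (Vars n →₀ ℕ) → CoeffRing k n d ⧸ Ideal.span {π}, eval u (Φ a) ≠ 0 := by
    by_contra! h
    exact hΦa (MvPolynomial.funext fun u => (h u).trans (map_zero _).symm)
  obtain ⟨u, hu⟩ := hex
  choose t ht using fun e => Ideal.Quotient.mk_surjective (u e)
  refine ⟨t, fun hdvd => hu ?_⟩
  have hcomp : (eval u).comp Φ = (Ideal.Quotient.mk (Ideal.span {π})).comp
      (specialize d w.1 δ t).toRingHom := by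
    refine MvPolynomial.ringHom_ext (fun c => ?_) fun c => ?_
    · simp [Φ, specialize, g, renameMk]
    · by_cases hc : c.1 = w.1
      · simp [Φ, specialize, splitIdx, hc, ht]
      · simp [Φ, specialize, splitIdx, hc, g, renameMk]
  have h1 := RingHom.congr_fun hcomp a
  refine h1.trans (Ideal.Quotient.eq_zero_iff_mem.2 (Ideal.mem_span_singleton.2 hdvd))

/-- If `d i` has a nonzero entry at p, the first and the last variable of group p, distinct since
n_p > 0, yield two monomials of multidegree `d i`. -/
theorem exists_coeffIdx_ne (hn : ∀ p, 0 < n p) (hd : ∀ i, d i ≠ 0) (w : CoeffIdx n d) :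
    ∃ w' : CoeffIdx n d, w' ≠ w := by
  by_contra! h
  obtain ⟨p, hp⟩ := Function.ne_iff.1 (hd w.1)
  have h1 : (⟨w.1, ⟨_, powerMonomial_mem (d w.1) fun _ => 0⟩⟩ : CoeffIdx n d) =
      ⟨w.1, ⟨_, powerMonomial_mem (d w.1) fun _ => Fin.last _⟩⟩ := (h _).trans (h _).symm
  rw [Sigma.mk.injEq] at h1
  have h2 := DFunLike.congr_fun (congrArg Subtype.val (eq_of_heq h1.2)) ⟨p, 0⟩
  have h3 : (0 : Fin (n p + 1)) ≠ Fin.last (n p) := by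
    intro h0
    have h4 := congrArg Fin.val h0
    have h5 := hn p
    rw [Fin.val_zero, Fin.val_last] at h4
    omega
  simp only [powerMonomial_apply, if_pos, if_neg h3] at h2
  exact hp h2

end Specialization

/-! ### Monotonicity and stabilization of the local lengths -/

section Monotonicity

variable {k : Type*} [Field k] {q s : ℕ} {n : Fin q → ℕ} (d : Fin s → Fin q → ℕ)
  {I : Ideal (MvPolynomial (Vars n) k)}

/-- The local lengths of the components of `𝓜(I)` eventually do not increase. -/
theorem eventually_lenLoc_le (hn : ∀ p, 0 < n p) (hI : I.IsHomogeneous (polyGrading k n))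
    (hs : relevantDim k (quotGrading k (polyGrading k n) I) = (s : ℤ) - 1) (hd : ∀ i, d i ≠ 0) :
    ∀ᶠ ν in atTop, ∀ (p : Fin q) (π : CoeffRing k n d) (hπ : Prime π),
      lenLoc (primeCompl hπ) (Comp (stageIdeal d I s) (Pi.single p 1 + ν)) ≤
        lenLoc (primeCompl hπ) (Comp (stageIdeal d I s) ν) := by
  have h : ∀ (i : Fin s) (p : Fin q), ∀ᶠ ν in atTop,
      ∃ a : CoeffRing k n (Function.update d i (Pi.single p 1)), a ≠ 0 ∧
        ∀ y ∈ polyGrading (CoeffRing k n (Function.update d i (Pi.single p 1))) n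
          (Pi.single p 1 + ν), a • y ∈ stageIdeal (Function.update d i (Pi.single p 1)) I s :=
    fun i p => (tendsto_add_atTop (Pi.single p 1)).eventually (eventually_exists_smul_mem _ hI hs)
  filter_upwards [eventually_all.2 fun i => eventually_all.2 (h i)] with ν hν p π hπ
  -- The index of the polynomial to be replaced depends on π, which is why ν is chosen beforehand to
  -- work for all indices at once.
  obtain ⟨w, hw⟩ := exists_mem_vars_of_prime hπ
  obtain ⟨a, ha, haν⟩ := hν w.1 p
  obtain ⟨t, ht⟩ := exists_specialize_not_dvd d _ hπ hw (exists_coeffIdx_ne d hn hd w) ha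
  have hℓ := polyOfCoeff_mem (k := k) d (Pi.single p 1) t
  refine lenLoc_le_of_smul_mem_range _ (compMul (J := stageIdeal d I s) (J' := stageIdeal d I s) hℓ
    fun y _ hy => Ideal.mul_mem_left _ _ hy) fun y => ?_
  refine ⟨_, (mem_primeCompl hπ).2 ht, ?_⟩
  obtain ⟨y, rfl⟩ := Submodule.Quotient.mk_surjective _ y
  have h1 := specialize_smul_mem d w.1 _ I t haν y.2
  obtain ⟨z, hz, hyz⟩ := exists_of_mem_sup_span (isHomogeneous_stageIdeal d hI s) hℓ
    (Submodule.smul_mem _ _ y.2) h1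
  refine ⟨Submodule.Quotient.mk ⟨z, hz⟩, ?_⟩
  rw [compMul_mk, ← Submodule.Quotient.mk_smul, eq_comm, Submodule.Quotient.eq]
  exact hyz

theorem le_of_step_le {α : Type*} [Preorder α] {F : (Fin q → ℕ) → α} {ν1 : Fin q → ℕ}
    (h : ∀ ν, ν1 ≤ ν → ∀ p, F (Pi.single p 1 + ν) ≤ F ν) {ν ν' : Fin q → ℕ} (hν : ν1 ≤ ν)
    (hνν' : ν ≤ ν') : F ν' ≤ F ν := by
  obtain ⟨μ, rfl⟩ := exists_add_of_le hνν'
  have key : ∀ (μ : Fin q →₀ ℕ) (ν), ν1 ≤ ν → F (⇑μ + ν) ≤ F ν := by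
    intro μ
    induction μ using Finsupp.induction_linear with
    | zero => intro ν _; simp
    | add μ μ' h h' =>
      intro ν hν
      rw [Finsupp.coe_add, add_assoc]
      exact (h _ (hν.trans le_add_self)).trans (h' ν hν)
    | single p m =>
      induction m with
      | zero => intro ν _; simp
      | succ m ih =>
        intro ν hν
        rw [Nat.add_comm m 1, Finsupp.single_add, Finsupp.coe_add, add_assoc,
          Finsupp.single_eq_pi_single p 1]
        exact (h _ (hν.trans le_add_self) p).trans (ih ν hν)
  rw [add_comm]
  exact key (Finsupp.equivFunOnFinite.symm μ) ν hν

/-- A function to a well-founded order that eventually does not increase is eventually constant. -/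
theorem exists_eq_of_step_le {α : Type*} [LinearOrder α] [WellFoundedLT α] {F : (Fin q → ℕ) → α}
    {ν1 : Fin q → ℕ} (h : ∀ ν, ν1 ≤ ν → ∀ p, F (Pi.single p 1 + ν) ≤ F ν) :
    ∃ ν2, ν1 ≤ ν2 ∧ ∀ ν, ν2 ≤ ν → F ν = F ν2 := by
  obtain ⟨x, ⟨ν2, hν2, rfl⟩, hmin⟩ := WellFounded.has_min (wellFounded_lt (α := α))
    (F '' Set.Ici ν1) ⟨_, ν1, le_refl ν1, rfl⟩
  refine ⟨ν2, hν2, fun ν hν => le_antisymm (le_of_step_le h hν2 hν) ?_⟩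
  exact not_lt.1 (hmin _ ⟨ν, hν2.trans hν, rfl⟩)

/-- The contents of the components of `𝓜(I)` are eventually constant. -/
theorem exists_eventually_content_eq (hn : ∀ p, 0 < n p) (hI : I.IsHomogeneous (polyGrading k n))
    (hs : relevantDim k (quotGrading k (polyGrading k n) I) = (s : ℤ) - 1) (hd : ∀ i, d i ≠ 0)
    (irr : IrrSystem (CoeffRing k n d)) :
    ∃ F, ∀ᶠ ν in atTop, content irr (Comp (stageIdeal d I s) ν) = F := by
  obtain ⟨ν1, h1⟩ := eventually_atTop.1 ((eventually_lenLoc_le d hn hI hs hd).and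
    (eventually_exists_smul_mem d hI hs))
  obtain ⟨a, ha, haν⟩ := (h1 ν1 le_rfl).2
  have ha0 : ∀ x : Comp (stageIdeal d I s) ν1, a • x = 0 := by
    intro x
    obtain ⟨y, rfl⟩ := Submodule.Quotient.mk_surjective _ x
    rw [← Submodule.Quotient.mk_smul, comp_mk_eq_zero]
    exact haν y.1 y.2
  let L : irr.carrier → (Fin q → ℕ) → ℕ∞ := fun π ν =>
    lenLoc (primeCompl (irr.irreducible π.1 π.2).prime) (Comp (stageIdeal d I s) ν)
  have hL : ∀ π ν, ν1 ≤ ν → ∀ p, L π (Pi.single p 1 + ν) ≤ L π ν := fun π ν hν p =>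
    (h1 ν hν).1 p π.1 _
  choose ν2 hν2 hc using fun π => exists_eq_of_step_le (hL π)
  set T := (finite_dvd_irrSystem irr ha).toFinset
  refine ⟨content irr (Comp (stageIdeal d I s) (ν1 + ∑ π ∈ T, ν2 π)), ?_⟩
  filter_upwards [eventually_ge_atTop (ν1 + ∑ π ∈ T, ν2 π)] with ν hν
  refine content_congr irr fun π => ?_
  rw [localLength_eq, localLength_eq]
  congr 1
  change L π ν = L π (ν1 + ∑ π ∈ T, ν2 π)
  by_cases hπ : π.1 ∣ a
  · have h2 : ν2 π ≤ ν1 + ∑ π ∈ T, ν2 π :=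
      (Finset.single_le_sum (f := ν2) (fun _ _ _ => Nat.zero_le _)
        ((Set.Finite.mem_toFinset _).2 hπ)).trans le_add_self
    rw [hc π _ h2, hc π _ (h2.trans hν)]
  -- A prime not dividing `a` has length 0 at `ν1`, hence at all larger multidegrees by
  -- monotonicity. Only the finitely many prime divisors of `a` need a bound `ν2`.
  · have h2 : L π ν1 = 0 := lenLoc_eq_zero _ ((mem_primeCompl _).2 hπ) ha0
    have h3 : ∀ ν, ν1 ≤ ν → L π ν = 0 := fun ν hν =>
      le_antisymm ((le_of_step_le (hL π) le_rfl hν).trans h2.le) (zero_le)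
    rw [h3 _ le_self_add, h3 _ (le_self_add.trans hν)]

end Monotonicity

end MultiRes

end

noncomputable section

namespace MultiRes

open MvPolynomial

/-! ### Comparison of the content with the Cayley determinant -/

section Comparison

variable {k : Type*} [Field k] {q s : ℕ} {n : Fin q → ℕ} (d : Fin s → Fin q → ℕ)
  {I : Ideal (MvPolynomial (Vars n) k)}

theorem content_elimGrading (irr : IrrSystem (CoeffRing k n d)) (ν : Fin q → ℕ) :
    content irr (elimGrading d I ν) = content irr (Comp (stageIdeal d I s) ν) :=
  content_congr irr fun π => by
    rw [localLength_eq, localLength_eq, lenLoc_congr _ (compEquivElim d I ν)]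

theorem eventually_exists_smul_comp_eq_zero (hI : I.IsHomogeneous (polyGrading k n))
    (hs : relevantDim k (quotGrading k (polyGrading k n) I) = (s : ℤ) - 1) :
    ∀ᶠ ν in atTop, ∃ a : CoeffRing k n d, a ≠ 0 ∧ ∀ x : Comp (stageIdeal d I s) ν, a • x = 0 := by
  filter_upwards [eventually_exists_smul_mem d hI hs] with ν ⟨a, ha, h⟩
  refine ⟨a, ha, fun x => ?_⟩
  obtain ⟨y, rfl⟩ := Submodule.Quotient.mk_surjective _ x
  rw [← Submodule.Quotient.mk_smul, comp_mk_eq_zero]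
  exact h y.1 y.2

/-- The contents of `𝓜(I)` and the Cayley determinants of the Koszul complex agree. -/
theorem eventually_isCayleyDet_content (hI : I.IsHomogeneous (polyGrading k n))
    (hs : relevantDim k (quotGrading k (polyGrading k n) I) = (s : ℤ) - 1)
    (irr : IrrSystem (CoeffRing k n d)) :
    ∀ᶠ ν in atTop,
      IsGenericallyExact (CoeffRing k n d) (fun p => koszulSlice (genGrading d I) d ν p)
        (koszulSliceD (genGrading_smul d I) (genericPoly_mem k n d) ν) ∧
      IsCayleyDet (CoeffRing k n d) (fun p => koszulSlice (genGrading d I) d ν p)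
        (koszulSliceD (genGrading_smul d I) (genericPoly_mem k n d) ν) s
        (content irr (Comp (stageIdeal d I s) ν)) := by
  filter_upwards [eventually_exact_koszulSliceD d hI,
    eventually_exists_smul_comp_eq_zero d hI hs] with ν hex ⟨a, ha, haν⟩
  obtain ⟨e⟩ := exists_koszulSlice_homology_equiv d hI ν
  have haQ : ∀ x : koszulSlice (genGrading d I) d ν 0 ⧸ LinearMap.range
      (koszulSliceD (genGrading_smul d I) (genericPoly_mem k n d) ν 0), a • x = 0 := by
    intro x
    obtain ⟨y, rfl⟩ := e.surjective x
    rw [← map_smul, haν, map_zero]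
  have hfree := free_koszulSlice (I := I) d ν
  have hfin := finite_koszulSlice (I := I) d ν
  refine ⟨isGenericallyExact_of_exact hex ha fun x => ?_, ?_, fun b => ?_⟩
  · rw [← Submodule.Quotient.mk_eq_zero, Submodule.Quotient.mk_smul]
    exact haQ _
  · refine nonempty_cayleyData hfree hfin hex (fun p hp => subsingleton_koszulSlice d ν hp) ?_
    have := hfin 0
    rw [Module.finrank_eq_zero_iff_isTorsion]
    exact fun x => ⟨⟨a, mem_nonZeroDivisors_of_ne_zero ha⟩, haQ x⟩
  · refine b.exists_det_eq hex (content_ne_zero irr ha haν) fun π hπ => ?_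
    have hlen := fun {π : CoeffRing k n d} (hπ : Prime π) => lenLoc_congr (primeCompl hπ) e
    rw [← hlen hπ]
    refine emultiplicity_content irr ha haν (fun π' hπ' => ?_) hπ
    rw [hlen hπ']
    exact b.lenLoc_ne_top hex hπ'

theorem annihilator_ne_bot {A N : Type*} [CommRing A] [AddCommGroup N] [Module A N] {a : A}
    (ha : a ≠ 0) (h : ∀ x : N, a • x = 0) : Module.annihilator A N ≠ ⊥ :=
  fun h0 => ha ((Submodule.eq_bot_iff _).1 h0 a (Module.mem_annihilator.2 h))

theorem exists_C_mul_eq_of_units {σ : Type*} {x y : MvPolynomial σ k} (c c' : (MvPolynomial σ k)ˣ)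
    (h : (c : MvPolynomial σ k) * x = c' * y) : ∃ e : k, e ≠ 0 ∧ x = C e * y := by
  obtain ⟨e, he, hce⟩ := MvPolynomial.isUnit_iff_eq_C_of_isReduced.1 (c⁻¹ * c').isUnit
  refine ⟨e, he.ne_zero, ?_⟩
  rw [← hce, Units.val_mul, mul_assoc, ← h, Units.inv_mul_cancel_left]

end Comparison

end MultiRes

end

theorem mainTheorem3 {k : Type*} [Field k] {q : ℕ} (hq : 0 < q) (n : Fin q → ℕ)
    (hn : ∀ p, 0 < n p) (I : Ideal (MvPolynomial (MultiRes.Vars n) k))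
    (hI : I.IsHomogeneous (MultiRes.polyGrading k n)) (s : ℕ)
    (hs : MultiRes.relevantDim k (MultiRes.quotGrading k (MultiRes.polyGrading k n) I) = (s : ℤ) - 1)
    (d : Fin s → Fin q → ℕ) (hd : ∀ i, d i ≠ 0)
    (irr : MultiRes.IrrSystem (MultiRes.CoeffRing k n d)) :
    ∃ Rres : MultiRes.CoeffRing k n d,
      MultiRes.IsResultantForm d irr I Rres ∧
      (∃ Kres : MultiRes.CoeffRing k n d, MultiRes.IsGenericMResultant d I Kres) ∧
      ∀ Kres : MultiRes.CoeffRing k n d, MultiRes.IsGenericMResultant d I Kres →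
        ∃ c : k, c ≠ 0 ∧ Rres = MvPolynomial.C c * Kres := by
  obtain ⟨F, hF⟩ := MultiRes.exists_eventually_content_eq d hn hI hs hd irr
  have hdet := MultiRes.eventually_isCayleyDet_content d hI hs irr
  refine ⟨F, ?_, ⟨F, ?_⟩, fun Kres hK => ?_⟩
  · filter_upwards [hF, MultiRes.eventually_exists_smul_comp_eq_zero d hI hs] with ν hν ⟨a, ha, haν⟩
    refine ⟨MultiRes.annihilator_ne_bot ha fun x => ?_, ?_⟩
    · obtain ⟨y, rfl⟩ := (MultiRes.compEquivElim d I ν).surjective x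
      rw [← map_smul, haν, map_zero]
    · rw [MultiRes.content_elimGrading, hν]
  · refine ⟨MultiRes.isComponentwiseFree_genGrading d hI, ?_,
      MultiRes.isFilterRegularSeq_genericPoly d hI, ?_⟩
    · rw [MultiRes.relevantDim_genGrading, hs]
    · filter_upwards [hF, hdet] with ν hν h
      rwa [hν] at h
  · obtain ⟨ν, hν, h, hKν⟩ := (hF.and (hdet.and hK.eventually_det)).exists
    obtain ⟨⟨b⟩, hb⟩ := h.2
    rw [hν] at hb
    obtain ⟨c, hc⟩ := hb b
    obtain ⟨c', hc'⟩ := hKν.2.2 b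
    exact MultiRes.exists_C_mul_eq_of_units c c'
      (IsFractionRing.injective _ (FractionRing (MultiRes.CoeffRing k n d)) (hc.symm.trans hc'))
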